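/- Let $0<L<2\pi$, $\Lambda=\mathbb R/L\mathbb Z$, and let $(e_k)_{k\in\mathbb Z}$ be the orthonormal basis of $L^2(\Lambda)$ given by $e_0=1/\sqrt L$, $e_k(x)=\sqrt{2/L}\cos(2k\pi x/L)$ for $k>0$ and $e_k(x)=\sqrt{2/L}\sin(2k\pi x/L)$ for $k<0$. For $N\in\mathbb N_0$ let $E_N=\operatorname{span}\{e_k:|k|\le N\}$ with the $L^2$ inner product and Lebesgue measure $d\phi$, and let $E_{\perp,N}\subset E_N$ be the subspace of mean-zero functions, with Laplacian $\Delta_\perp=\Delta_{\perp,N}$. Let $$V(\phi)=\int_0^L\Bigl[\tfrac12\phi'(x)^2+\tfrac14(\phi(x)^2-1)^2\Bigr]dx,\qquad V_0(y)=\tfrac L4\Bigl(\tfrac{y^2}{L}-1\Bigr)^2,\qquad \nu_0=2,\quad \mu_0=-1 .$$ For $\varepsilon>0$ and disjoint closed sets $A,B\subset E_N$, let $\mathcal L=\varepsilon e^{V/\varepsilon}\nabla\cdot e^{-V/\varepsilon}\nabla$ and let $h_{AB}$ be the equilibrium potential, i.e. the weak solution of $\mathcal L h=0$ on $(A\cup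 B)^c$ with $0\le h\le 1$, $h=1$ on $A$ and $h=0$ on $B$: $h_{AB}$ is a limit, in $L^2(e^{-V/\varepsilon}d\phi)$ together with the gradients, of Lipschitz functions with values in $[0,1]$ equal to $1$ on $A$ and $0$ on $B$. The equilibrium measure is the measure $e_{AB}=-\mathcal L h_{AB}$ on $\partial A$, in the weak sense that $\varepsilon\int e^{-V/\varepsilon}\nabla h_{AB}\cdot\nabla f\,d\phi=\int e^{-V/\varepsilon}f\,de_{AB}$ for all $f\in C_c^\infty(B^c)$, and the capacity is $\operatorname{cap}(A,B)=\int_{\partial A}e^{-V/\varepsilon}\,de_{AB}$. (i) There are constants $C,\varepsilon_0>0$, depending only on $L$, such that for all $N\ge0$ and $0<\varepsilon<\varepsilon_0$ the function $e^{-V/\varepsilon}$ is integrable on $E_N$ and $$\mathcal Z_N:=\int_{E_N}e^{-V(\phi)/\varepsilon}\,d\phi=2\,\frac{(2\pi\varepsilon)^{N+1/2}}{\sqrt{\nu_0\det(-\Delta_\perp+2)}}\,[1+r],\qquad |r|\le C\varepsilon .$$ (ii) For every $0<\delta<\sqrt L$ and $s<\tfrac12$ there are constants $C,\varepsilon_0>0$,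 depending only on $L,\delta,s$, such that the following holds for all $N\ge0$ and $0<\varepsilon<\varepsilon_0$. Write $\phi\in E_N$ as $\phi=\phi_0e_0+\sqrt\varepsilon\,\phi_\perp$ with $\phi_\perp\in E_{\perp,N}$. Let $D_\perp\subset E_{\perp,N}$ be any closed set containing the ball $\{\psi:\|\psi\|_{H^s}<\sqrt{\log(\varepsilon^{-1})}\}$, where $\|\psi\|_{H^s}^2=\sum_k(1+k^2)^s\langle e_k,\psi\rangle^2$, and let $$A=\{\phi:|\phi_0+\sqrt L|\le\delta,\ \phi_\perp\in D_\perp\},\qquad B=-A .$$ Then $\operatorname{cap}(A,B)$ is well defined (it exists and is unique) and $$\operatorname{cap}(A,B)=\frac{(2\pi\varepsilon)^{N+1/2}\sqrt{|\mu_0|}\,e^{-V_0(0)/\varepsilon}}{2\pi\sqrt{\det(-\Delta_\perp-1)}}\,[1+r],\qquad |r|\le C\varepsilon .$$ -/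

import Mathlib

open MeasureTheory Filter Topology
open scoped ContDiff

noncomputable section

namespace AllenCahn

/-! ### Potential theory of the diffusion `dy = -∇V(y) dt + √(2ε) dW` on `ℝ^ι` -/

section PotentialTheory

variable {ι : Type*} [Fintype ι]

/-- The reversible (unnormalised Gibbs) measure `e^{-V(y)/ε} dy`. -/
def gibbsMeasure (V : EuclideanSpace ℝ ι → ℝ) (ε : ℝ) : Measure (EuclideanSpace ℝ ι) :=
  volume.withDensity fun y => ENNReal.ofReal (Real.exp (-V y / ε))

/-- The partition function `∫ e^{-V(y)/ε} dy`. -/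
def partitionFunction (V : EuclideanSpace ℝ ι → ℝ) (ε : ℝ) : ℝ :=
  ∫ y, Real.exp (-V y / ε)

/-- The bilinear Dirichlet form `ε ∫ e^{-V(y)/ε} F(y) · G(y) dy`, as a function of the
two gradient fields `F` and `G`. -/
def dirichletForm (V : EuclideanSpace ℝ ι → ℝ) (ε : ℝ)
    (F G : EuclideanSpace ℝ ι → EuclideanSpace ℝ ι) : ℝ :=
  ε * ∫ y, inner ℝ (F y) (G y) ∂(gibbsMeasure V ε)

/-- Lipschitz functions with values in `[0, 1]`, equal to `1` on `A` and to `0` on `B`. -/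
def IsAdmissible (A B : Set (EuclideanSpace ℝ ι)) (f : EuclideanSpace ℝ ι → ℝ) : Prop :=
  (∃ K, LipschitzWith K f) ∧ (∀ y, f y ∈ Set.Icc (0 : ℝ) 1) ∧
    (∀ y ∈ A, f y = 1) ∧ (∀ y ∈ B, f y = 0)

/-- Smooth compactly supported test functions on the complement of `S`. -/
def IsTestFunctionOff (S : Set (EuclideanSpace ℝ ι)) (f : EuclideanSpace ℝ ι → ℝ) : Prop :=
  ContDiff ℝ ∞ f ∧ HasCompactSupport f ∧ Disjoint (tsupport f) S

/-- `h` is the equilibrium potential (committor) of `A` and `B`, with weak gradient `G`: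
it solves `𝓛 h = 0` on `(A ∪ B)ᶜ`, `h = 1` on `A`, `h = 0` on `B`, where
`𝓛 = ε e^{V/ε} ∇ · e^{-V/ε} ∇` is the generator. The function `h` belongs to the (closed) domain
of the Dirichlet form and takes its boundary values in the sense of that domain (`approx`);
the equation holds in the weak sense (`harmonic`). -/
structure IsEquilibriumPotential (V : EuclideanSpace ℝ ι → ℝ) (ε : ℝ)
    (A B : Set (EuclideanSpace ℝ ι)) (h : EuclideanSpace ℝ ι → ℝ)
    (G : EuclideanSpace ℝ ι → EuclideanSpace ℝ ι) : Prop where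
  memLp : MemLp h 2 (gibbsMeasure V ε)
  memLp_grad : MemLp G 2 (gibbsMeasure V ε)
  mem_Icc : ∀ y, h y ∈ Set.Icc (0 : ℝ) 1
  eq_one : ∀ y ∈ A, h y = 1
  eq_zero : ∀ y ∈ B, h y = 0
  approx : ∃ f : ℕ → EuclideanSpace ℝ ι → ℝ, (∀ n, IsAdmissible A B (f n)) ∧
    Tendsto (fun n => eLpNorm (fun y => f n y - h y) 2 (gibbsMeasure V ε)) atTop (𝓝 0) ∧
    Tendsto (fun n => eLpNorm (fun y => gradient (f n) y - G y) 2 (gibbsMeasure V ε))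
      atTop (𝓝 0)
  harmonic : ∀ f, IsTestFunctionOff (A ∪ B) f → dirichletForm V ε G (gradient f) = 0

/-- `e` is the equilibrium measure `e_{AB} = -𝓛 h`: a measure concentrated on `∂A`,
the identity being understood in the weak sense on `Bᶜ`, that is, integrated against
`e^{-V/ε} f` for test functions `f`. Here `G` is the gradient of `h`. -/
structure IsEquilibriumMeasure (V : EuclideanSpace ℝ ι → ℝ) (ε : ℝ)
    (A B : Set (EuclideanSpace ℝ ι)) (G : EuclideanSpace ℝ ι → EuclideanSpace ℝ ι)
    (e : Measure (EuclideanSpace ℝ ι)) : Prop where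
  finite_compact : ∀ K : Set (EuclideanSpace ℝ ι), IsCompact K → e K < ⊤
  concentrated : e (frontier A)ᶜ = 0
  weak_eq : ∀ f, IsTestFunctionOff B f →
    dirichletForm V ε G (gradient f) = ∫ y, Real.exp (-V y / ε) * f y ∂e

/-- `c` is the capacity `cap(A, B) = ∫_{∂A} e^{-V(y)/ε} e_{AB}(dy)`. -/
def IsCapacity (V : EuclideanSpace ℝ ι → ℝ) (ε : ℝ) (A B : Set (EuclideanSpace ℝ ι))
    (c : ℝ) : Prop :=
  ∃ (h : EuclideanSpace ℝ ι → ℝ) (G : EuclideanSpace ℝ ι → EuclideanSpace ℝ ι)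
    (e : Measure (EuclideanSpace ℝ ι)),
    IsEquilibriumPotential V ε A B h G ∧ IsEquilibriumMeasure V ε A B G e ∧
    IntegrableOn (fun y => Real.exp (-V y / ε)) (frontier A) e ∧
    c = ∫ y in frontier A, Real.exp (-V y / ε) ∂e

end PotentialTheory

/-! ### The Galerkin approximation of the Allen–Cahn potential on the circle of length `L` -/

/-- The real orthonormal Fourier basis of `L²(ℝ/Lℤ)`. -/
def realFourierBasis (L : ℝ) (k : ℤ) (x : ℝ) : ℝ :=
  if 0 < k then √(2 / L) * Real.cos (2 * k * Real.pi * x / L)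
  else if k = 0 then 1 / √L
  else √(2 / L) * Real.sin (2 * k * Real.pi * x / L)

/-- The Fourier modes `|k| ≤ N`. -/
abbrev Modes (N : ℕ) : Type := ↥(Finset.Icc (-(N : ℤ)) (N : ℤ))

/-- The nonzero Fourier modes `0 < |k| ≤ N`. -/
abbrev PerpModes (N : ℕ) : Type := ↥((Finset.Icc (-(N : ℤ)) (N : ℤ)).erase 0)

/-- The space `E_N` spanned by the `e_k` with `|k| ≤ N`, in its orthonormal Fourier coordinates;
its norm is the `L²` norm and its volume is Lebesgue measure. -/
abbrev GalerkinSpace (N : ℕ) : Type := EuclideanSpace ℝ (Modes N)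

/-- The subspace `E_{⊥,N}` of mean-zero functions, in its Fourier coordinates. -/
abbrev PerpSpace (N : ℕ) : Type := EuclideanSpace ℝ (PerpModes N)

/-- The function `φ(x) = ∑_{|k| ≤ N} φ̂_k e_k(x)`. -/
def toFun (L : ℝ) {N : ℕ} (φ : GalerkinSpace N) (x : ℝ) : ℝ :=
  ∑ k : Modes N, φ k * realFourierBasis L k x

/-- The Allen–Cahn potential `V(φ) = ∫₀ᴸ [φ'(x)²/2 + (φ(x)² - 1)²/4] dx` on `E_N`. -/
def potential (L : ℝ) (N : ℕ) (φ : GalerkinSpace N) : ℝ :=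
  ∫ x in (0 : ℝ)..L,
    (1 / 2 * (deriv (toFun L φ) x) ^ 2 + 1 / 4 * ((toFun L φ x) ^ 2 - 1) ^ 2)

/-- The restriction of the potential to the constant modes. -/
def potentialZero (L : ℝ) (y : ℝ) : ℝ := L / 4 * (y ^ 2 / L - 1) ^ 2

/-- The coordinate `φ₀ = ⟨e_0, φ⟩`. -/
def zeroMode {N : ℕ} (φ : GalerkinSpace N) : ℝ := φ ⟨0, by simp⟩

/-- The transversal coordinate `φ_⊥ = ε^{-1/2} (φ - φ₀ e_0)`. -/
def perpPart (ε : ℝ) {N : ℕ} (φ : GalerkinSpace N) : PerpSpace N :=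
  WithLp.toLp 2 fun k => φ ⟨k, Finset.mem_of_mem_erase k.2⟩ / √ε

/-- The matrix `(⟨e_j, Δ e_k⟩)` of the Laplacian `Δ_⊥` acting on `E_{⊥,N}`. -/
def laplacianPerp (L : ℝ) (N : ℕ) : Matrix (PerpModes N) (PerpModes N) ℝ :=
  Matrix.of fun j k =>
    ∫ x in (0 : ℝ)..L, realFourierBasis L j x * iteratedDeriv 2 (realFourierBasis L k) x

/-- The eigenvalues `μ_k` of `-Δ - 1`. -/
def mu (L : ℝ) (k : ℤ) : ℝ := (2 * k * Real.pi / L) ^ 2 - 1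

/-- The eigenvalues `ν_k` of `-Δ + 2`. -/
def nu (L : ℝ) (k : ℤ) : ℝ := (2 * k * Real.pi / L) ^ 2 + 2

/-- The fractional Sobolev norm `‖ψ‖_{H^s} = (∑ (1 + k²)^s ψ̂_k²)^{1/2}`. -/
def sobolevNorm (s : ℝ) {N : ℕ} (ψ : PerpSpace N) : ℝ :=
  √(∑ k : PerpModes N, (1 + ((k : ℤ) : ℝ) ^ 2) ^ s * ψ k ^ 2)

/-- The set `A = {φ : |φ₀ + √L| ≤ δ, φ_⊥ ∈ D}`. -/
def wellSet (L ε δ : ℝ) {N : ℕ} (D : Set (PerpSpace N)) : Set (GalerkinSpace N) :=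
  {φ | |zeroMode φ + √L| ≤ δ ∧ perpPart ε φ ∈ D}

end AllenCahn

end

open AllenCahn

/-! Everything has to hold with relative error O(ε) uniformly in the dimension 2N + 1. The
uniformity rests on the spectrum: since L < 2π, the eigenvalues μ_k of -Δ - 1 on mean-zero functions
are positive and grow like k², so Σ 1/μ_k is bounded in N (`exists_sum_inv_mu_le`). Under the
Gaussian law with variances 1/μ_k or 1/ν_k the field ψ(x) therefore has bounded variance at each x,
and ∫ cosh ψ(x) dx has bounded expectation (`integrable_coshEnergy_and_le`). This functional
dominates all polynomial errors.

Partition function. The potential is even, so one half space suffices. Around the well 1, on scale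
√ε, the exponent V/ε is exactly the quadratic form of -Δ + 2 plus X = √ε ∫ψ³ + (ε/4) ∫ψ⁴. The cubic
term is odd and averages to zero, which leaves an error ε instead of √ε. The factor e^{-X} is not
bounded uniformly in ε, but on the half space the whole exponent dominates a second positive
quadratic form (`half_sum_barrierWeight_le`), so the Taylor remainder is integrated against a
comparison Gaussian at a cost bounded in N.

Capacity. A minimiser of the Dirichlet energy yields an equilibrium potential, and its first
variation a positive functional, hence the equilibrium measure (`exists_isCapacity`). For any
equilibrium potential the capacity equals its energy, which is the infimum of the energy over
admissible functions; this gives uniqueness and a variational principle for both bounds.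

Upper bound: the trial function is the equilibrium potential of the parabolic barrier in the zero
mode alone, and V ≥ V₀(0) - φ₀²/2 + ½ Σ μ_k φ_k² reduces its energy to Gaussian integrals
(`energy_trialPotential_le`).

Lower bound: space is fibred by curves from A to B labelled by the transversal coordinate ψ, and the
energy is at least the integral of one-dimensional conductances (`energy_ge_of_curves`). Straight
lines would need ψ itself in the Sobolev ball, and the Gaussian mass outside the ball need not be
O(ε) when the lowest μ_k are small. So the finitely many low modes are squeezed by a factor 1/R away
from the saddle, which shrinks them at the endpoints. The squeezed Sobolev weights β then satisfy 4β
≤ μ, so e^{Σ β ψ²} has bounded expectation and Markov's inequality makes the excluded curves cost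
only O(ε). The Jacobian of the squeezing is a correction of order y² in few modes, hence also O(ε)
after integration over the barrier. -/

noncomputable section

namespace AllenCahn

/-! ### Gradients of Lipschitz functions, mollification and enlarged test classes -/

section Gradients

variable {ι : Type*} [Fintype ι]

theorem measurable_gradient (f : EuclideanSpace ℝ ι → ℝ) : Measurable (gradient f) :=
  (InnerProductSpace.toDual ℝ (EuclideanSpace ℝ ι)).symm.continuous.measurable.comp
    (measurable_fderiv ℝ f)

theorem norm_gradient (f : EuclideanSpace ℝ ι → ℝ) (x : EuclideanSpace ℝ ι) :
    ‖gradient f x‖ = ‖fderiv ℝ f x‖ := by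
  simp [gradient]

theorem norm_gradient_le {f : EuclideanSpace ℝ ι → ℝ} {K : NNReal} (hf : LipschitzWith K f)
    (x : EuclideanSpace ℝ ι) : ‖gradient f x‖ ≤ K := by
  rw [norm_gradient]; exact norm_fderiv_le_of_lipschitz ℝ hf

theorem inner_gradient (f : EuclideanSpace ℝ ι → ℝ) (x v : EuclideanSpace ℝ ι) :
    inner ℝ (gradient f x) v = fderiv ℝ f x v := by
  simp [gradient]

/-- A Lipschitz function has vanishing gradient at almost every point of a level set. -/
theorem ae_hasGradientAt_zero_of_eq {f : EuclideanSpace ℝ ι → ℝ} {K : NNReal}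
    (hf : LipschitzWith K f) (c : ℝ) : ∀ᵐ x, f x = c → HasGradientAt f 0 x := by
  have h1 : LipschitzWith K (fun x => |f x - c|) := by
    refine LipschitzWith.of_dist_le_mul fun x y => ?_
    refine le_trans ?_ (hf.dist_le_mul x y)
    rw [Real.dist_eq, Real.dist_eq]
    refine (abs_abs_sub_abs_le _ _).trans (le_of_eq ?_)
    congr 1; ring
  filter_upwards [h1.ae_differentiableAt (μ := volume)] with x hx hfx
  -- The function |f - c| is minimal at every point of the level set, so wherever Rademacher's
  -- theorem makes it differentiable its derivative vanishes. Having the same absolute value, f - c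
  -- is then also of smaller order than the increment.
  have h0 : fderiv ℝ (fun x => |f x - c|) x = 0 :=
    IsLocalMin.fderiv_eq_zero (Filter.Eventually.of_forall fun y => by simp [hfx])
  have h2 := hx.hasFDerivAt
  rw [h0] at h2
  rw [hasGradientAt_iff_hasFDerivAt, map_zero]
  rw [hasFDerivAt_iff_isLittleO] at h2 ⊢
  refine (Asymptotics.IsLittleO.congr_left ?_ (f₁ := fun y => f y - c) fun y => by simp [hfx])
  rw [← Asymptotics.isLittleO_abs_left]
  refine h2.congr_left fun y => by simp [hfx]

theorem ae_hasGradientAt {f : EuclideanSpace ℝ ι → ℝ} {K : NNReal}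
    (hf : LipschitzWith K f) : ∀ᵐ x, HasGradientAt f (gradient f x) x := by
  filter_upwards [hf.ae_differentiableAt (μ := volume)] with x hx using hx.hasGradientAt

theorem memLp_gradient {μ : Measure (EuclideanSpace ℝ ι)} [IsFiniteMeasure μ]
    {f : EuclideanSpace ℝ ι → ℝ} {K : NNReal} (hf : LipschitzWith K f) {p : ENNReal} :
    MemLp (gradient f) p μ :=
  MemLp.of_bound (measurable_gradient f).aestronglyMeasurable K
    (Filter.Eventually.of_forall (norm_gradient_le hf))

theorem gradient_eq_zero_of_eventuallyEq_const {f : EuclideanSpace ℝ ι → ℝ} {c : ℝ}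
    {x : EuclideanSpace ℝ ι} (h : f =ᶠ[𝓝 x] fun _ => c) : gradient f x = 0 := by
  rw [gradient, h.fderiv_eq]; simp

theorem tendsto_integral_inner_of_bounded {μ : Measure (EuclideanSpace ℝ ι)}
    {G : EuclideanSpace ℝ ι → EuclideanSpace ℝ ι} (hG : Integrable G μ)
    {F : ℕ → EuclideanSpace ℝ ι → EuclideanSpace ℝ ι} {F' : EuclideanSpace ℝ ι → EuclideanSpace ℝ ι}
    {K : ℝ} (hF : ∀ n, AEStronglyMeasurable (F n) μ) (hb : ∀ n, ∀ᵐ x ∂μ, ‖F n x‖ ≤ K)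
    (hlim : ∀ᵐ x ∂μ, Tendsto (fun n => F n x) atTop (𝓝 (F' x))) :
    Tendsto (fun n => ∫ x, inner ℝ (G x) (F n x) ∂μ) atTop (𝓝 (∫ x, inner ℝ (G x) (F' x) ∂μ)) := by
  refine tendsto_integral_of_dominated_convergence (fun x => ‖G x‖ * K)
    (fun n => hG.aestronglyMeasurable.inner (hF n)) (hG.norm.mul_const K) (fun n => ?_) ?_
  · filter_upwards [hb n] with x hx
    exact (norm_inner_le_norm _ _).trans (mul_le_mul_of_nonneg_left hx (norm_nonneg _))
  · filter_upwards [hlim] with x hx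
    exact tendsto_const_nhds.inner hx

/-- Convolution with a smooth bump differentiates under the integral sign. -/
theorem hasFDerivAt_convolution_bump {g : EuclideanSpace ℝ ι → ℝ} {K : NNReal}
    (hg : LipschitzWith K g) (φ : ContDiffBump (0 : EuclideanSpace ℝ ι))
    (x : EuclideanSpace ℝ ι) :
    HasFDerivAt (convolution (φ.normed volume) g (ContinuousLinearMap.lsmul ℝ ℝ) volume)
      (convolution (φ.normed volume) (fderiv ℝ g) (ContinuousLinearMap.lsmul ℝ ℝ) volume x) x := by
  have hφi : Integrable (φ.normed volume) volume := φ.integrable_normed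
  unfold convolution
  have hcont : ∀ y, Continuous fun t => φ.normed volume t * g (y - t) := fun y =>
    φ.continuous_normed.mul (hg.continuous.comp (by fun_prop))
  have := hasFDerivAt_integral_of_dominated_loc_of_lip (μ := volume)
    (F := fun y t => φ.normed volume t * g (y - t))
    (F' := fun t => φ.normed volume t • fderiv ℝ g (x - t)) (x₀ := x) (s := Set.univ)
    (bound := fun t => φ.normed volume t * K) univ_mem
    (Filter.Eventually.of_forall fun y => (hcont y).aestronglyMeasurable)
    ((hcont x).integrable_of_hasCompactSupport (φ.hasCompactSupport_normed.mul_right))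
    ?_ ?_ (hφi.mul_const _) ?_
  · simpa using this.2
  · refine (φ.continuous_normed.measurable.smul ?_).aestronglyMeasurable
    exact (measurable_fderiv ℝ g).comp (by fun_prop)
  · refine Filter.Eventually.of_forall fun t => LipschitzOnWith.of_dist_le_mul fun y _ z _ => ?_
    have h0 := φ.nonneg_normed (μ := volume) t
    have := hg.dist_le_mul (y - t) (z - t)
    rw [dist_sub_right] at this
    simp only [Real.dist_eq, Real.coe_nnabs] at this ⊢
    rw [← mul_sub, abs_mul, abs_mul, mul_assoc, NNReal.abs_eq]
    exact mul_le_mul_of_nonneg_left this (abs_nonneg _)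
  · have h1 : ∀ᵐ t ∂(volume : Measure (EuclideanSpace ℝ ι)), DifferentiableAt ℝ g (x - t) :=
      (quasiMeasurePreserving_sub_left_of_right_invariant volume x).ae
        (hg.ae_differentiableAt (μ := volume))
    filter_upwards [h1] with t ht
    have h2 : HasFDerivAt (fun y => g (y - t)) (fderiv ℝ g (x - t)) x :=
      ht.hasFDerivAt.comp x ((hasFDerivAt_id x).sub_const t)
    simpa using h2.const_mul (φ.normed volume t)

/-- The derivative of the mollification is an average of derivatives of `g` against a probability
density, so the Lipschitz constant is preserved. -/
theorem lipschitzWith_convolution_bump {g : EuclideanSpace ℝ ι → ℝ} {K : NNReal}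
    (hg : LipschitzWith K g) (φ : ContDiffBump (0 : EuclideanSpace ℝ ι)) :
    LipschitzWith K (convolution (φ.normed volume) g (ContinuousLinearMap.lsmul ℝ ℝ) volume) := by
  refine lipschitzWith_of_nnnorm_fderiv_le
    (fun x => (hasFDerivAt_convolution_bump hg φ x).differentiableAt) fun x => ?_
  rw [← NNReal.coe_le_coe, coe_nnnorm, (hasFDerivAt_convolution_bump hg φ x).fderiv]
  unfold convolution
  refine (norm_integral_le_of_norm_le (g := fun t => φ.normed volume t * K)
    (φ.integrable_normed.mul_const _) (Filter.Eventually.of_forall fun t => ?_)).trans ?_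
  · simp only [ContinuousLinearMap.lsmul_apply, norm_smul, Real.norm_eq_abs,
      abs_of_nonneg (φ.nonneg_normed (μ := volume) t)]
    exact mul_le_mul_of_nonneg_left (norm_fderiv_le_of_lipschitz ℝ hg)
      (φ.nonneg_normed (μ := volume) t)
  · rw [integral_mul_const, φ.integral_normed, one_mul]

/-- A field orthogonal to the gradients of all test functions off `S` is orthogonal to the
gradients of compactly supported Lipschitz functions off `S`. -/
theorem integral_inner_gradient_eq_zero_of_compact {μ : Measure (EuclideanSpace ℝ ι)}
    (hμ : μ ≪ volume) {S : Set (EuclideanSpace ℝ ι)} (hS : IsClosed S)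
    {G : EuclideanSpace ℝ ι → EuclideanSpace ℝ ι} (hG : Integrable G μ)
    (harm : ∀ f, IsTestFunctionOff S f → ∫ x, inner ℝ (G x) (gradient f x) ∂μ = 0)
    {g : EuclideanSpace ℝ ι → ℝ} {K : NNReal} (hg : LipschitzWith K g)
    (hc : HasCompactSupport g) (hd : Disjoint (tsupport g) S) :
    ∫ x, inner ℝ (G x) (gradient g x) ∂μ = 0 := by
  obtain ⟨δ, hδ, hδS⟩ := hc.isCompact.exists_cthickening_subset_open hS.isOpen_compl
    (Set.disjoint_left.mp hd)
  -- The outer radii δ/(n+1) keep the mollified supports inside the thickening that misses S. The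
  -- fixed ratio 2 of the radii is what almost everywhere convergence of the mollified derivative
  -- requires.
  let φ : ℕ → ContDiffBump (0 : EuclideanSpace ℝ ι) := fun n =>
    ⟨δ / 2 / ((n : ℝ) + 1), δ / ((n : ℝ) + 1), by positivity, by gcongr; linarith⟩
  have hφ : Tendsto (fun n => (φ n).rOut) atTop (𝓝 0) := by
    simpa [φ, div_eq_mul_inv] using
      (tendsto_one_div_add_atTop_nhds_zero_nat (𝕜 := ℝ)).const_mul δ
  let gn : ℕ → EuclideanSpace ℝ ι → ℝ := fun n =>
    convolution ((φ n).normed volume) g (ContinuousLinearMap.lsmul ℝ ℝ) volume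
  have hloc : LocallyIntegrable (fderiv ℝ g) (volume : Measure (EuclideanSpace ℝ ι)) := by
    intro x
    refine ⟨Metric.ball x 1, Metric.ball_mem_nhds x one_pos, ?_⟩
    refine Measure.integrableOn_of_bounded (M := K) measure_ball_lt_top.ne
      (measurable_fderiv ℝ g).aestronglyMeasurable
      (Filter.Eventually.of_forall fun y => norm_fderiv_le_of_lipschitz ℝ hg)
  have hlim := ContDiffBump.ae_convolution_tendsto_right_of_locallyIntegrable (φ := φ) (K := 2) hφ
    (Filter.Eventually.of_forall fun n => by simp only [φ]; apply le_of_eq; ring) hloc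
  have hgrad : ∀ᵐ x ∂μ, Tendsto (fun n => gradient (gn n) x) atTop (𝓝 (gradient g x)) := by
    filter_upwards [hμ hlim] with x hx
    simp only [gradient]
    refine ((InnerProductSpace.toDual ℝ _).symm.continuous.tendsto _).comp ?_
    refine hx.congr fun n => ?_
    exact (hasFDerivAt_convolution_bump hg (φ n) x).fderiv.symm
  have htest : ∀ n, IsTestFunctionOff S (gn n) := by
    intro n
    refine ⟨(φ n).hasCompactSupport_normed.contDiff_convolution_left _
      (φ n).contDiff_normed hg.continuous.locallyIntegrable,
      (φ n).hasCompactSupport_normed.convolution _ hc, ?_⟩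
    refine Set.disjoint_left.mpr fun x hx => hδS (closure_minimal ?_ Metric.isClosed_cthickening hx)
    refine (support_convolution_subset _).trans ?_
    rintro _ ⟨a, ha, b, hb, rfl⟩
    rw [(φ n).support_normed_eq] at ha
    refine Metric.mem_cthickening_of_dist_le _ b _ _ (subset_closure hb) ?_
    have ha' : ‖a‖ < δ / ((n : ℝ) + 1) := by simpa [φ] using ha
    rw [dist_eq_norm, add_sub_cancel_right]
    refine ha'.le.trans (div_le_self hδ.le (by linarith [n.cast_nonneg (α := ℝ)]))
  have := tendsto_integral_inner_of_bounded (K := K) hG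
    (fun n => (measurable_gradient (gn n)).aestronglyMeasurable)
    (fun n => Filter.Eventually.of_forall
      (norm_gradient_le (lipschitzWith_convolution_bump hg (φ n)))) hgrad
  refine tendsto_nhds_unique this ?_
  simp only [harm _ (htest _)]
  exact tendsto_const_nhds

/-- Dilations of a single bump by x ↦ x/(n+1). These maps are contractions, so one Lipschitz
constant serves for all n, and cutoffs can be removed by dominated convergence. -/
theorem exists_smooth_cutoffs : ∃ (ρ : ℕ → EuclideanSpace ℝ ι → ℝ) (K : NNReal), ∀ n,
    ContDiff ℝ ∞ (ρ n) ∧ HasCompactSupport (ρ n) ∧ LipschitzWith K (ρ n) ∧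
      (∀ x, ρ n x ∈ Set.Icc (0 : ℝ) 1) ∧ ∀ x, ‖x‖ ≤ n → ρ n x = 1 := by
  let φ : ContDiffBump (0 : EuclideanSpace ℝ ι) := ⟨1, 2, one_pos, one_lt_two⟩
  obtain ⟨K, hK⟩ := φ.contDiff.lipschitzWith_of_hasCompactSupport φ.hasCompactSupport
    (n := ∞) (by simp)
  refine ⟨fun n x => φ (((n : ℝ) + 1)⁻¹ • x), K, fun n => ⟨?_, ?_, ?_, ?_, ?_⟩⟩
  · exact φ.contDiff.comp (contDiff_const_smul _)
  · exact φ.hasCompactSupport.comp_homeomorph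
      (Homeomorph.smulOfNeZero ((n : ℝ) + 1)⁻¹ (by positivity))
  · have h1 : LipschitzWith 1 fun x : EuclideanSpace ℝ ι => ((n : ℝ) + 1)⁻¹ • x := by
      refine LipschitzWith.of_dist_le_mul fun x y => ?_
      rw [dist_smul₀, NNReal.coe_one, Real.norm_eq_abs, abs_of_nonneg (by positivity)]
      refine mul_le_mul_of_nonneg_right (inv_le_one_of_one_le₀ ?_) dist_nonneg
      linarith [n.cast_nonneg (α := ℝ)]
    have h2 := hK.comp h1
    rw [mul_one] at h2
    exact h2
  · exact fun x => ⟨φ.nonneg, φ.le_one⟩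
  · intro x hx
    refine φ.one_of_mem_closedBall ?_
    rw [mem_closedBall_zero_iff, norm_smul, Real.norm_eq_abs, abs_of_nonneg (by positivity),
      inv_mul_le_iff₀ (by positivity)]
    change ‖x‖ ≤ ((n : ℝ) + 1) * 1
    linarith

theorem lipschitzWith_mul_of_bounded {f g : EuclideanSpace ℝ ι → ℝ} {K K' B B' : NNReal}
    (hf : LipschitzWith K f) (hg : LipschitzWith K' g) (hfb : ∀ x, |f x| ≤ B)
    (hgb : ∀ x, |g x| ≤ B') : LipschitzWith (B * K' + B' * K) (fun x => f x * g x) := by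
  refine LipschitzWith.of_dist_le_mul fun x y => ?_
  have h1 := hf.dist_le_mul x y
  have h2 := hg.dist_le_mul x y
  rw [Real.dist_eq] at h1 h2 ⊢
  have : f x * g x - f y * g y = f x * (g x - g y) + g y * (f x - f y) := by ring
  rw [this]
  refine (abs_add_le _ _).trans ?_
  rw [abs_mul, abs_mul]
  push_cast
  have h3 := mul_le_mul (hfb x) h2 (abs_nonneg _) B.2
  have h4 := mul_le_mul (hgb y) h1 (abs_nonneg _) B'.2
  linarith [h3, h4]

/-- The function `u` with its values in `[-η, η]` collapsed to zero. -/
def collapse (η u : ℝ) : ℝ := max (u - η) 0 + min (u + η) 0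

theorem collapse_of_abs_le {η u : ℝ} (h : |u| ≤ η) : collapse η u = 0 := by
  obtain ⟨h1, h2⟩ := abs_le.mp h
  simp [collapse, max_eq_right (by linarith : u - η ≤ 0), min_eq_right (by linarith : 0 ≤ u + η)]

theorem abs_collapse_le {η u : ℝ} (hη : 0 ≤ η) : |collapse η u| ≤ |u| := by
  unfold collapse
  rcases max_cases (u - η) 0 with h | h <;> rcases min_cases (u + η) 0 with h' | h' <;>
    rcases abs_cases u with h'' | h'' <;> rw [abs_le] <;> constructor <;> linarith

theorem collapse_of_pos {η u : ℝ} (h : η < u) (hη : 0 ≤ η) : collapse η u = u - η := by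
  simp [collapse, max_eq_left (by linarith : 0 ≤ u - η), min_eq_right (by linarith : 0 ≤ u + η)]

theorem collapse_of_neg {η u : ℝ} (h : u < -η) (hη : 0 ≤ η) : collapse η u = u + η := by
  simp [collapse, max_eq_right (by linarith : u - η ≤ 0), min_eq_left (by linarith : u + η ≤ 0)]

theorem lipschitzWith_collapse (η : ℝ) : LipschitzWith 2 (collapse η) := by
  have h1 : LipschitzWith 1 fun u : ℝ => max (u - η) 0 :=
    (LipschitzWith.id.sub (LipschitzWith.const η) |>.weaken (by simp)).max_const 0
  have h2 : LipschitzWith 1 fun u : ℝ => min (u + η) 0 :=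
    (LipschitzWith.id.add (LipschitzWith.const η) |>.weaken (by simp)).min_const 0
  exact (h1.add h2).weaken (by norm_num)

/-- A field orthogonal to the gradients of all test functions off `S` is orthogonal to the
gradients of all bounded Lipschitz functions vanishing on `S`. -/
theorem integral_inner_gradient_eq_zero {μ : Measure (EuclideanSpace ℝ ι)}
    (hμ : μ ≪ volume) {S : Set (EuclideanSpace ℝ ι)} (hS : IsClosed S)
    {G : EuclideanSpace ℝ ι → EuclideanSpace ℝ ι} (hG : Integrable G μ)
    (harm : ∀ f, IsTestFunctionOff S f → ∫ x, inner ℝ (G x) (gradient f x) ∂μ = 0)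
    {g : EuclideanSpace ℝ ι → ℝ} {K : NNReal} (hg : LipschitzWith K g) {B : NNReal}
    (hB : ∀ x, |g x| ≤ B) (h0 : ∀ x ∈ S, g x = 0) :
    ∫ x, inner ℝ (G x) (gradient g x) ∂μ = 0 := by
  obtain ⟨ρ, Kρ, hρ⟩ := exists_smooth_cutoffs (ι := ι)
  let η : ℕ → ℝ := fun n => 1 / ((n : ℝ) + 1)
  have hη : ∀ n, 0 < η n := fun n => by positivity
  have hηlim : Tendsto η atTop (𝓝 0) := tendsto_one_div_add_atTop_nhds_zero_nat
  let gn : ℕ → EuclideanSpace ℝ ι → ℝ := fun n x => ρ n x * collapse (η n) (g x)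
  have hlip : ∀ n, LipschitzWith (1 * (2 * K) + B * Kρ) (gn n) := fun n =>
    lipschitzWith_mul_of_bounded (hρ n).2.2.1 ((lipschitzWith_collapse _).comp hg)
      (fun x => by
        rw [abs_of_nonneg ((hρ n).2.2.2.1 x).1]; exact ((hρ n).2.2.2.1 x).2)
      (fun x => (abs_collapse_le (hη n).le).trans (hB x))
  have hzero : ∀ n, ∫ x, inner ℝ (G x) (gradient (gn n) x) ∂μ = 0 := by
    intro n
    refine integral_inner_gradient_eq_zero_of_compact hμ hS hG harm (hlip n)
      (hρ n).2.1.mul_right ?_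
    -- The collapsed function is supported in the closed set {|g| ≥ η}, which misses S because g
    -- vanishes there.
    have hsub : tsupport (gn n) ⊆ {x | η n ≤ |g x|} := by
      refine closure_minimal (fun x hx => ?_)
        (isClosed_le continuous_const hg.continuous.abs)
      by_contra hlt
      exact hx (by simp [gn, collapse_of_abs_le (not_le.mp hlt).le])
    refine Set.disjoint_left.mpr fun x hx hxS => ?_
    have := hsub hx
    rw [Set.mem_ofPred_eq, h0 x hxS, abs_zero] at this
    exact absurd (hη n) (not_lt.mpr this)
  have hgrad : ∀ᵐ x ∂μ, Tendsto (fun n => gradient (gn n) x) atTop (𝓝 (gradient g x)) := by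
    filter_upwards [hμ (ae_hasGradientAt_zero_of_eq hg 0)] with x hx
    obtain ⟨m, hm⟩ := exists_nat_gt ‖x‖
    have hnear : ∀ n ≥ m, ∀ᶠ y in 𝓝 x, gn n y = collapse (η n) (g y) := by
      intro n hn
      have : ∀ᶠ y in 𝓝 x, ‖y‖ < n :=
        continuous_norm.continuousAt.eventually_lt continuousAt_const
          (hm.trans_le (by exact_mod_cast hn))
      filter_upwards [this] with y hy
      simp [gn, (hρ n).2.2.2.2 y hy.le]
    -- Off {g = 0} the approximant is eventually g shifted by the constant ±η near x. On {g = 0} the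
    -- gradient of g vanishes almost everywhere, and `abs_collapse_le` transfers this to the
    -- approximants.
    rcases lt_trichotomy (g x) 0 with hgx | hgx | hgx
    · refine tendsto_const_nhds.congr' ?_
      filter_upwards [eventually_ge_atTop m,
        hηlim.eventually_lt_const (neg_pos.mpr hgx)] with n hn hn'
      have h1 : gn n =ᶠ[𝓝 x] fun y => g y + η n := by
        filter_upwards [hnear n hn, hg.continuous.continuousAt.eventually_lt continuousAt_const
          (by linarith : g x < -η n)] with y hy hy'
        rw [hy, collapse_of_neg hy' (hη n).le]
      simp only [gradient, h1.fderiv_eq, fderiv_add_const]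
    · have hx0 := hx hgx
      rw [hx0.gradient]
      refine tendsto_const_nhds.congr' ?_
      filter_upwards [eventually_ge_atTop m] with n hn
      symm
      apply HasGradientAt.gradient
      rw [hasGradientAt_iff_hasFDerivAt, map_zero, hasFDerivAt_iff_isLittleO] at hx0 ⊢
      refine Asymptotics.IsBigO.trans_isLittleO ?_ hx0
      refine Asymptotics.IsBigO.of_bound 1 ?_
      have hxn : gn n x = 0 := by
        simp [gn, hgx, collapse_of_abs_le (u := 0) (by simpa using (hη n).le)]
      filter_upwards [hnear n hn] with y hy
      rw [hxn, hy, hgx]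
      simpa using abs_collapse_le (hη n).le
    · refine tendsto_const_nhds.congr' ?_
      filter_upwards [eventually_ge_atTop m,
        hηlim.eventually_lt_const hgx] with n hn hn'
      have h1 : gn n =ᶠ[𝓝 x] fun y => g y - η n := by
        filter_upwards [hnear n hn, continuousAt_const.eventually_lt hg.continuous.continuousAt
          hn'] with y hy hy'
        rw [hy, collapse_of_pos hy' (hη n).le]
      simp only [gradient, h1.fderiv_eq, fderiv_sub_const]
  have := tendsto_integral_inner_of_bounded hG
    (fun n => (measurable_gradient (gn n)).aestronglyMeasurable)
    (fun n => Filter.Eventually.of_forall (norm_gradient_le (hlip n))) hgrad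
  refine tendsto_nhds_unique this ?_
  simp only [hzero]
  exact tendsto_const_nhds

end Gradients

/-! ### Minimising sequences in Hilbert space -/

section Minimizers

/-- A convex set of pairs, bounded in the first component, carries a convergent sequence along
which the norm of the second component is minimised. -/
theorem exists_convergent_minimizing_sequence {H₁ H₂ : Type*} [NormedAddCommGroup H₁]
    [InnerProductSpace ℝ H₁] [CompleteSpace H₁] [NormedAddCommGroup H₂] [InnerProductSpace ℝ H₂]
    [CompleteSpace H₂] {K : Set (H₁ × H₂)} (hK : Convex ℝ K) (hne : K.Nonempty) {R : ℝ}
    (hR : ∀ p ∈ K, ‖p.1‖ ≤ R) :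
    ∃ (u : ℕ → H₁ × H₂) (a : H₁) (b : H₂), (∀ n, u n ∈ K) ∧
      Tendsto (fun n => (u n).1) atTop (𝓝 a) ∧ Tendsto (fun n => (u n).2) atTop (𝓝 b) ∧
      ∀ p ∈ K, ‖b‖ ≤ ‖p.2‖ := by
  set I : ℝ := sInf ((fun p : H₁ × H₂ => ‖p.2‖ ^ 2) '' K) with hI
  have hIbdd : BddBelow ((fun p : H₁ × H₂ => ‖p.2‖ ^ 2) '' K) :=
    ⟨0, by rintro _ ⟨p, _, rfl⟩; positivity⟩
  have hIle : ∀ p ∈ K, I ≤ ‖p.2‖ ^ 2 := fun p hp => csInf_le hIbdd ⟨p, hp, rfl⟩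
  -- The norm of the second component does not control the first one, so the minimisation is
  -- lexicographic: among pairs that are optimal in the second norm up to 1/(m+1), the first norm is
  -- nearly minimised too. Midpoints stay in `S m` by convexity, and the parallelogram law makes
  -- both components Cauchy.
  let S : ℕ → Set (H₁ × H₂) := fun m => {p | p ∈ K ∧ ‖p.2‖ ^ 2 ≤ I + 1 / ((m : ℝ) + 1)}
  have hSne : ∀ m, (S m).Nonempty := by
    intro m
    obtain ⟨_, ⟨p, hp, rfl⟩, hlt⟩ := exists_lt_of_csInf_lt (hne.image _)
      (lt_add_of_pos_right I (by positivity : (0 : ℝ) < 1 / ((m : ℝ) + 1)))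
    exact ⟨p, hp, hlt.le⟩
  have hSanti : ∀ m n, m ≤ n → S n ⊆ S m := fun m n hmn p hp =>
    ⟨hp.1, hp.2.trans (by gcongr)⟩
  set d : ℕ → ℝ := fun m => sInf ((fun p : H₁ × H₂ => ‖p.1‖ ^ 2) '' S m) with hd
  have hdbdd : ∀ m, BddBelow ((fun p : H₁ × H₂ => ‖p.1‖ ^ 2) '' S m) := fun m =>
    ⟨0, by rintro _ ⟨p, _, rfl⟩; positivity⟩
  have hdle : ∀ m, ∀ p ∈ S m, d m ≤ ‖p.1‖ ^ 2 := fun m p hp => csInf_le (hdbdd m) ⟨p, hp, rfl⟩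
  have hch : ∀ m, ∃ p ∈ S m, ‖p.1‖ ^ 2 ≤ d m + 1 / ((m : ℝ) + 1) := by
    intro m
    obtain ⟨_, ⟨p, hp, rfl⟩, hlt⟩ := exists_lt_of_csInf_lt ((hSne m).image _)
      (lt_add_of_pos_right (d m) (by positivity : (0 : ℝ) < 1 / ((m : ℝ) + 1)))
    exact ⟨p, hp, hlt.le⟩
  choose u huS hu using hch
  -- The infima increase because the sets shrink, and they stay below R²; their limit D takes the
  -- place of a common minimal value.
  have hdmono : Monotone d := fun m n hmn =>
    csInf_le_csInf (hdbdd m) ((hSne n).image _) (Set.image_mono (hSanti m n hmn))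
  have hR0 : 0 ≤ R := (norm_nonneg _).trans (hR _ (huS 0).1)
  have hdub : ∀ m, d m ≤ R ^ 2 := fun m =>
    (hdle m _ (huS m)).trans (pow_le_pow_left₀ (norm_nonneg _) (hR _ (huS m).1) 2)
  obtain ⟨D, hD⟩ : ∃ D, Tendsto d atTop (𝓝 D) :=
    ⟨_, tendsto_atTop_ciSup hdmono ⟨R ^ 2, by rintro _ ⟨m, rfl⟩; exact hdub m⟩⟩
  have hdD : ∀ m, d m ≤ D := fun m => hdmono.ge_of_tendsto hD m
  have hmid : ∀ m n, m ≤ n → (1 / 2 : ℝ) • u m + (1 / 2 : ℝ) • u n ∈ S m := by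
    intro m n hmn
    have h1 := huS m
    have h2 := hSanti m n hmn (huS n)
    refine ⟨hK h1.1 h2.1 (by norm_num) (by norm_num) (by norm_num), ?_⟩
    have h3 := parallelogram_law_with_norm ℝ (u m).2 (u n).2
    have h4 : ‖((1 / 2 : ℝ) • u m + (1 / 2 : ℝ) • u n).2‖ = 1 / 2 * ‖(u m).2 + (u n).2‖ := by
      rw [Prod.snd_add, Prod.smul_snd, Prod.smul_snd, ← smul_add, norm_smul]; norm_num
    rw [h4]
    nlinarith [h1.2, h2.2, norm_nonneg ((u m).2 - (u n).2)]
  have hlim0 : Tendsto (fun m : ℕ => 1 / ((m : ℝ) + 1)) atTop (𝓝 0) :=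
    tendsto_one_div_add_atTop_nhds_zero_nat
  have hc1 : ∀ m n, m ≤ n → ‖(u m).1 - (u n).1‖ ^ 2 ≤ 2 * (D - d m) + 4 * (1 / ((m : ℝ) + 1)) := by
    intro m n hmn
    have h3 := parallelogram_law_with_norm ℝ (u m).1 (u n).1
    have h4 : ‖((1 / 2 : ℝ) • u m + (1 / 2 : ℝ) • u n).1‖ = 1 / 2 * ‖(u m).1 + (u n).1‖ := by
      rw [Prod.fst_add, Prod.smul_fst, Prod.smul_fst, ← smul_add, norm_smul]; norm_num
    have h5 := hdle m _ (hmid m n hmn)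
    rw [h4] at h5
    have h6 : 1 / ((n : ℝ) + 1) ≤ 1 / ((m : ℝ) + 1) := by gcongr
    nlinarith [hu m, hu n, hdD n]
  have hc2 : ∀ m n, m ≤ n → ‖(u m).2 - (u n).2‖ ^ 2 ≤ 4 * (1 / ((m : ℝ) + 1)) := by
    intro m n hmn
    have h3 := parallelogram_law_with_norm ℝ (u m).2 (u n).2
    have h4 : ‖((1 / 2 : ℝ) • u m + (1 / 2 : ℝ) • u n).2‖ = 1 / 2 * ‖(u m).2 + (u n).2‖ := by
      rw [Prod.snd_add, Prod.smul_snd, Prod.smul_snd, ← smul_add, norm_smul]; norm_num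
    have h5 := hIle _ (hmid m n hmn).1
    rw [h4] at h5
    have h6 : 1 / ((n : ℝ) + 1) ≤ 1 / ((m : ℝ) + 1) := by gcongr
    nlinarith [(huS m).2, (huS n).2]
  have hcauchy : ∃ a, Tendsto (fun n => (u n).1) atTop (𝓝 a) := by
    refine cauchySeq_tendsto_of_complete (cauchySeq_of_le_tendsto_0'
      (fun m => √(2 * (D - d m) + 4 * (1 / ((m : ℝ) + 1)))) ?_ ?_)
    · intro m n hmn
      rw [dist_eq_norm]
      exact Real.le_sqrt_of_sq_le (hc1 m n hmn)
    · have := (Real.continuous_sqrt.tendsto _).comp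
        ((((tendsto_const_nhds (x := D)).sub hD).const_mul 2).add (hlim0.const_mul 4))
      rw [sub_self, mul_zero, mul_zero, add_zero, Real.sqrt_zero] at this
      exact this
  obtain ⟨a, ha⟩ := hcauchy
  have hcauchy' : ∃ b, Tendsto (fun n => (u n).2) atTop (𝓝 b) := by
    refine cauchySeq_tendsto_of_complete (cauchySeq_of_le_tendsto_0'
      (fun m => √(4 * (1 / ((m : ℝ) + 1)))) ?_ ?_)
    · intro m n hmn
      rw [dist_eq_norm]
      exact Real.le_sqrt_of_sq_le (hc2 m n hmn)
    · have := (Real.continuous_sqrt.tendsto _).comp (hlim0.const_mul 4)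
      rw [mul_zero, Real.sqrt_zero] at this
      exact this
  obtain ⟨b, hb⟩ := hcauchy'
  refine ⟨u, a, b, fun n => (huS n).1, ha, hb, fun p hp => ?_⟩
  have h1 : ‖b‖ ^ 2 ≤ I := by
    refine le_of_tendsto_of_tendsto (hb.norm.pow 2) ?_
      (Filter.Eventually.of_forall fun n => (huS n).2)
    simpa using tendsto_const_nhds.add hlim0
  exact le_of_sq_le_sq (h1.trans (hIle p hp)) (norm_nonneg _)

end Minimizers

/-! ### The Dirichlet energy and its minimiser -/

section Dirichlet

variable {ι : Type*} [Fintype ι]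

theorem norm_toLp_sq {α F : Type*} [MeasurableSpace α] [NormedAddCommGroup F]
    [InnerProductSpace ℝ F] {μ : Measure α} {f : α → F} (hf : MemLp f 2 μ) :
    ‖hf.toLp f‖ ^ 2 = ∫ x, ‖f x‖ ^ 2 ∂μ := by
  rw [← real_inner_self_eq_norm_sq, L2.inner_def]
  refine integral_congr_ae ?_
  filter_upwards [hf.coeFn_toLp] with x hx
  rw [hx, real_inner_self_eq_norm_sq]

theorem inner_toLp {α F : Type*} [MeasurableSpace α] [NormedAddCommGroup F]
    [InnerProductSpace ℝ F] {μ : Measure α} {f g : α → F} (hf : MemLp f 2 μ) (hg : MemLp g 2 μ) :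
    inner ℝ (hf.toLp f) (hg.toLp g) = ∫ x, inner ℝ (f x) (g x) ∂μ := by
  rw [L2.inner_def]
  refine integral_congr_ae ?_
  filter_upwards [hf.coeFn_toLp, hg.coeFn_toLp] with x hx hx'
  rw [hx, hx']

theorem tendsto_toLp {α F : Type*} [MeasurableSpace α] [NormedAddCommGroup F]
    {μ : Measure α} {f : ℕ → α → F} {g : α → F} (hf : ∀ n, MemLp (f n) 2 μ) (hg : MemLp g 2 μ)
    (h : Tendsto (fun n => eLpNorm (fun x => f n x - g x) 2 μ) atTop (𝓝 0)) :
    Tendsto (fun n => (hf n).toLp (f n)) atTop (𝓝 (hg.toLp g)) :=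
  (Lp.tendsto_Lp_iff_tendsto_eLpNorm'' f hf g hg).mpr h

theorem IsAdmissible.memLp {μ : Measure (EuclideanSpace ℝ ι)} [IsFiniteMeasure μ]
    {A B : Set (EuclideanSpace ℝ ι)} {f : EuclideanSpace ℝ ι → ℝ} (hf : IsAdmissible A B f) :
    MemLp f 2 μ := by
  obtain ⟨⟨K, hK⟩, hI, -⟩ := hf
  refine MemLp.of_bound hK.continuous.aestronglyMeasurable 1 (Filter.Eventually.of_forall fun x => ?_)
  rw [Real.norm_eq_abs, abs_of_nonneg (hI x).1]
  exact (hI x).2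

theorem IsAdmissible.memLp_gradient {μ : Measure (EuclideanSpace ℝ ι)} [IsFiniteMeasure μ]
    {A B : Set (EuclideanSpace ℝ ι)} {f : EuclideanSpace ℝ ι → ℝ} (hf : IsAdmissible A B f) :
    MemLp (gradient f) 2 μ := by
  obtain ⟨⟨K, hK⟩, -⟩ := hf
  exact AllenCahn.memLp_gradient hK

/-- Where the clamp is active the function sits at its global minimum or maximum, so the derivative
is zero; elsewhere it agrees locally with `u`. The bound holds at every point, since `fderiv` is
zero by default where it does not exist. -/
theorem norm_gradient_clamp_le {u : EuclideanSpace ℝ ι → ℝ} (hu : Continuous u)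
    (x : EuclideanSpace ℝ ι) :
    ‖gradient (fun y => max 0 (min 1 (u y))) x‖ ≤ ‖gradient u x‖ := by
  have hr : ∀ y, 0 ≤ max 0 (min 1 (u y)) ∧ max 0 (min 1 (u y)) ≤ 1 := fun y =>
    ⟨le_max_left _ _, max_le zero_le_one (min_le_left _ _)⟩
  rw [norm_gradient, norm_gradient]
  rcases le_or_gt (u x) 0 with h0 | h0
  · rw [IsLocalMin.fderiv_eq_zero (Filter.Eventually.of_forall fun y => ?_), norm_zero]
    · exact norm_nonneg _
    · rw [max_eq_left ((min_le_right _ _).trans h0)]; exact (hr y).1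
  rcases le_or_gt 1 (u x) with h1 | h1
  · rw [IsLocalMax.fderiv_eq_zero (Filter.Eventually.of_forall fun y => ?_), norm_zero]
    · exact norm_nonneg _
    · rw [min_eq_left h1, max_eq_right zero_le_one]; exact (hr y).2
  · have : (fun y => max 0 (min 1 (u y))) =ᶠ[𝓝 x] u := by
      filter_upwards [continuousAt_const.eventually_lt hu.continuousAt h0,
        hu.continuousAt.eventually_lt continuousAt_const h1] with y hy hy'
      rw [min_eq_right hy'.le, max_eq_right hy.le]
    rw [this.fderiv_eq]

theorem ae_gradient_add_smul {f g : EuclideanSpace ℝ ι → ℝ} {K K' : NNReal}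
    (hf : LipschitzWith K f) (hg : LipschitzWith K' g) (a b : ℝ) :
    ∀ᵐ x, gradient (fun y => a * f y + b * g y) x = a • gradient f x + b • gradient g x := by
  filter_upwards [ae_hasGradientAt hf, ae_hasGradientAt hg] with x h1 h2
  apply HasGradientAt.gradient
  rw [hasGradientAt_iff_hasFDerivAt] at h1 h2 ⊢
  refine ((h1.const_mul a).add (h2.const_mul b)).congr_fderiv ?_
  simp

/-- First variation of the Dirichlet energy at a minimiser, in the directions that keep the
obstacle conditions. -/
theorem integral_inner_gradient_nonneg_of_minimal {μ : Measure (EuclideanSpace ℝ ι)}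
    [IsFiniteMeasure μ] (hμ : μ ≪ volume) {A B : Set (EuclideanSpace ℝ ι)}
    {G : EuclideanSpace ℝ ι → EuclideanSpace ℝ ι} (hG : MemLp G 2 μ)
    {fn : ℕ → EuclideanSpace ℝ ι → ℝ} (hfn : ∀ n, IsAdmissible A B (fn n))
    (hlim : Tendsto (fun n => eLpNorm (fun y => gradient (fn n) y - G y) 2 μ) atTop (𝓝 0))
    (hmin : ∀ f, IsAdmissible A B f → ∫ x, ‖G x‖ ^ 2 ∂μ ≤ ∫ x, ‖gradient f x‖ ^ 2 ∂μ)
    {g : EuclideanSpace ℝ ι → ℝ} {K : NNReal} (hg : LipschitzWith K g) (hgA : ∀ x ∈ A, 0 ≤ g x)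
    (hgB : ∀ x ∈ B, g x = 0) : 0 ≤ ∫ x, inner ℝ (G x) (gradient g x) ∂μ := by
  have hg2 : MemLp (gradient g) 2 μ := memLp_gradient hg
  have hfl := fun n => (hfn n).memLp_gradient (μ := μ)
  set b := hG.toLp G
  set c := hg2.toLp (gradient g)
  have hconv := tendsto_toLp hfl hG hlim
  -- Only one-sided variations are available: for t > 0 the function fn + t g is at least 1 on A, so
  -- its clamp is admissible. Clamping does not increase the energy, and letting n tend to infinity
  -- gives the inequality for the limit field.
  have key : ∀ t : ℝ, 0 < t → ‖b‖ ^ 2 ≤ ‖b + t • c‖ ^ 2 := by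
    intro t ht
    refine ge_of_tendsto ((hconv.add_const (t • c)).norm.pow 2)
      (Filter.Eventually.of_forall fun n => ?_)
    obtain ⟨⟨Kn, hKn⟩, hI, hA, hB⟩ := hfn n
    let u : EuclideanSpace ℝ ι → ℝ := fun y => 1 * fn n y + t * g y
    have htg : LipschitzWith (t.toNNReal * K) fun y => t * g y := by
      refine LipschitzWith.of_dist_le_mul fun x y => ?_
      have := hg.dist_le_mul x y
      rw [Real.dist_eq] at this ⊢
      rw [← mul_sub, abs_mul, abs_of_pos ht, NNReal.coe_mul, Real.coe_toNNReal _ ht.le, mul_assoc]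
      exact mul_le_mul_of_nonneg_left this ht.le
    have hu : LipschitzWith (Kn + t.toNNReal * K) u := by
      simpa only [u, one_mul] using hKn.add htg
    have hadm : IsAdmissible A B (fun y => max 0 (min 1 (u y))) := by
      refine ⟨⟨_, (hu.const_min 1).const_max 0⟩, fun y =>
        ⟨le_max_left _ _, max_le zero_le_one (min_le_left _ _)⟩, fun y hy => ?_, fun y hy => ?_⟩
      · have : 1 ≤ u y := by
          simp only [u, hA y hy]
          nlinarith [hgA y hy]
        simp only [min_eq_left this, max_eq_right zero_le_one]
      · simp [u, hB y hy, hgB y hy]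
    have h1 := hmin _ hadm
    have h2 : ∫ x, ‖gradient (fun y => max 0 (min 1 (u y))) x‖ ^ 2 ∂μ
        ≤ ∫ x, ‖gradient u x‖ ^ 2 ∂μ := by
      refine integral_mono (hadm.memLp_gradient (μ := μ)).norm.integrable_sq
        (memLp_gradient hu).norm.integrable_sq fun x => ?_
      exact pow_le_pow_left₀ (norm_nonneg _) (norm_gradient_clamp_le hu.continuous x) 2
    have h3 : ‖(hfl n).toLp _ + t • c‖ ^ 2 = ∫ x, ‖gradient u x‖ ^ 2 ∂μ := by
      rw [← norm_toLp_sq (memLp_gradient hu)]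
      congr 2
      rw [← MemLp.toLp_const_smul, ← MemLp.toLp_add]
      refine MemLp.toLp_congr _ _ ?_
      filter_upwards [hμ (ae_gradient_add_smul hKn hg 1 t)] with x hx
      rw [hx]; simp
    rw [h3, norm_toLp_sq]
    exact h1.trans h2
  rw [← inner_toLp hG hg2]
  by_contra hneg
  have hneg' : inner ℝ b c < 0 := not_le.mp hneg
  have hexp : ∀ t : ℝ, ‖b + t • c‖ ^ 2 = ‖b‖ ^ 2 + 2 * t * inner ℝ b c + t ^ 2 * ‖c‖ ^ 2 := by
    intro t
    rw [norm_add_sq_real, inner_smul_right, norm_smul, mul_pow, Real.norm_eq_abs, sq_abs]; ring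
  have hpos : 0 < ‖c‖ ^ 2 + 1 := by positivity
  -- For this t a negative linear term 2t⟨b, c⟩ outweighs t²‖c‖²; the added 1 keeps the denominator
  -- positive.
  have ht : 0 < -inner ℝ b c / (‖c‖ ^ 2 + 1) := div_pos (neg_pos.mpr hneg') hpos
  have h5 := key _ ht
  rw [hexp] at h5
  set i := inner ℝ b c
  set t := -i / (‖c‖ ^ 2 + 1) with htdef
  have h6 : t * (‖c‖ ^ 2 + 1) = -i := by rw [htdef]; field_simp
  nlinarith [mul_pos ht ht]

/-- Existence of a minimiser of the Dirichlet energy in the closed class of admissible functions. -/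
theorem exists_dirichlet_minimizer {μ : Measure (EuclideanSpace ℝ ι)}
    [IsFiniteMeasure μ] (hμ : μ ≪ volume) {A B : Set (EuclideanSpace ℝ ι)}
    (hne : ∃ f, IsAdmissible A B f) :
    ∃ (h : EuclideanSpace ℝ ι → ℝ) (G : EuclideanSpace ℝ ι → EuclideanSpace ℝ ι)
      (fn : ℕ → EuclideanSpace ℝ ι → ℝ), MemLp h 2 μ ∧ MemLp G 2 μ ∧
      (∀ y, h y ∈ Set.Icc (0 : ℝ) 1) ∧ (∀ y ∈ A, h y = 1) ∧ (∀ y ∈ B, h y = 0) ∧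
      (∀ n, IsAdmissible A B (fn n)) ∧
      Tendsto (fun n => eLpNorm (fun y => fn n y - h y) 2 μ) atTop (𝓝 0) ∧
      Tendsto (fun n => eLpNorm (fun y => gradient (fn n) y - G y) 2 μ) atTop (𝓝 0) ∧
      ∀ f, IsAdmissible A B f → ∫ x, ‖G x‖ ^ 2 ∂μ ≤ ∫ x, ‖gradient f x‖ ^ 2 ∂μ := by
  -- Function and gradient are kept as a pair, so that the limit of the gradients comes with a limit
  -- function. The first component is bounded because admissible functions lie in [0, 1] and μ is
  -- finite.
  let K : Set (Lp ℝ 2 μ × Lp (EuclideanSpace ℝ ι) 2 μ) :=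
    {p | ∃ (f : EuclideanSpace ℝ ι → ℝ) (hf : IsAdmissible A B f),
      p = (hf.memLp.toLp f, hf.memLp_gradient.toLp (gradient f))}
  have hK : Convex ℝ K := by
    rintro _ ⟨f, hf, rfl⟩ _ ⟨g, hg, rfl⟩ a b ha hb hab
    obtain ⟨⟨Kf, hKf⟩, hfI, hfA, hfB⟩ := id hf
    obtain ⟨⟨Kg, hKg⟩, hgI, hgA, hgB⟩ := id hg
    have hadm : IsAdmissible A B (fun y => a * f y + b * g y) := by
      refine ⟨⟨a.toNNReal * Kf + b.toNNReal * Kg, LipschitzWith.of_dist_le_mul fun x y => ?_⟩,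
        fun y => ⟨?_, ?_⟩, fun y hy => ?_, fun y hy => ?_⟩
      · have h1 := hKf.dist_le_mul x y
        have h2 := hKg.dist_le_mul x y
        rw [Real.dist_eq] at h1 h2 ⊢
        have : a * f x + b * g x - (a * f y + b * g y) = a * (f x - f y) + b * (g x - g y) := by
          ring
        rw [this]
        refine (abs_add_le _ _).trans ?_
        rw [abs_mul, abs_mul, abs_of_nonneg ha, abs_of_nonneg hb]
        push_cast
        rw [Real.coe_toNNReal _ ha, Real.coe_toNNReal _ hb]
        nlinarith [mul_le_mul_of_nonneg_left h1 ha, mul_le_mul_of_nonneg_left h2 hb]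
      · have := (hfI y).1; have := (hgI y).1; positivity
      · nlinarith [(hfI y).2, (hgI y).2]
      · simp only [hfA y hy, hgA y hy]; linarith
      · simp only [hfB y hy, hgB y hy]; ring
    refine ⟨_, hadm, ?_⟩
    refine Prod.ext ?_ ?_
    · simp only [Prod.fst_add, Prod.smul_fst]
      rw [← MemLp.toLp_const_smul, ← MemLp.toLp_const_smul, ← MemLp.toLp_add]
      exact MemLp.toLp_congr _ _ (Filter.Eventually.of_forall fun x => by simp)
    · simp only [Prod.snd_add, Prod.smul_snd]
      rw [← MemLp.toLp_const_smul, ← MemLp.toLp_const_smul, ← MemLp.toLp_add]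
      refine MemLp.toLp_congr _ _ ?_
      filter_upwards [hμ (ae_gradient_add_smul hKf hKg a b)] with x hx
      rw [hx]; simp
  have hKne : K.Nonempty := by
    obtain ⟨f, hf⟩ := hne
    exact ⟨_, f, hf, rfl⟩
  have hKb : ∀ p ∈ K, ‖p.1‖ ≤ √(μ.real Set.univ) := by
    rintro _ ⟨f, hf, rfl⟩
    refine Real.le_sqrt_of_sq_le ?_
    rw [norm_toLp_sq]
    calc ∫ x, ‖f x‖ ^ 2 ∂μ ≤ ∫ _, (1 : ℝ) ∂μ := by
          refine integral_mono hf.memLp.norm.integrable_sq (integrable_const _) fun x => ?_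
          have h1 := (hf.2.1 x).1
          have h2 := (hf.2.1 x).2
          simp only [Real.norm_eq_abs, sq_abs]
          nlinarith
      _ = μ.real Set.univ := by simp
  obtain ⟨u, a, b, huK, ha, hb, hmin⟩ := exists_convergent_minimizing_sequence hK hKne hKb
  choose fn hfn hfu using huK
  have ha' : Tendsto (fun n => (hfn n).memLp.toLp (fn n)) atTop (𝓝 a) := by
    refine ha.congr fun n => ?_
    rw [hfu n]
  have hb' : Tendsto (fun n => (hfn n).memLp_gradient.toLp (gradient (fn n))) atTop (𝓝 b) := by
    refine hb.congr fun n => ?_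
    rw [hfu n]
  have ha2 : Tendsto (fun n => eLpNorm (fn n - (a : EuclideanSpace ℝ ι → ℝ)) 2 μ) atTop (𝓝 0) := by
    rw [Lp.tendsto_Lp_iff_tendsto_eLpNorm'] at ha'
    refine ha'.congr fun n => eLpNorm_congr_ae ?_
    filter_upwards [(hfn n).memLp.coeFn_toLp (μ := μ)] with x hx
    simp [hx]
  have hb2 : Tendsto (fun n => eLpNorm (gradient (fn n) - (b : EuclideanSpace ℝ ι → EuclideanSpace ℝ ι)) 2 μ) atTop (𝓝 0) := by
    rw [Lp.tendsto_Lp_iff_tendsto_eLpNorm'] at hb'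
    refine hb'.congr fun n => eLpNorm_congr_ae ?_
    filter_upwards [(hfn n).memLp_gradient.coeFn_toLp (μ := μ)] with x hx
    simp [hx]
  obtain ⟨ns, -, hns⟩ := (tendstoInMeasure_of_tendsto_eLpNorm two_ne_zero
    (fun n => (hfn n).memLp.aestronglyMeasurable) (Lp.aestronglyMeasurable a)
    ha2).exists_seq_tendsto_ae
  -- The limsup along an almost everywhere convergent subsequence is a version of the L² limit that
  -- lies in [0, 1] and equals 1 on A and 0 on B at every point, null sets included.
  let h : EuclideanSpace ℝ ι → ℝ := fun x => limsup (fun i => fn (ns i) x) atTop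
  have hmeas : Measurable h := Measurable.limsup fun i => by
    obtain ⟨⟨K, hK⟩, -⟩ := hfn (ns i)
    exact hK.continuous.measurable
  have hha : h =ᵐ[μ] a := by
    filter_upwards [hns] with x hx using hx.limsup_eq
  have hbd1 : ∀ x, IsBoundedUnder (· ≤ ·) atTop fun i => fn (ns i) x := fun x =>
    isBoundedUnder_of ⟨1, fun i => ((hfn (ns i)).2.1 x).2⟩
  have hbd2 : ∀ x, IsBoundedUnder (· ≥ ·) atTop fun i => fn (ns i) x := fun x =>
    isBoundedUnder_of ⟨0, fun i => ((hfn (ns i)).2.1 x).1⟩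
  have hI : ∀ y, h y ∈ Set.Icc (0 : ℝ) 1 := fun y =>
    ⟨le_limsup_of_frequently_le (Frequently.of_forall fun i => ((hfn (ns i)).2.1 y).1) (hbd1 y),
      limsup_le_of_le (hbd2 y).isCoboundedUnder_le
        (Filter.Eventually.of_forall fun i => ((hfn (ns i)).2.1 y).2)⟩
  refine ⟨h, b, fn, ?_, Lp.memLp b, hI, fun y hy => ?_, fun y hy => ?_, hfn, ?_, hb2, ?_⟩
  · refine MemLp.of_bound hmeas.aestronglyMeasurable 1 (Filter.Eventually.of_forall fun x => ?_)
    rw [Real.norm_eq_abs, abs_of_nonneg (hI x).1]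
    exact (hI x).2
  · simp only [h, (hfn _).2.2.1 y hy]; simp
  · simp only [h, (hfn _).2.2.2 y hy]; simp
  · refine ha2.congr fun n => eLpNorm_congr_ae ?_
    filter_upwards [hha] with x hx
    simp [hx]
  · intro f hf
    have h1 := hmin _ ⟨f, hf, rfl⟩
    have h2 := pow_le_pow_left₀ (norm_nonneg _) h1 2
    simp only [norm_toLp_sq] at h2
    rw [← real_inner_self_eq_norm_sq, L2.inner_def] at h2
    simpa only [real_inner_self_eq_norm_sq] using h2

end Dirichlet

/-! ### Separators and the equilibrium measure -/

section Capacity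

variable {ι : Type*} [Fintype ι]

/-- A smooth Lipschitz function equal to one near `A` and to zero near `B`. -/
structure IsSeparator (A B : Set (EuclideanSpace ℝ ι)) (χ : EuclideanSpace ℝ ι → ℝ) : Prop where
  contDiff : ContDiff ℝ ∞ χ
  lipschitz : ∃ K, LipschitzWith K χ
  mem_Icc : ∀ x, χ x ∈ Set.Icc (0 : ℝ) 1
  disjoint_right : Disjoint (tsupport χ) B
  disjoint_left : Disjoint (tsupport fun x => 1 - χ x) A

namespace IsSeparator

variable {A B : Set (EuclideanSpace ℝ ι)} {χ : EuclideanSpace ℝ ι → ℝ}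

theorem eq_one (h : IsSeparator A B χ) {x : EuclideanSpace ℝ ι} (hx : x ∈ A) : χ x = 1 := by
  have := image_eq_zero_of_notMem_tsupport (Set.disjoint_right.mp h.disjoint_left hx)
  linarith

theorem eq_zero (h : IsSeparator A B χ) {x : EuclideanSpace ℝ ι} (hx : x ∈ B) : χ x = 0 :=
  image_eq_zero_of_notMem_tsupport (Set.disjoint_right.mp h.disjoint_right hx)

theorem isAdmissible (h : IsSeparator A B χ) : IsAdmissible A B χ :=
  ⟨h.lipschitz, h.mem_Icc, fun _ hx => h.eq_one hx, fun _ hx => h.eq_zero hx⟩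

theorem abs_le (h : IsSeparator A B χ) (x : EuclideanSpace ℝ ι) : |χ x| ≤ (1 : NNReal) := by
  rw [abs_of_nonneg (h.mem_Icc x).1]; exact (h.mem_Icc x).2

theorem isTestFunctionOff_mul (h : IsSeparator A B χ) {f : EuclideanSpace ℝ ι → ℝ}
    (hf : ContDiff ℝ ∞ f) (hc : HasCompactSupport f) :
    IsTestFunctionOff B (fun x => χ x * f x) :=
  ⟨h.contDiff.mul hf, hc.mul_left, h.disjoint_right.mono_left (tsupport_mul_subset_left)⟩

/-- Splitting f = χ f + (1 - χ) f, the second part does not contribute when paired with a field that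
is weakly harmonic off A ∪ B. -/
theorem isTestFunctionOff_one_sub_mul (h : IsSeparator A B χ) {f : EuclideanSpace ℝ ι → ℝ}
    (hf : IsTestFunctionOff B f) :
    IsTestFunctionOff (A ∪ B) (fun x => (1 - χ x) * f x) :=
  ⟨(contDiff_const.sub h.contDiff).mul hf.1, hf.2.1.mul_left, Set.disjoint_union_right.mpr
    ⟨h.disjoint_left.mono_left tsupport_mul_subset_left,
      hf.2.2.mono_left tsupport_mul_subset_right⟩⟩

end IsSeparator

theorem IsTestFunctionOff.lipschitz {S : Set (EuclideanSpace ℝ ι)} {f : EuclideanSpace ℝ ι → ℝ}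
    (hf : IsTestFunctionOff S f) : ∃ K, LipschitzWith K f :=
  hf.1.lipschitzWith_of_hasCompactSupport hf.2.1 (by simp)

theorem IsTestFunctionOff.eq_zero {S : Set (EuclideanSpace ℝ ι)} {f : EuclideanSpace ℝ ι → ℝ}
    (hf : IsTestFunctionOff S f) {x : EuclideanSpace ℝ ι} (hx : x ∈ S) : f x = 0 :=
  image_eq_zero_of_notMem_tsupport (Set.disjoint_right.mp hf.2.2 hx)

theorem gradient_add_of_differentiableAt {f g : EuclideanSpace ℝ ι → ℝ} {x : EuclideanSpace ℝ ι}
    (hf : DifferentiableAt ℝ f x) (hg : DifferentiableAt ℝ g x) :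
    gradient (fun y => f y + g y) x = gradient f x + gradient g x := by
  simp [gradient, fderiv_fun_add hf hg]

theorem gradient_const_mul_of_differentiableAt {f : EuclideanSpace ℝ ι → ℝ}
    {x : EuclideanSpace ℝ ι} (hf : DifferentiableAt ℝ f x) (c : ℝ) :
    gradient (fun y => c * f y) x = c • gradient f x := by
  simp [gradient, fderiv_const_mul hf]

theorem integrable_inner_gradient {μ : Measure (EuclideanSpace ℝ ι)}
    {G : EuclideanSpace ℝ ι → EuclideanSpace ℝ ι} (hG : Integrable G μ)
    {f : EuclideanSpace ℝ ι → ℝ} {K : NNReal} (hf : LipschitzWith K f) :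
    Integrable (fun x => inner ℝ (G x) (gradient f x)) μ := by
  refine Integrable.mono' (hG.norm.mul_const K)
    (hG.aestronglyMeasurable.inner (measurable_gradient f).aestronglyMeasurable)
    (Filter.Eventually.of_forall fun x => ?_)
  exact (norm_inner_le_norm _ _).trans
    (mul_le_mul_of_nonneg_left (norm_gradient_le hf x) (norm_nonneg _))

/-- A positive linear functional on smooth compactly supported functions is a measure. -/
theorem exists_measure_of_positive_on_smooth
    (T : (EuclideanSpace ℝ ι → ℝ) → ℝ)
    (hadd : ∀ f g, ContDiff ℝ ∞ f → HasCompactSupport f → ContDiff ℝ ∞ g → HasCompactSupport g →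
      T (fun x => f x + g x) = T f + T g)
    (hsmul : ∀ (c : ℝ) f, ContDiff ℝ ∞ f → HasCompactSupport f →
      T (fun x => c * f x) = c * T f)
    (hpos : ∀ f, ContDiff ℝ ∞ f → HasCompactSupport f → (∀ x, 0 ≤ f x) → 0 ≤ T f) :
    ∃ e : Measure (EuclideanSpace ℝ ι), IsFiniteMeasureOnCompacts e ∧
      ∀ f, ContDiff ℝ ∞ f → HasCompactSupport f → ∫ x, f x ∂e = T f := by
  obtain ⟨ρ, K, hρ⟩ := exists_smooth_cutoffs (ι := ι)
  let X := CompactlySupportedContinuousMap (EuclideanSpace ℝ ι) ℝ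
  let D : Submodule ℝ X :=
    { carrier := {f | ContDiff ℝ ∞ f}
      add_mem' := fun {f g} hf hg => by
        rw [Set.mem_ofPred_eq] at *; exact ContDiff.add hf hg
      zero_mem' := by rw [Set.mem_ofPred_eq]; exact contDiff_const (c := (0 : ℝ))
      smul_mem' := fun c f hf => by
        rw [Set.mem_ofPred_eq] at *; exact ContDiff.const_smul c hf }
  let S : PointedCone ℝ X :=
    { carrier := {f | ∀ x, 0 ≤ f x}
      add_mem' := fun {f g} hf hg x => add_nonneg (hf x) (hg x)
      zero_mem' := fun x => le_refl _
      smul_mem' := fun c f hf x => mul_nonneg c.2 (hf x) }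
  let P : X →ₗ.[ℝ] ℝ :=
    { domain := D
      toFun :=
        { toFun := fun f => T f.1
          map_add' := fun f g => hadd _ _ f.2 f.1.hasCompactSupport g.2 g.1.hasCompactSupport
          map_smul' := fun c f => hsmul c _ f.2 f.1.hasCompactSupport } }
  -- M. Riesz extension along the cone of nonnegative functions. Its cofinality condition holds
  -- because a continuous f of compact support satisfies f ≥ -C ρ_n, where C bounds |f| and the
  -- smooth cutoff ρ_n is one on the support.
  obtain ⟨Λ, hΛ, hΛpos⟩ := riesz_extension S P
    (fun f hf => hpos _ f.2 f.1.hasCompactSupport hf) (fun f => by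
      obtain ⟨C, hC⟩ := f.hasCompactSupport.exists_bound_of_continuous f.continuous
      obtain ⟨r, hr⟩ := f.hasCompactSupport.isCompact.isBounded.subset_closedBall 0
      obtain ⟨n, hn⟩ := exists_nat_ge r
      let F : X := ⟨⟨fun x => C * ρ n x, continuous_const.mul (hρ n).1.continuous⟩,
        (hρ n).2.1.mul_left⟩
      refine ⟨⟨F, contDiff_const.mul (hρ n).1⟩, fun x => ?_⟩
      change 0 ≤ C * ρ n x + f x
      by_cases hx : x ∈ tsupport f
      · have h1 : ‖x‖ ≤ n := (by simpa using hr hx : ‖x‖ ≤ r).trans hn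
        rw [(hρ n).2.2.2.2 x h1]
        have := hC x
        rw [Real.norm_eq_abs] at this
        linarith [neg_abs_le (f x)]
      · rw [image_eq_zero_of_notMem_tsupport hx, add_zero]
        exact mul_nonneg ((norm_nonneg _).trans (hC 0)) ((hρ n).2.2.2.1 x).1)
  let Λp : X →ₚ[ℝ] ℝ := PositiveLinearMap.mk₀ Λ fun f hf => hΛpos f fun x => hf x
  refine ⟨RealRMK.rieszMeasure Λp, inferInstance, fun f hf hc => ?_⟩
  let F : X := ⟨⟨f, hf.continuous⟩, hc⟩
  have h1 := RealRMK.integral_rieszMeasure Λp F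
  have h2 := hΛ ⟨F, hf⟩
  exact h1.trans h2

/-- The equilibrium measure attached to a minimising field `G`. -/
theorem exists_finite_equilibrium_measure {μ : Measure (EuclideanSpace ℝ ι)}
    {A B : Set (EuclideanSpace ℝ ι)}
    {χ : EuclideanSpace ℝ ι → ℝ} (hχ : IsSeparator A B χ) (hA : IsClosed A)
    {G : EuclideanSpace ℝ ι → EuclideanSpace ℝ ι} (hG : Integrable G μ)
    (hG0 : ∀ᵐ x ∂μ, x ∈ interior A → G x = 0)
    (harm : ∀ f, IsTestFunctionOff (A ∪ B) f → ∫ x, inner ℝ (G x) (gradient f x) ∂μ = 0)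
    (hpos : ∀ f, IsTestFunctionOff B f → (∀ x, 0 ≤ f x) →
      0 ≤ ∫ x, inner ℝ (G x) (gradient f x) ∂μ) :
    ∃ e : Measure (EuclideanSpace ℝ ι), IsFiniteMeasure e ∧ e (frontier A)ᶜ = 0 ∧
      ∀ f, IsTestFunctionOff B f → ∫ x, inner ℝ (G x) (gradient f x) ∂μ = ∫ x, f x ∂e := by
  have hdiff : ∀ f : EuclideanSpace ℝ ι → ℝ, ContDiff ℝ ∞ f → ∀ x, DifferentiableAt ℝ f x :=
    fun f hf x => (hf.differentiable (by simp)).differentiableAt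
  have hint : ∀ f : EuclideanSpace ℝ ι → ℝ, ContDiff ℝ ∞ f → HasCompactSupport f →
      Integrable (fun x => inner ℝ (G x) (gradient (fun y => χ y * f y) x)) μ := by
    intro f hf hc
    obtain ⟨K, hK⟩ := (hχ.isTestFunctionOff_mul hf hc).lipschitz
    exact integrable_inner_gradient hG hK
  -- Inserting χ makes the functional f ↦ ∫ ⟨G, ∇(χ f)⟩ meaningful for all smooth compactly
  -- supported f, also near B, and positive, since χ f vanishes near B and is nonnegative with f.
  obtain ⟨e, he, hrep⟩ := exists_measure_of_positive_on_smooth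
    (fun f => ∫ x, inner ℝ (G x) (gradient (fun y => χ y * f y) x) ∂μ)
    (fun f g hf hfc hg hgc => by
      rw [← integral_add (hint f hf hfc) (hint g hg hgc)]
      refine integral_congr_ae (Filter.Eventually.of_forall fun x => ?_)
      simp only
      rw [← inner_add_right, ← gradient_add_of_differentiableAt
        (hdiff _ (hχ.contDiff.mul hf) x) (hdiff _ (hχ.contDiff.mul hg) x)]
      simp only [mul_add])
    (fun c f hf hfc => by
      rw [← integral_const_mul]
      refine integral_congr_ae (Filter.Eventually.of_forall fun x => ?_)
      simp only
      rw [← inner_smul_right, ← gradient_const_mul_of_differentiableAt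
        (hdiff _ (hχ.contDiff.mul hf) x)]
      congr 2
      ext y; ring)
    (fun f hf hc h0 => hpos _ (hχ.isTestFunctionOff_mul hf hc) fun x =>
      mul_nonneg (hχ.mem_Icc x).1 (h0 x))
  have hweak : ∀ f, IsTestFunctionOff B f →
      ∫ x, inner ℝ (G x) (gradient f x) ∂μ = ∫ x, f x ∂e := by
    intro f hf
    rw [hrep f hf.1 hf.2.1]
    have h1 := hχ.isTestFunctionOff_one_sub_mul hf
    obtain ⟨K, hK⟩ := h1.lipschitz
    rw [← zero_add (∫ x, inner ℝ (G x) (gradient (fun y => χ y * f y) x) ∂μ), ← harm _ h1,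
      ← integral_add (integrable_inner_gradient hG hK) (hint f hf.1 hf.2.1)]
    refine integral_congr_ae (Filter.Eventually.of_forall fun x => ?_)
    simp only
    rw [← inner_add_right, ← gradient_add_of_differentiableAt (hdiff _ h1.1 x)
      (hdiff _ (hχ.contDiff.mul hf.1) x)]
    congr 2
    ext y; ring
  refine ⟨e, ?_, ?_, hweak⟩
  · obtain ⟨ρ, Kρ, hρ⟩ := exists_smooth_cutoffs (ι := ι)
    obtain ⟨Kχ, hKχ⟩ := hχ.lipschitz
    -- Cutoffs with a common Lipschitz constant bound the mass of every ball by ∫ ‖G‖ times a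
    -- constant independent of the radius, so e is finite.
    have hb : ∀ n : ℕ, e (Metric.closedBall 0 n) ≤
        ENNReal.ofReal ((∫ x, ‖G x‖ ∂μ) * (1 * Kρ + 1 * Kχ : NNReal)) := by
      intro n
      have hlip : LipschitzWith (1 * Kρ + 1 * Kχ) (fun x => χ x * ρ n x) :=
        lipschitzWith_mul_of_bounded hKχ (hρ n).2.2.1 hχ.abs_le (fun x => by
          rw [abs_of_nonneg ((hρ n).2.2.2.1 x).1]; exact ((hρ n).2.2.2.1 x).2)
      have h1 : ∫ x, ρ n x ∂e ≤ (∫ x, ‖G x‖ ∂μ) * (1 * Kρ + 1 * Kχ : NNReal) := by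
        rw [hrep _ (hρ n).1 (hρ n).2.1, ← integral_mul_const]
        refine integral_mono (hint _ (hρ n).1 (hρ n).2.1) (hG.norm.mul_const _) fun x => ?_
        exact (real_inner_le_norm _ _).trans
          (mul_le_mul_of_nonneg_left (norm_gradient_le hlip x) (norm_nonneg _))
      refine le_trans ?_ (ENNReal.ofReal_le_ofReal h1)
      rw [ofReal_integral_eq_lintegral_ofReal
        ((hρ n).1.continuous.integrable_of_hasCompactSupport (hρ n).2.1)
        (Filter.Eventually.of_forall fun x => ((hρ n).2.2.2.1 x).1)]
      calc e (Metric.closedBall 0 n) = ∫⁻ x in Metric.closedBall 0 (n : ℝ), 1 ∂e := by simp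
        _ ≤ ∫⁻ x in Metric.closedBall 0 (n : ℝ), ENNReal.ofReal (ρ n x) ∂e := by
            refine setLIntegral_mono' Metric.isClosed_closedBall.measurableSet fun x hx => ?_
            rw [(hρ n).2.2.2.2 x (by simpa using hx), ENNReal.ofReal_one]
        _ ≤ _ := setLIntegral_le_lintegral _ _
    constructor
    have : Tendsto (fun n : ℕ => e (Metric.closedBall 0 (n : ℝ))) atTop
        (𝓝 (e (⋃ n : ℕ, Metric.closedBall 0 (n : ℝ)))) :=
      tendsto_measure_iUnion_atTop fun m n hmn =>
        Metric.closedBall_subset_closedBall (by exact_mod_cast hmn)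
    rw [Metric.iUnion_closedBall_nat] at this
    exact (le_of_tendsto' this hb).trans_lt ENNReal.ofReal_lt_top
  · refine measure_null_of_locally_null _ fun x hx => ?_
    suffices h : ∃ s ∈ 𝓝 x, ∀ f : EuclideanSpace ℝ ι → ℝ, ContDiff ℝ ∞ f → HasCompactSupport f → tsupport f ⊆ s →
        ∫ y, f y ∂e = 0 by
      obtain ⟨s, hs, hf⟩ := h
      obtain ⟨f, hfs, hfc, hfd, hfr, hfx⟩ := exists_contDiff_tsupport_subset (n := ⊤) hs
      have h0 : ∀ y, 0 ≤ f y := fun y => (hfr ⟨y, rfl⟩).1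
      have h1 := hf f hfd hfc hfs
      rw [integral_eq_zero_iff_of_nonneg h0
        (hfd.continuous.integrable_of_hasCompactSupport hfc)] at h1
      refine ⟨{y | 0 < f y}, mem_nhdsWithin_of_mem_nhds
        ((isOpen_lt continuous_const hfd.continuous).mem_nhds (by simp [hfx])), ?_⟩
      rw [Filter.EventuallyEq, ae_iff] at h1
      refine measure_mono_null (fun y hy => ?_) h1
      exact ne_of_gt hy
    -- Points off the boundary are of two kinds. In the interior of A the field G vanishes; for f
    -- supported off A the product χ f is a test function off A ∪ B, where G is harmonic.
    by_cases hxA : x ∈ A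
    · have hxi : x ∈ interior A := by
        by_contra h
        exact hx ⟨subset_closure hxA, h⟩
      refine ⟨interior A, isOpen_interior.mem_nhds hxi, fun f hf hc hfs => ?_⟩
      rw [hrep f hf hc]
      refine integral_eq_zero_of_ae ?_
      filter_upwards [hG0] with y hy
      by_cases hyA : y ∈ interior A
      · simp [hy hyA]
      · have : (fun y => χ y * f y) =ᶠ[𝓝 y] fun _ => 0 := by
          have : y ∉ tsupport f := fun h => hyA (hfs h)
          filter_upwards [notMem_tsupport_iff_eventuallyEq.mp this] with z hz
          simp [hz]
        simp [gradient_eq_zero_of_eventuallyEq_const this]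
    · refine ⟨Aᶜ, hA.isOpen_compl.mem_nhds hxA, fun f hf hc hfs => ?_⟩
      rw [hrep f hf hc]
      refine harm _ ⟨hχ.contDiff.mul hf, hc.mul_left, Set.disjoint_union_right.mpr ⟨?_, ?_⟩⟩
      · exact Set.disjoint_left.mpr fun y hy => hfs (tsupport_mul_subset_right hy)
      · exact hχ.disjoint_right.mono_left tsupport_mul_subset_left

end Capacity

/-! ### The capacity as the infimum of the Dirichlet energy -/

section Variational

variable {ι : Type*} [Fintype ι] {V : EuclideanSpace ℝ ι → ℝ} {ε : ℝ}
  {A B : Set (EuclideanSpace ℝ ι)}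

theorem gibbsMeasure_absolutelyContinuous : gibbsMeasure V ε ≪ volume :=
  withDensity_absolutelyContinuous _ _

theorem isFiniteMeasure_gibbsMeasure (hint : Integrable fun y => Real.exp (-V y / ε)) :
    IsFiniteMeasure (gibbsMeasure V ε) := by
  unfold gibbsMeasure
  exact isFiniteMeasure_withDensity_ofReal hint.2

theorem measurable_gibbsDensity (hV : Continuous V) :
    Measurable fun y => ENNReal.ofReal (Real.exp (-V y / ε)) :=
  (by fun_prop : Continuous fun y => Real.exp (-V y / ε)).measurable.ennreal_ofReal

theorem integral_gibbsMeasure (hV : Continuous V) (F : EuclideanSpace ℝ ι → ℝ) :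
    ∫ y, F y ∂(gibbsMeasure V ε) = ∫ y, Real.exp (-V y / ε) * F y := by
  unfold gibbsMeasure
  rw [integral_withDensity_eq_integral_toReal_smul (measurable_gibbsDensity hV)
    (Filter.Eventually.of_forall fun _ => ENNReal.ofReal_lt_top)]
  simp [ENNReal.toReal_ofReal (Real.exp_pos _).le]

/-- The inner product of the gradient of the equilibrium potential with the gradient of an
admissible function is the Dirichlet energy. -/
theorem IsEquilibriumPotential.integral_inner_gradient_eq
    [IsFiniteMeasure (gibbsMeasure V ε)] (hε : 0 < ε) (hA : IsClosed A) (hB : IsClosed B)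
    {h : EuclideanSpace ℝ ι → ℝ} {G : EuclideanSpace ℝ ι → EuclideanSpace ℝ ι}
    (hG : IsEquilibriumPotential V ε A B h G) {f : EuclideanSpace ℝ ι → ℝ}
    (hf : IsAdmissible A B f) :
    ∫ y, inner ℝ (G y) (gradient f y) ∂(gibbsMeasure V ε) =
      ∫ y, ‖G y‖ ^ 2 ∂(gibbsMeasure V ε) := by
  have hGi : Integrable G (gibbsMeasure V ε) := hG.memLp_grad.integrable (by norm_num)
  obtain ⟨fn, hfn, -, hlim⟩ := hG.approx
  have harm : ∀ g, IsTestFunctionOff (A ∪ B) g →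
      ∫ x, inner ℝ (G x) (gradient g x) ∂(gibbsMeasure V ε) = 0 := by
    intro g hg
    have := hG.harmonic g hg
    unfold dirichletForm at this
    exact (mul_eq_zero.mp this).resolve_left hε.ne'
  -- Two admissible functions differ by a bounded Lipschitz function vanishing on A ∪ B, so the
  -- pairing with G is the same for all of them. Along the approximating sequence it tends to ∫
  -- ‖G‖².
  have hsame : ∀ n, ∫ y, inner ℝ (G y) (gradient (fn n) y) ∂(gibbsMeasure V ε) =
      ∫ y, inner ℝ (G y) (gradient f y) ∂(gibbsMeasure V ε) := by
    intro n
    obtain ⟨⟨K, hK⟩, hI, h1, h0⟩ := hf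
    obtain ⟨⟨K', hK'⟩, hI', h1', h0'⟩ := hfn n
    have hlip : LipschitzWith (K' + K) fun x => fn n x - f x := hK'.sub hK
    have hz := integral_inner_gradient_eq_zero gibbsMeasure_absolutelyContinuous
      (hA.union hB) hGi harm hlip (B := 1) (fun x => by
        rw [NNReal.coe_one, abs_le]
        constructor <;> linarith [(hI x).1, (hI x).2, (hI' x).1, (hI' x).2]) (by
        rintro x (hx | hx)
        · rw [h1 x hx, h1' x hx, sub_self]
        · rw [h0 x hx, h0' x hx, sub_self])
    rw [← sub_eq_zero, ← integral_sub (integrable_inner_gradient hGi hK')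
      (integrable_inner_gradient hGi hK), ← hz]
    refine integral_congr_ae ?_
    filter_upwards [gibbsMeasure_absolutelyContinuous (ae_gradient_add_smul hK' hK 1 (-1))]
      with x hx
    rw [← inner_sub_right]
    congr 1
    have : (fun y => fn n y - f y) = fun y => 1 * fn n y + -1 * f y := by ext; ring
    rw [this, hx]
    simp [sub_eq_add_neg]
  have hconv := (tendsto_toLp (fun n => (hfn n).memLp_gradient) hG.memLp_grad hlim)
  have h2 := (tendsto_const_nhds (x := hG.memLp_grad.toLp G)).inner hconv (𝕜 := ℝ)
  simp only [inner_toLp, hsame] at h2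
  rw [tendsto_nhds_unique tendsto_const_nhds h2]
  simp

/-- Cauchy–Schwarz applied to ‖G‖² = ⟨G, ∇f⟩. Only the defining properties of an equilibrium
potential enter, so this covers every such potential and not just a constructed minimiser. -/
theorem IsEquilibriumPotential.energy_le
    [IsFiniteMeasure (gibbsMeasure V ε)] (hε : 0 < ε) (hA : IsClosed A) (hB : IsClosed B)
    {h : EuclideanSpace ℝ ι → ℝ} {G : EuclideanSpace ℝ ι → EuclideanSpace ℝ ι}
    (hG : IsEquilibriumPotential V ε A B h G) {f : EuclideanSpace ℝ ι → ℝ}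
    (hf : IsAdmissible A B f) :
    ∫ y, ‖G y‖ ^ 2 ∂(gibbsMeasure V ε) ≤ ∫ y, ‖gradient f y‖ ^ 2 ∂(gibbsMeasure V ε) := by
  have h1 := hG.integral_inner_gradient_eq hε hA hB hf
  rw [← inner_toLp hG.memLp_grad hf.memLp_gradient, ← norm_toLp_sq hG.memLp_grad] at h1
  rw [← norm_toLp_sq hG.memLp_grad, ← norm_toLp_sq hf.memLp_gradient]
  have h2 := real_inner_le_norm (hG.memLp_grad.toLp G) (hf.memLp_gradient.toLp (gradient f))
  rw [h1] at h2
  have h3 := norm_nonneg (hG.memLp_grad.toLp G)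
  have h4 := norm_nonneg ((hf.memLp_gradient (μ := gibbsMeasure V ε)).toLp (gradient f))
  nlinarith

/-- The capacity is the Dirichlet energy of the equilibrium potential. -/
theorem capacity_eq_energy [IsFiniteMeasure (gibbsMeasure V ε)] (hε : 0 < ε)
    (hA : IsClosed A) (hB : IsClosed B)
    {χ : EuclideanSpace ℝ ι → ℝ} (hχ : IsSeparator A B χ)
    {h : EuclideanSpace ℝ ι → ℝ} {G : EuclideanSpace ℝ ι → EuclideanSpace ℝ ι}
    {e : Measure (EuclideanSpace ℝ ι)} (hG : IsEquilibriumPotential V ε A B h G)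
    (he : IsEquilibriumMeasure V ε A B G e)
    (hint : IntegrableOn (fun y => Real.exp (-V y / ε)) (frontier A) e) :
    ∫ y in frontier A, Real.exp (-V y / ε) ∂e = ε * ∫ y, ‖G y‖ ^ 2 ∂(gibbsMeasure V ε) := by
  have hGi : Integrable G (gibbsMeasure V ε) := hG.memLp_grad.integrable (by norm_num)
  obtain ⟨ρ, Kρ, hρ⟩ := exists_smooth_cutoffs (ι := ι)
  obtain ⟨Kχ, hKχ⟩ := hχ.lipschitz
  -- The separator χ is one on A and vanishes near B but need not have compact support. The weak
  -- equation is tested with χ ρ_n, and the cutoff is removed on both sides by dominated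
  -- convergence.
  have htest := fun n => hχ.isTestFunctionOff_mul (hρ n).1 (hρ n).2.1
  have hρabs : ∀ n x, |ρ n x| ≤ (1 : NNReal) := fun n x => by
    rw [abs_of_nonneg ((hρ n).2.2.2.1 x).1]; exact ((hρ n).2.2.2.1 x).2
  have hlip : ∀ n, LipschitzWith (1 * Kρ + 1 * Kχ) (fun x => χ x * ρ n x) := fun n =>
    lipschitzWith_mul_of_bounded hKχ (hρ n).2.2.1 hχ.abs_le (hρabs n)
  have hres : e.restrict (frontier A) = e :=
    Measure.restrict_eq_self_of_ae_mem (by rw [ae_iff]; exact he.concentrated)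
  have hlim1 : Tendsto (fun n => ∫ y, Real.exp (-V y / ε) * (χ y * ρ n y) ∂e) atTop
      (𝓝 (∫ y in frontier A, Real.exp (-V y / ε) ∂e)) := by
    rw [← hres]
    rw [Measure.restrict_restrict isClosed_frontier.measurableSet, Set.inter_self]
    refine tendsto_integral_of_dominated_convergence (fun y => Real.exp (-V y / ε))
      (fun n => hint.aestronglyMeasurable.mul
        (hχ.contDiff.continuous.mul (hρ n).1.continuous).aestronglyMeasurable) hint
      (fun n => Filter.Eventually.of_forall fun y => ?_) ?_
    · rw [norm_mul, Real.norm_of_nonneg (Real.exp_pos _).le, norm_mul, Real.norm_eq_abs,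
        Real.norm_eq_abs]
      have h1 := hχ.abs_le y
      have h2 := hρabs n y
      refine mul_le_of_le_one_right (Real.exp_pos _).le (mul_le_one₀ h1 (abs_nonneg _) h2)
    · rw [ae_restrict_iff' isClosed_frontier.measurableSet]
      refine Filter.Eventually.of_forall fun y hy => ?_
      have hyA : y ∈ A := hA.frontier_subset hy
      refine tendsto_const_nhds.congr' ?_
      obtain ⟨m, hm⟩ := exists_nat_ge ‖y‖
      filter_upwards [eventually_ge_atTop m] with n hn
      rw [hχ.eq_one hyA, (hρ n).2.2.2.2 y (hm.trans (by exact_mod_cast hn))]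
      ring
  have hlim2 : Tendsto (fun n => ∫ y, inner ℝ (G y) (gradient (fun x => χ x * ρ n x) y)
      ∂(gibbsMeasure V ε)) atTop (𝓝 (∫ y, inner ℝ (G y) (gradient χ y) ∂(gibbsMeasure V ε))) := by
    refine tendsto_integral_inner_of_bounded hGi
      (fun n => (measurable_gradient _).aestronglyMeasurable)
      (fun n => Filter.Eventually.of_forall (norm_gradient_le (hlip n)))
      (Filter.Eventually.of_forall fun x => ?_)
    refine tendsto_const_nhds.congr' ?_
    obtain ⟨m, hm⟩ := exists_nat_gt ‖x‖
    filter_upwards [eventually_ge_atTop m] with n hn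
    have : (fun y => χ y * ρ n y) =ᶠ[𝓝 x] χ := by
      filter_upwards [continuous_norm.continuousAt.eventually_lt continuousAt_const
          (hm.trans_le (by exact_mod_cast hn : (m : ℝ) ≤ n))] with y hy
      rw [(hρ n).2.2.2.2 y hy.le, mul_one]
    simp only [gradient, this.fderiv_eq]
  rw [hG.integral_inner_gradient_eq hε hA hB hχ.isAdmissible] at hlim2
  refine tendsto_nhds_unique hlim1 ((hlim2.const_mul ε).congr fun n => ?_)
  exact he.weak_eq _ (htest n)

theorem IsCapacity.le_energy [IsFiniteMeasure (gibbsMeasure V ε)] (hε : 0 < ε)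
    (hA : IsClosed A) (hB : IsClosed B)
    {χ : EuclideanSpace ℝ ι → ℝ} (hχ : IsSeparator A B χ) {c : ℝ} (hc : IsCapacity V ε A B c)
    {f : EuclideanSpace ℝ ι → ℝ} (hf : IsAdmissible A B f) :
    c ≤ ε * ∫ y, ‖gradient f y‖ ^ 2 ∂(gibbsMeasure V ε) := by
  obtain ⟨h, G, e, hG, he, hint, rfl⟩ := hc
  rw [capacity_eq_energy hε hA hB hχ hG he hint]
  exact mul_le_mul_of_nonneg_left (hG.energy_le hε hA hB hf) hε.le

/-- The field G need not be the gradient of an admissible function; the lower bound reaches it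
through the approximating sequence. -/
theorem IsCapacity.ge_of_forall_energy_ge [IsFiniteMeasure (gibbsMeasure V ε)] (hε : 0 < ε)
    (hA : IsClosed A) (hB : IsClosed B)
    {χ : EuclideanSpace ℝ ι → ℝ} (hχ : IsSeparator A B χ) {c : ℝ} (hc : IsCapacity V ε A B c)
    {b : ℝ} (hb : ∀ f, IsAdmissible A B f →
      b ≤ ε * ∫ y, ‖gradient f y‖ ^ 2 ∂(gibbsMeasure V ε)) : b ≤ c := by
  obtain ⟨h, G, e, hG, he, hint, rfl⟩ := hc
  rw [capacity_eq_energy hε hA hB hχ hG he hint]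
  obtain ⟨fn, hfn, -, hlim⟩ := hG.approx
  have hconv := (tendsto_toLp (fun n => (hfn n).memLp_gradient) hG.memLp_grad hlim)
  have h2 := ((hconv.norm.pow 2).const_mul ε)
  simp only [norm_toLp_sq] at h2
  exact ge_of_tendsto' h2 fun n => hb _ (hfn n)

/-- A capacity is a lower bound for all admissible energies and at least as large as any other lower
bound, so it is their infimum. -/
theorem IsCapacity.unique [IsFiniteMeasure (gibbsMeasure V ε)] (hε : 0 < ε)
    (hA : IsClosed A) (hB : IsClosed B)
    {χ : EuclideanSpace ℝ ι → ℝ} (hχ : IsSeparator A B χ) {c c' : ℝ}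
    (hc : IsCapacity V ε A B c) (hc' : IsCapacity V ε A B c') : c = c' :=
  le_antisymm
    (hc'.ge_of_forall_energy_ge hε hA hB hχ fun _ hf => hc.le_energy hε hA hB hχ hf)
    (hc.ge_of_forall_energy_ge hε hA hB hχ fun _ hf => hc'.le_energy hε hA hB hχ hf)

/-- Existence of the capacity of separated closed sets. -/
theorem exists_isCapacity [IsFiniteMeasure (gibbsMeasure V ε)] (hV : Continuous V)
    (hA : IsClosed A) {χ : EuclideanSpace ℝ ι → ℝ}
    (hχ : IsSeparator A B χ) (hε : 0 < ε) : ∃ c, IsCapacity V ε A B c := by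
  set μ := gibbsMeasure V ε with hμdef
  have hμ : μ ≪ volume := gibbsMeasure_absolutelyContinuous
  obtain ⟨h, G, fn, hh, hG, hI, h1, h0, hfn, hlim1, hlim2, hmin⟩ :=
    exists_dirichlet_minimizer hμ ⟨χ, hχ.isAdmissible⟩
  have hGi : Integrable G μ := hG.integrable (by norm_num)
  have hvar : ∀ {g : EuclideanSpace ℝ ι → ℝ} {K : NNReal}, LipschitzWith K g →
      (∀ x ∈ A, 0 ≤ g x) → (∀ x ∈ B, g x = 0) → 0 ≤ ∫ x, inner ℝ (G x) (gradient g x) ∂μ :=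
    fun hg hgA hgB =>
      integral_inner_gradient_nonneg_of_minimal hμ hG hfn hlim2 hmin hg hgA hgB
  -- A function vanishing on A ∪ B may be added with either sign, which turns the variational
  -- inequality into an equality.
  have harm : ∀ f, IsTestFunctionOff (A ∪ B) f → ∫ x, inner ℝ (G x) (gradient f x) ∂μ = 0 := by
    intro f hf
    obtain ⟨K, hK⟩ := hf.lipschitz
    have ha := hvar hK (fun x hx => (hf.eq_zero (Or.inl hx)).ge) fun x hx => hf.eq_zero (Or.inr hx)
    have hb := hvar hK.neg (fun x hx => by simp [hf.eq_zero (Or.inl hx)])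
      fun x hx => by simp [hf.eq_zero (Or.inr hx)]
    have : ∀ x, gradient (-f) x = -gradient f x := fun x => by
      simp [gradient, fderiv_neg]
    simp only [this, inner_neg_right, integral_neg] at hb
    linarith
  have hG0 : ∀ᵐ x ∂μ, x ∈ interior A → G x = 0 := by
    have h3 := tendstoInMeasure_of_tendsto_eLpNorm two_ne_zero
      (fun n => (hfn n).memLp_gradient.aestronglyMeasurable) hG.aestronglyMeasurable hlim2
    obtain ⟨ns, -, hns⟩ := h3.exists_seq_tendsto_ae
    filter_upwards [hns] with x hx hxA
    refine tendsto_nhds_unique hx (tendsto_const_nhds.congr fun i => ?_)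
    symm
    refine gradient_eq_zero_of_eventuallyEq_const (c := 1) ?_
    filter_upwards [isOpen_interior.mem_nhds hxA] with y hy
    exact (hfn _).2.2.1 y (interior_subset hy)
  obtain ⟨e, hefin, hecon, heweak⟩ := exists_finite_equilibrium_measure hχ hA hGi hG0 harm
    fun f hf hf0 => by
      obtain ⟨K, hK⟩ := hf.lipschitz
      exact hvar hK (fun x _ => hf0 x) fun x hx => hf.eq_zero hx
  -- The measure e represents the pairing of G and ∇f without the factor ε and without the weight
  -- e^{-V/ε}. The density ε e^{V/ε} supplies both, and the integrand of the capacity becomes the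
  -- constant ε.
  have hcont : Continuous fun y => ε * Real.exp (V y / ε) := by fun_prop
  have hdpos : ∀ y, 0 < ε * Real.exp (V y / ε) := fun y => by positivity
  have hmeas : Measurable fun y => ENNReal.ofReal (ε * Real.exp (V y / ε)) :=
    hcont.measurable.ennreal_ofReal
  have hprod : ∀ y, ε * Real.exp (V y / ε) * Real.exp (-V y / ε) = ε := fun y => by
    rw [mul_assoc, ← Real.exp_add]
    simp [neg_div]
  have hfinae : ∀ᵐ y ∂e, ENNReal.ofReal (ε * Real.exp (V y / ε)) < ⊤ :=
    Filter.Eventually.of_forall fun _ => ENNReal.ofReal_lt_top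
  refine ⟨_, h, G, e.withDensity fun y => ENNReal.ofReal (ε * Real.exp (V y / ε)),
    ⟨hh, hG, hI, h1, h0, ⟨fn, hfn, hlim1, hlim2⟩, fun f hf => ?_⟩, ⟨fun K hK => ?_, ?_, ?_⟩, ?_, rfl⟩
  · unfold dirichletForm
    rw [← hμdef, harm f hf, mul_zero]
  · have : IsLocallyFiniteMeasure (e.withDensity fun y => ENNReal.ofReal (ε * Real.exp (V y / ε))) :=
      IsLocallyFiniteMeasure.withDensity_ofReal hcont
    exact hK.measure_lt_top
  · exact withDensity_absolutelyContinuous _ _ hecon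
  · intro f hf
    rw [integral_withDensity_eq_integral_toReal_smul hmeas hfinae]
    unfold dirichletForm
    rw [← hμdef, heweak f hf, ← integral_const_mul]
    refine integral_congr_ae (Filter.Eventually.of_forall fun y => ?_)
    simp only [ENNReal.toReal_ofReal (hdpos y).le, smul_eq_mul]
    rw [← mul_assoc, hprod]
  · refine Integrable.integrableOn ?_
    rw [integrable_withDensity_iff_integrable_smul' hmeas hfinae]
    refine (integrable_const ε).congr (Filter.Eventually.of_forall fun y => ?_)
    simp only [ENNReal.toReal_ofReal (hdpos y).le, smul_eq_mul]
    rw [hprod]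

end Variational

/-! ### The real Fourier basis and trigonometric sums -/

section Fourier

variable {L : ℝ}

/-- With cosines at k > 0 and sines at k < 0 the signs work out so that a single formula covers all
k: differentiation flips the index. -/
theorem hasDerivAt_realFourierBasis (L : ℝ) (k : ℤ) (x : ℝ) :
    HasDerivAt (realFourierBasis L k) (2 * k * Real.pi / L * realFourierBasis L (-k) x) x := by
  have hlin : HasDerivAt (fun x : ℝ => 2 * k * Real.pi * x / L) (2 * k * Real.pi / L) x := by
    simpa using ((hasDerivAt_id x).const_mul (2 * k * Real.pi)).div_const L
  rcases lt_trichotomy k 0 with hk | hk | hk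
  · have h1 : realFourierBasis L k = fun x => √(2 / L) * Real.sin (2 * k * Real.pi * x / L) := by
      ext x; simp [realFourierBasis, hk.not_gt, hk.ne]
    rw [h1]
    refine (hlin.sin.const_mul _).congr_deriv ?_
    have : (2 : ℝ) * (-k : ℤ) * Real.pi * x / L = -(2 * k * Real.pi * x / L) := by push_cast; ring
    simp only [realFourierBasis, Left.neg_pos_iff, hk, if_true, this, Real.cos_neg]
    ring
  · subst hk
    have h1 : realFourierBasis L 0 = fun x => 1 / √L := by ext x; simp [realFourierBasis]
    rw [h1]
    simpa using hasDerivAt_const x (√L)⁻¹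
  · have h1 : realFourierBasis L k = fun x => √(2 / L) * Real.cos (2 * k * Real.pi * x / L) := by
      ext x; simp [realFourierBasis, hk]
    rw [h1]
    refine (hlin.cos.const_mul _).congr_deriv ?_
    have : (2 : ℝ) * (-k : ℤ) * Real.pi * x / L = -(2 * k * Real.pi * x / L) := by push_cast; ring
    have h2 : ¬ (-k = 0) := by omega
    simp only [realFourierBasis, Left.neg_pos_iff, hk.not_gt, h2, if_false, this, Real.sin_neg]
    ring

@[fun_prop]
theorem continuous_realFourierBasis (L : ℝ) (k : ℤ) : Continuous (realFourierBasis L k) :=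
  continuous_iff_continuousAt.mpr fun x => (hasDerivAt_realFourierBasis L k x).continuousAt

theorem deriv_realFourierBasis (L : ℝ) (k : ℤ) :
    deriv (realFourierBasis L k) = fun x => 2 * k * Real.pi / L * realFourierBasis L (-k) x :=
  funext fun x => (hasDerivAt_realFourierBasis L k x).deriv

theorem iteratedDeriv_two_realFourierBasis (L : ℝ) (k : ℤ) :
    iteratedDeriv 2 (realFourierBasis L k) =
      fun x => -(2 * k * Real.pi / L) ^ 2 * realFourierBasis L k x := by
  rw [iteratedDeriv_succ, iteratedDeriv_one, deriv_realFourierBasis]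
  ext x
  rw [((hasDerivAt_realFourierBasis L (-k) x).const_mul _).deriv, neg_neg]
  push_cast; ring

theorem realFourierBasis_zero (L x : ℝ) : realFourierBasis L 0 x = 1 / √L := by
  simp [realFourierBasis]

theorem abs_realFourierBasis_le (L : ℝ) (k : ℤ) (x : ℝ) :
    |realFourierBasis L k x| ≤ √(2 / L) := by
  unfold realFourierBasis
  split_ifs
  · rw [abs_mul, abs_of_nonneg (Real.sqrt_nonneg _)]
    exact mul_le_of_le_one_right (Real.sqrt_nonneg _) (Real.abs_cos_le_one _)
  · rcases le_or_gt L 0 with hL | hL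
    · rw [Real.sqrt_eq_zero_of_nonpos hL]; simp; positivity
    rw [abs_of_nonneg (by positivity), one_div, ← Real.sqrt_inv]
    refine Real.sqrt_le_sqrt ?_
    rw [inv_eq_one_div]; gcongr; norm_num
  · rw [abs_mul, abs_of_nonneg (Real.sqrt_nonneg _)]
    exact mul_le_of_le_one_right (Real.sqrt_nonneg _) (Real.abs_sin_le_one _)

theorem integral_cos_mode (hL : 0 < L) (m : ℤ) :
    ∫ x in (0 : ℝ)..L, Real.cos (2 * m * Real.pi * x / L) = if m = 0 then L else 0 := by
  split_ifs with hm
  · simp [hm]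
  · have hm' : (m : ℝ) ≠ 0 := by exact_mod_cast hm
    have h : ∀ x : ℝ, Real.cos (2 * m * Real.pi * x / L) =
        Real.cos ((2 * m * Real.pi / L) * x) := fun x => by ring_nf
    simp_rw [h]
    rw [intervalIntegral.integral_comp_mul_left _ (by positivity), integral_cos]
    have h2 : 2 * m * Real.pi / L * L = ((2 * m : ℤ) : ℝ) * Real.pi := by
      push_cast; field_simp
    rw [h2, Real.sin_int_mul_pi]; simp

theorem integral_sin_mode (hL : 0 < L) (m : ℤ) :
    ∫ x in (0 : ℝ)..L, Real.sin (2 * m * Real.pi * x / L) = 0 := by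
  by_cases hm : m = 0
  · simp [hm]
  · have hm' : (m : ℝ) ≠ 0 := by exact_mod_cast hm
    have h : ∀ x : ℝ, Real.sin (2 * m * Real.pi * x / L) =
        Real.sin ((2 * m * Real.pi / L) * x) := fun x => by ring_nf
    simp_rw [h]
    rw [intervalIntegral.integral_comp_mul_left _ (by positivity), integral_sin]
    have h2 : 2 * m * Real.pi / L * L = (m : ℝ) * (2 * Real.pi) := by
      field_simp
    rw [h2, Real.cos_int_mul_two_pi]; simp

/-- Product-to-sum formulas reduce the nine sign cases to integrals of single modes, which vanish
except for the cosine of frequency zero. -/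
theorem integral_realFourierBasis_mul (hL : 0 < L) (j k : ℤ) :
    ∫ x in (0 : ℝ)..L, realFourierBasis L j x * realFourierBasis L k x =
      if j = k then 1 else 0 := by
  have hii : ∀ f : ℝ → ℝ, Continuous f → IntervalIntegrable f volume 0 L :=
    fun f hf => hf.intervalIntegrable _ _
  have hc : ∀ m : ℤ, IntervalIntegrable (fun x : ℝ => Real.cos (2 * m * Real.pi * x / L))
    volume 0 L := fun m => hii _ (by fun_prop)
  have hs : ∀ m : ℤ, IntervalIntegrable (fun x : ℝ => Real.sin (2 * m * Real.pi * x / L))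
    volume 0 L := fun m => hii _ (by fun_prop)
  have hsq : √(2 / L) * √(2 / L) = 2 / L := Real.mul_self_sqrt (by positivity)
  have hsqL : 1 / √L * (1 / √L) = 1 / L := by
    rw [div_mul_div_comm, Real.mul_self_sqrt hL.le, one_mul]
  have hcc : ∀ j k : ℤ, ∀ x : ℝ, Real.cos (2 * j * Real.pi * x / L) *
      Real.cos (2 * k * Real.pi * x / L) =
      1 / 2 * (Real.cos (2 * (j - k : ℤ) * Real.pi * x / L) +
        Real.cos (2 * (j + k : ℤ) * Real.pi * x / L)) := by
    intro j k x
    have e1 : 2 * ((j - k : ℤ) : ℝ) * Real.pi * x / L =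
      2 * j * Real.pi * x / L - 2 * k * Real.pi * x / L := by push_cast; ring
    have e2 : 2 * ((j + k : ℤ) : ℝ) * Real.pi * x / L =
      2 * j * Real.pi * x / L + 2 * k * Real.pi * x / L := by push_cast; ring
    rw [e1, e2, Real.cos_add, Real.cos_sub]; ring
  have hss : ∀ j k : ℤ, ∀ x : ℝ, Real.sin (2 * j * Real.pi * x / L) *
      Real.sin (2 * k * Real.pi * x / L) =
      1 / 2 * (Real.cos (2 * (j - k : ℤ) * Real.pi * x / L) -
        Real.cos (2 * (j + k : ℤ) * Real.pi * x / L)) := by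
    intro j k x
    have e1 : 2 * ((j - k : ℤ) : ℝ) * Real.pi * x / L =
      2 * j * Real.pi * x / L - 2 * k * Real.pi * x / L := by push_cast; ring
    have e2 : 2 * ((j + k : ℤ) : ℝ) * Real.pi * x / L =
      2 * j * Real.pi * x / L + 2 * k * Real.pi * x / L := by push_cast; ring
    rw [e1, e2, Real.cos_add, Real.cos_sub]; ring
  have hsc : ∀ j k : ℤ, ∀ x : ℝ, Real.sin (2 * j * Real.pi * x / L) *
      Real.cos (2 * k * Real.pi * x / L) =
      1 / 2 * (Real.sin (2 * (j - k : ℤ) * Real.pi * x / L) +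
        Real.sin (2 * (j + k : ℤ) * Real.pi * x / L)) := by
    intro j k x
    have e1 : 2 * ((j - k : ℤ) : ℝ) * Real.pi * x / L =
      2 * j * Real.pi * x / L - 2 * k * Real.pi * x / L := by push_cast; ring
    have e2 : 2 * ((j + k : ℤ) : ℝ) * Real.pi * x / L =
      2 * j * Real.pi * x / L + 2 * k * Real.pi * x / L := by push_cast; ring
    rw [e1, e2, Real.sin_add, Real.sin_sub]; ring
  have icc : ∀ j k : ℤ, ∫ x in (0 : ℝ)..L, Real.cos (2 * j * Real.pi * x / L) *
      Real.cos (2 * k * Real.pi * x / L) =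
      1 / 2 * ((if j - k = 0 then L else 0) + if j + k = 0 then L else 0) := by
    intro j k
    simp_rw [hcc]
    rw [intervalIntegral.integral_const_mul, intervalIntegral.integral_add (hc _) (hc _),
      integral_cos_mode hL, integral_cos_mode hL]
  have iss : ∀ j k : ℤ, ∫ x in (0 : ℝ)..L, Real.sin (2 * j * Real.pi * x / L) *
      Real.sin (2 * k * Real.pi * x / L) =
      1 / 2 * ((if j - k = 0 then L else 0) - if j + k = 0 then L else 0) := by
    intro j k
    simp_rw [hss]
    rw [intervalIntegral.integral_const_mul, intervalIntegral.integral_sub (hc _) (hc _),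
      integral_cos_mode hL, integral_cos_mode hL]
  have isc : ∀ j k : ℤ, ∫ x in (0 : ℝ)..L, Real.sin (2 * j * Real.pi * x / L) *
      Real.cos (2 * k * Real.pi * x / L) = 0 := by
    intro j k
    simp_rw [hsc]
    rw [intervalIntegral.integral_const_mul, intervalIntegral.integral_add (hs _) (hs _),
      integral_sin_mode hL, integral_sin_mode hL]
    simp
  have epos : ∀ k : ℤ, 0 < k → ∀ x, realFourierBasis L k x =
      √(2 / L) * Real.cos (2 * k * Real.pi * x / L) := fun k hk x => by
    simp [realFourierBasis, hk]
  have eneg : ∀ k : ℤ, k < 0 → ∀ x, realFourierBasis L k x =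
      √(2 / L) * Real.sin (2 * k * Real.pi * x / L) := fun k hk x => by
    simp [realFourierBasis, hk.not_gt, hk.ne]
  rcases lt_trichotomy j 0 with hj | hj | hj <;> rcases lt_trichotomy k 0 with hk | hk | hk
  · simp_rw [eneg j hj, eneg k hk, mul_mul_mul_comm _ (Real.sin _), hsq]
    rw [intervalIntegral.integral_const_mul, iss, if_neg (by omega : ¬ j + k = 0)]
    by_cases h : j = k
    · simp only [h, sub_self, if_true]; field_simp; ring
    · rw [if_neg (by omega), if_neg h]; simp
  · subst hk
    simp_rw [eneg j hj, realFourierBasis_zero]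
    rw [intervalIntegral.integral_mul_const, intervalIntegral.integral_const_mul,
      integral_sin_mode hL, if_neg hj.ne]; simp
  · simp_rw [eneg j hj, epos k hk, mul_mul_mul_comm _ (Real.sin _), hsq]
    rw [intervalIntegral.integral_const_mul, isc, if_neg (by omega)]; simp
  · subst hj
    simp_rw [eneg k hk, realFourierBasis_zero]
    rw [intervalIntegral.integral_const_mul, intervalIntegral.integral_const_mul,
      integral_sin_mode hL, if_neg hk.ne']; simp
  · subst hj; subst hk
    simp_rw [realFourierBasis_zero, hsqL]
    simp [hL.ne']
  · subst hj
    simp_rw [epos k hk, realFourierBasis_zero]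
    rw [intervalIntegral.integral_const_mul, intervalIntegral.integral_const_mul,
      integral_cos_mode hL, if_neg hk.ne', if_neg hk.ne]; simp
  · simp_rw [eneg k hk, epos j hj, mul_mul_mul_comm _ (Real.cos _), hsq, mul_comm (Real.cos _)]
    rw [intervalIntegral.integral_const_mul, isc, if_neg (by omega)]; simp
  · subst hk
    simp_rw [epos j hj, realFourierBasis_zero]
    rw [intervalIntegral.integral_mul_const, intervalIntegral.integral_const_mul,
      integral_cos_mode hL, if_neg hj.ne', if_neg hj.ne']; simp
  · simp_rw [epos j hj, epos k hk, mul_mul_mul_comm _ (Real.cos _), hsq]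
    rw [intervalIntegral.integral_const_mul, icc, if_neg (by omega : ¬ j + k = 0)]
    by_cases h : j = k
    · simp only [h, sub_self, if_true]; field_simp; ring
    · rw [if_neg (by omega), if_neg h]; simp

theorem integral_realFourierBasis (hL : 0 < L) {k : ℤ} (hk : k ≠ 0) :
    ∫ x in (0 : ℝ)..L, realFourierBasis L k x = 0 := by
  have h := integral_realFourierBasis_mul hL 0 k
  simp_rw [realFourierBasis_zero] at h
  rw [intervalIntegral.integral_const_mul, if_neg hk.symm] at h
  exact (mul_eq_zero.mp h).resolve_left (by positivity)

section Sums

variable {ι : Type*} [Fintype ι]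

/-- The trigonometric sum `∑ a_i e_{κ i}(x)`. -/
def trigSum (L : ℝ) (κ : ι → ℤ) (a : ι → ℝ) (x : ℝ) : ℝ :=
  ∑ i, a i * realFourierBasis L (κ i) x

@[fun_prop]
theorem continuous_trigSum (L : ℝ) (κ : ι → ℤ) (a : ι → ℝ) : Continuous (trigSum L κ a) := by
  unfold trigSum; fun_prop

theorem continuous_uncurry_trigSum (L : ℝ) (κ : ι → ℤ) :
    Continuous fun p : (ι → ℝ) × ℝ => trigSum L κ p.1 p.2 := by
  unfold trigSum
  refine continuous_finsetSum _ fun i _ => ?_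
  exact ((continuous_apply i).comp continuous_fst).mul
    ((continuous_realFourierBasis L (κ i)).comp continuous_snd)

theorem deriv_trigSum (L : ℝ) (κ : ι → ℤ) (a : ι → ℝ) :
    deriv (trigSum L κ a) =
      trigSum L (fun i => -κ i) fun i => a i * (2 * κ i * Real.pi / L) := by
  ext x
  have h : HasDerivAt (trigSum L κ a)
      (∑ i, a i * (2 * κ i * Real.pi / L * realFourierBasis L (-κ i) x)) x :=
    HasDerivAt.fun_sum fun i _ => (hasDerivAt_realFourierBasis L (κ i) x).const_mul (a i)
  rw [h.deriv, trigSum]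
  exact Finset.sum_congr rfl fun i _ => by ring

theorem integral_trigSum_sq (hL : 0 < L) {κ : ι → ℤ} (hκ : Function.Injective κ) (a : ι → ℝ) :
    ∫ x in (0 : ℝ)..L, trigSum L κ a x ^ 2 = ∑ i, a i ^ 2 := by
  classical
  have h : ∀ x, trigSum L κ a x ^ 2 = ∑ i, ∑ j, a i * a j *
      (realFourierBasis L (κ i) x * realFourierBasis L (κ j) x) := by
    intro x
    rw [sq, trigSum, Finset.sum_mul_sum]
    exact Finset.sum_congr rfl fun i _ => Finset.sum_congr rfl fun j _ => by ring
  simp_rw [h]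
  rw [intervalIntegral.integral_finsetSum fun i _ =>
    Continuous.intervalIntegrable (by fun_prop) _ _]
  refine Finset.sum_congr rfl fun i _ => ?_
  rw [intervalIntegral.integral_finsetSum fun j _ =>
    Continuous.intervalIntegrable (by fun_prop) _ _]
  simp_rw [intervalIntegral.integral_const_mul, integral_realFourierBasis_mul hL, hκ.eq_iff]
  simp [sq]

theorem integral_deriv_trigSum_sq (hL : 0 < L) {κ : ι → ℤ} (hκ : Function.Injective κ)
    (a : ι → ℝ) :
    ∫ x in (0 : ℝ)..L, deriv (trigSum L κ a) x ^ 2 =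
      ∑ i, (2 * κ i * Real.pi / L) ^ 2 * a i ^ 2 := by
  rw [deriv_trigSum, integral_trigSum_sq hL (κ := fun i => -κ i) fun i j h => hκ (neg_injective h)]
  exact Finset.sum_congr rfl fun i _ => by ring

theorem integral_trigSum (hL : 0 < L) {κ : ι → ℤ} (hκ : ∀ i, κ i ≠ 0) (a : ι → ℝ) :
    ∫ x in (0 : ℝ)..L, trigSum L κ a x = 0 := by
  unfold trigSum
  rw [intervalIntegral.integral_finsetSum fun i _ =>
    Continuous.intervalIntegrable (by fun_prop) _ _]
  simp [intervalIntegral.integral_const_mul, integral_realFourierBasis hL (hκ _)]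

end Sums

end Fourier

/-! ### Exact expansions and two-sided bounds of the potential -/

section Potential

variable {L : ℝ} {N : ℕ}

/-- The zero Fourier mode. -/
def zeroIndex (N : ℕ) : Modes N := ⟨0, by simp⟩

/-- The inclusion of the nonzero modes into all modes. -/
def perpIndex (k : PerpModes N) : Modes N := ⟨k, Finset.mem_of_mem_erase k.2⟩

/-- All modes are the zero mode together with the nonzero ones. -/
def modesEquiv (N : ℕ) : Option (PerpModes N) ≃ Modes N where
  toFun o := o.elim (zeroIndex N) perpIndex
  invFun k := if h : (k : ℤ) = 0 then none else some ⟨k, Finset.mem_erase.mpr ⟨h, k.2⟩⟩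
  left_inv o := by
    rcases o with _ | k
    · simp [zeroIndex]
    · have : (k : ℤ) ≠ 0 := (Finset.mem_erase.mp k.2).1
      simp [perpIndex, this]
  right_inv k := by
    by_cases h : (k : ℤ) = 0
    · simp only [h, dite_true, Option.elim]
      exact Subtype.ext h.symm
    · simp [h, perpIndex]

theorem sum_modes {M : Type*} [AddCommMonoid M] (f : Modes N → M) :
    ∑ k, f k = f (zeroIndex N) + ∑ k : PerpModes N, f (perpIndex k) := by
  rw [← (modesEquiv N).sum_comp, Fintype.sum_option]; rfl

theorem prod_modes {M : Type*} [CommMonoid M] (f : Modes N → M) :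
    ∏ k, f k = f (zeroIndex N) * ∏ k : PerpModes N, f (perpIndex k) := by
  rw [← (modesEquiv N).prod_comp, Fintype.prod_option]; rfl

theorem perpModes_ne_zero (k : PerpModes N) : (k : ℤ) ≠ 0 := (Finset.mem_erase.mp k.2).1

theorem card_modes (N : ℕ) : Fintype.card (Modes N) = 2 * N + 1 := by
  simp [Modes]; omega

theorem card_perpModes (N : ℕ) : Fintype.card (PerpModes N) = 2 * N := by
  have := Fintype.card_congr (modesEquiv N)
  rw [Fintype.card_option, card_modes] at this
  omega

/-- The eigenvalues of `-Δ`. -/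
def lam (L : ℝ) (k : ℤ) : ℝ := (2 * k * Real.pi / L) ^ 2

theorem laplacianPerp_eq (hL : 0 < L) :
    laplacianPerp L N = Matrix.diagonal fun k : PerpModes N => -lam L k := by
  ext j k
  rw [laplacianPerp, Matrix.of_apply, iteratedDeriv_two_realFourierBasis]
  simp_rw [mul_left_comm (realFourierBasis L j _)]
  rw [intervalIntegral.integral_const_mul, integral_realFourierBasis_mul hL, Matrix.diagonal_apply]
  by_cases h : j = k
  · simp [h, lam]
  · have : (j : ℤ) ≠ k := fun h' => h (Subtype.ext h')
    simp [h, this]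

theorem det_neg_laplacianPerp_add (hL : 0 < L) :
    (-laplacianPerp L N + (2 : ℝ) • (1 : Matrix _ _ ℝ)).det = ∏ k : PerpModes N, nu L k := by
  rw [laplacianPerp_eq hL, ← Matrix.diagonal_one, ← Matrix.diagonal_smul, ← Matrix.diagonal_neg,
    neg_neg, Matrix.diagonal_add, Matrix.det_diagonal]
  simp [nu, lam]

theorem det_neg_laplacianPerp_sub (hL : 0 < L) :
    (-laplacianPerp L N - (1 : Matrix _ _ ℝ)).det = ∏ k : PerpModes N, mu L k := by
  rw [laplacianPerp_eq hL, ← Matrix.diagonal_one, ← Matrix.diagonal_neg, neg_neg,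
    Matrix.diagonal_sub, Matrix.det_diagonal]
  simp [mu, lam]

theorem toFun_eq_trigSum (φ : GalerkinSpace N) :
    toFun L φ = trigSum L (fun k : Modes N => (k : ℤ)) φ := rfl

/-- The mean-zero part of the function with Fourier coefficients `φ`. -/
def perpFun (L : ℝ) (ψ : PerpModes N → ℝ) : ℝ → ℝ := trigSum L (fun k : PerpModes N => (k : ℤ)) ψ

@[fun_prop]
theorem continuous_toFun (φ : GalerkinSpace N) : Continuous (toFun L φ) := by
  rw [toFun_eq_trigSum]; fun_prop

@[fun_prop]
theorem continuous_perpFun (ψ : PerpModes N → ℝ) : Continuous (perpFun L ψ) := by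
  unfold perpFun; fun_prop

theorem toFun_eq_zeroMode_add (φ : GalerkinSpace N) (x : ℝ) :
    toFun L φ x = zeroMode φ / √L + perpFun L (fun k => φ (perpIndex k)) x := by
  rw [toFun, sum_modes, perpFun, trigSum]
  congr 1
  simp [zeroIndex, realFourierBasis_zero, zeroMode, div_eq_mul_inv]

theorem potential_eq (hL : 0 < L) (φ : GalerkinSpace N) :
    potential L N φ = 1 / 2 * ∑ k : Modes N, lam L k * φ k ^ 2 +
      ∫ x in (0 : ℝ)..L, 1 / 4 * (toFun L φ x ^ 2 - 1) ^ 2 := by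
  have hd : Continuous (deriv (toFun L φ)) := by
    rw [toFun_eq_trigSum, deriv_trigSum]; fun_prop
  unfold potential
  rw [intervalIntegral.integral_add (Continuous.intervalIntegrable (by fun_prop) _ _)
    (Continuous.intervalIntegrable (by fun_prop) _ _), intervalIntegral.integral_const_mul]
  congr 2
  exact integral_deriv_trigSum_sq hL Subtype.val_injective φ

theorem continuous_potential (hL : 0 < L) (N : ℕ) : Continuous (potential L N) := by
  have : potential L N = fun φ => 1 / 2 * ∑ k : Modes N, lam L k * φ k ^ 2 +
      ∫ x in (0 : ℝ)..L, 1 / 4 * (toFun L φ x ^ 2 - 1) ^ 2 := funext (potential_eq hL)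
  rw [this]
  refine Continuous.add (by fun_prop) ?_
  refine intervalIntegral.continuous_parametric_intervalIntegral_of_continuous' ?_ _ _
  have h1 : Continuous fun p : GalerkinSpace N × ℝ => toFun L p.1 p.2 :=
    (continuous_uncurry_trigSum L (fun k : Modes N => (k : ℤ))).comp
      (((PiLp.continuous_ofLp 2 _).comp continuous_fst).prodMk continuous_snd)
  change Continuous fun p : GalerkinSpace N × ℝ => 1 / 4 * (toFun L p.1 p.2 ^ 2 - 1) ^ 2
  fun_prop

theorem potential_neg (φ : GalerkinSpace N) : potential L N (-φ) = potential L N φ := by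
  have h : toFun L (-φ) = fun x => -toFun L φ x := by
    ext x; simp [toFun]
  unfold potential
  rw [h]
  simp [deriv.fun_neg]

/-- The constant function `1` in Fourier coordinates. -/
def oneVector (L : ℝ) (N : ℕ) : GalerkinSpace N := EuclideanSpace.single (zeroIndex N) √L

theorem toFun_oneVector_add (hL : 0 < L) (u : GalerkinSpace N) (x : ℝ) :
    toFun L (oneVector L N + u) x = 1 + toFun L u x := by
  have h : √L ≠ 0 := by positivity
  simp [toFun, oneVector, add_mul, Finset.sum_add_distrib]
  simp [zeroIndex, realFourierBasis_zero, h]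

/-- The expansion about the well is finite: ((1 + t)² - 1)²/4 = t² + t³ + t⁴/4, and the term t²
turns -Δ into -Δ + 2. -/
theorem potential_oneVector_add (hL : 0 < L) (u : GalerkinSpace N) :
    potential L N (oneVector L N + u) = 1 / 2 * ∑ k : Modes N, nu L k * u k ^ 2 +
      ((∫ x in (0 : ℝ)..L, toFun L u x ^ 3) + 1 / 4 * ∫ x in (0 : ℝ)..L, toFun L u x ^ 4) := by
  have h1 : ∑ k : Modes N, lam L k * (oneVector L N + u) k ^ 2 =
      ∑ k : Modes N, lam L k * u k ^ 2 := by
    refine Finset.sum_congr rfl fun k _ => ?_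
    by_cases hk : k = zeroIndex N
    · simp [hk, zeroIndex, lam]
    · simp [oneVector, hk]
  have h2 : ∀ x, 1 / 4 * (toFun L (oneVector L N + u) x ^ 2 - 1) ^ 2 =
      toFun L u x ^ 2 + (toFun L u x ^ 3 + 1 / 4 * toFun L u x ^ 4) := by
    intro x; rw [toFun_oneVector_add hL]; ring
  have h3 : ∑ k : Modes N, nu L k * u k ^ 2 =
      ∑ k : Modes N, lam L k * u k ^ 2 + 2 * ∑ k : Modes N, u k ^ 2 := by
    rw [Finset.mul_sum, ← Finset.sum_add_distrib]
    exact Finset.sum_congr rfl fun k _ => by simp only [nu, lam]; ring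
  have h4 := integral_trigSum_sq hL (Subtype.val_injective (p := (· ∈ Finset.Icc (-(N : ℤ)) N))) u
  rw [potential_eq hL, h1, h3]
  simp_rw [h2]
  rw [intervalIntegral.integral_add (Continuous.intervalIntegrable (by fun_prop) _ _)
    (Continuous.intervalIntegrable (by fun_prop) _ _),
    intervalIntegral.integral_add (Continuous.intervalIntegrable (by fun_prop) _ _)
    (Continuous.intervalIntegrable (by fun_prop) _ _), intervalIntegral.integral_const_mul,
    toFun_eq_trigSum]
  rw [show (∫ x in (0 : ℝ)..L, trigSum L (fun k : Modes N => (k : ℤ)) u x ^ 2) = _ from h4]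
  ring

/-- Expansion about the constant a = φ₀/√L. The part linear in the mean-zero component p integrates
to zero, the term -p²/2 enters the eigenvalues μ_k, and what is left has the nonnegative integrand
exploited in `potential_ge`. -/
theorem potential_eq_potentialZero_add (hL : 0 < L) (φ : GalerkinSpace N) :
    potential L N φ = potentialZero L (zeroMode φ) +
      1 / 2 * ∑ k : PerpModes N, mu L k * φ (perpIndex k) ^ 2 +
      ∫ x in (0 : ℝ)..L, perpFun L (fun k => φ (perpIndex k)) x ^ 2 *
        (3 / 2 * (zeroMode φ / √L) ^ 2 +
          zeroMode φ / √L * perpFun L (fun k => φ (perpIndex k)) x +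
          1 / 4 * perpFun L (fun k => φ (perpIndex k)) x ^ 2) := by
  set a := zeroMode φ / √L with ha
  set ψ : PerpModes N → ℝ := fun k => φ (perpIndex k) with hψ
  have h1 : ∑ k : Modes N, lam L k * φ k ^ 2 = ∑ k : PerpModes N, lam L k * ψ k ^ 2 := by
    rw [sum_modes]; simp [zeroIndex, lam, perpIndex, hψ]
  have h2 : ∀ x, 1 / 4 * (toFun L φ x ^ 2 - 1) ^ 2 =
      1 / 4 * (a ^ 2 - 1) ^ 2 + (a * (a ^ 2 - 1) * perpFun L ψ x + (-1 / 2 * perpFun L ψ x ^ 2 +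
      perpFun L ψ x ^ 2 * (3 / 2 * a ^ 2 + a * perpFun L ψ x + 1 / 4 * perpFun L ψ x ^ 2))) := by
    intro x; rw [toFun_eq_zeroMode_add]; ring
  have h3 : ∑ k : PerpModes N, mu L k * ψ k ^ 2 =
      ∑ k : PerpModes N, lam L k * ψ k ^ 2 - ∑ k : PerpModes N, ψ k ^ 2 := by
    rw [← Finset.sum_sub_distrib]
    exact Finset.sum_congr rfl fun k _ => by simp only [mu, lam]; ring
  have h4 : ∫ x in (0 : ℝ)..L, perpFun L ψ x ^ 2 = ∑ k : PerpModes N, ψ k ^ 2 :=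
    integral_trigSum_sq hL Subtype.val_injective ψ
  have h5 : ∫ x in (0 : ℝ)..L, perpFun L ψ x = 0 := integral_trigSum hL perpModes_ne_zero ψ
  have h6 : potentialZero L (zeroMode φ) = L * (1 / 4 * (a ^ 2 - 1) ^ 2) := by
    rw [potentialZero, ha, div_pow, Real.sq_sqrt hL.le]; ring
  rw [potential_eq hL, h1, h3, h6]
  simp_rw [h2]
  rw [intervalIntegral.integral_add (Continuous.intervalIntegrable (by fun_prop) _ _)
    (Continuous.intervalIntegrable (by fun_prop) _ _),
    intervalIntegral.integral_add (Continuous.intervalIntegrable (by fun_prop) _ _)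
    (Continuous.intervalIntegrable (by fun_prop) _ _),
    intervalIntegral.integral_add (Continuous.intervalIntegrable (by fun_prop) _ _)
    (Continuous.intervalIntegrable (by fun_prop) _ _), intervalIntegral.integral_const_mul,
    intervalIntegral.integral_const_mul, intervalIntegral.integral_const_mul, h4, h5,
    intervalIntegral.integral_const]
  simp only [smul_eq_mul, sub_zero]
  ring

/-- The bracket of the remainder is (a + p/2)² + a²/2, where a is the constant part and p the
mean-zero part. Coercivity and the upper bound on the capacity both come from this inequality. -/
theorem potential_ge (hL : 0 < L) (φ : GalerkinSpace N) :
    potentialZero L (zeroMode φ) + 1 / 2 * ∑ k : PerpModes N, mu L k * φ (perpIndex k) ^ 2 ≤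
      potential L N φ := by
  rw [potential_eq_potentialZero_add hL]
  refine le_add_of_nonneg_right (intervalIntegral.integral_nonneg hL.le fun x _ => ?_)
  refine mul_nonneg (sq_nonneg _) ?_
  nlinarith [sq_nonneg (zeroMode φ / √L + 1 / 2 * perpFun L (fun k => φ (perpIndex k)) x),
    sq_nonneg (zeroMode φ / √L)]

/-- Uses a p ≤ (a² + p²)/2. An upper bound on V bounds the resistance of curves across the saddle,
as the lower bound on the capacity requires. -/
theorem potential_le (hL : 0 < L) (φ : GalerkinSpace N) :
    potential L N φ ≤ potentialZero L (zeroMode φ) +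
      1 / 2 * ∑ k : PerpModes N, mu L k * φ (perpIndex k) ^ 2 +
      2 * zeroMode φ ^ 2 / L * ∑ k : PerpModes N, φ (perpIndex k) ^ 2 +
      3 / 4 * ∫ x in (0 : ℝ)..L, perpFun L (fun k => φ (perpIndex k)) x ^ 4 := by
  rw [potential_eq_potentialZero_add hL]
  set ψ : PerpModes N → ℝ := fun k => φ (perpIndex k) with hψ
  set a := zeroMode φ / √L with ha
  have h4 : ∫ x in (0 : ℝ)..L, perpFun L ψ x ^ 2 = ∑ k : PerpModes N, ψ k ^ 2 :=
    integral_trigSum_sq hL Subtype.val_injective ψ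
  have h6 : 2 * zeroMode φ ^ 2 / L = 2 * a ^ 2 := by
    rw [ha, div_pow, Real.sq_sqrt hL.le]; ring
  rw [add_assoc (_ + _) (_ * _) (_ * _), h6, ← h4, ← intervalIntegral.integral_const_mul,
    ← intervalIntegral.integral_const_mul,
    ← intervalIntegral.integral_add (Continuous.intervalIntegrable (by fun_prop) _ _)
    (Continuous.intervalIntegrable (by fun_prop) _ _)]
  gcongr
  refine intervalIntegral.integral_mono hL.le (Continuous.intervalIntegrable (by fun_prop) _ _)
    (Continuous.intervalIntegrable (by fun_prop) _ _) fun x => ?_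
  have h7 : 0 ≤ perpFun L ψ x ^ 2 * (a - perpFun L ψ x) ^ 2 := by positivity
  nlinarith [h7]

end Potential

/-! ### Gaussian measures and their exponential moments -/

section Gaussian

theorem integrable_exp_quadratic {w : ℝ} (hw : 0 < w) (a : ℝ) :
    Integrable fun x : ℝ => Real.exp (-(1 / 2 * (w * x ^ 2)) + a * x) := by
  have h := ((integrable_exp_neg_mul_sq (half_pos hw)).comp_sub_right (a / w)).const_mul
    (Real.exp (a ^ 2 / (2 * w)))
  refine h.congr (Filter.Eventually.of_forall fun x => ?_)
  simp only
  rw [← Real.exp_add]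
  congr 1
  field_simp; ring

theorem integral_exp_quadratic {w : ℝ} (hw : 0 < w) (a : ℝ) :
    ∫ x : ℝ, Real.exp (-(1 / 2 * (w * x ^ 2)) + a * x) =
      √(2 * Real.pi / w) * Real.exp (1 / 2 * (a ^ 2 / w)) := by
  have h1 : ∀ x : ℝ, Real.exp (-(1 / 2 * (w * x ^ 2)) + a * x) =
      Real.exp (1 / 2 * (a ^ 2 / w)) * Real.exp (-(w / 2) * (x - a / w) ^ 2) := by
    intro x
    rw [← Real.exp_add]
    congr 1
    field_simp; ring
  simp_rw [h1]
  rw [integral_const_mul, integral_sub_right_eq_self (fun x => Real.exp (-(w / 2) * x ^ 2)),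
    integral_gaussian, mul_comm]
  congr 2
  field_simp

variable {ι : Type*} [Fintype ι]

/-- The normalisation `∏ √(2π/w_i)` of the Gaussian weight. -/
def gaussNorm (w : ι → ℝ) : ℝ := ∏ i, √(2 * Real.pi / w i)

theorem gaussNorm_pos {w : ι → ℝ} (hw : ∀ i, 0 < w i) : 0 < gaussNorm w :=
  Finset.prod_pos fun i _ => Real.sqrt_pos.mpr (div_pos (by positivity) (hw i))

theorem exp_quadratic_eq_prod (w a x : ι → ℝ) :
    Real.exp (-(1 / 2 * ∑ i, w i * x i ^ 2) + ∑ i, a i * x i) =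
      ∏ i, Real.exp (-(1 / 2 * (w i * x i ^ 2)) + a i * x i) := by
  rw [← Real.exp_sum, Finset.sum_add_distrib, Finset.sum_neg_distrib, Finset.mul_sum]

theorem integrable_exp_quadratic_pi {w : ι → ℝ} (hw : ∀ i, 0 < w i) (a : ι → ℝ) :
    Integrable fun x : ι → ℝ => Real.exp (-(1 / 2 * ∑ i, w i * x i ^ 2) + ∑ i, a i * x i) := by
  simp_rw [exp_quadratic_eq_prod]
  exact Integrable.fintype_prod (f := fun i (y : ℝ) => Real.exp (-(1 / 2 * (w i * y ^ 2)) + a i * y))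
    fun i => integrable_exp_quadratic (hw i) (a i)

theorem integral_exp_quadratic_pi {w : ι → ℝ} (hw : ∀ i, 0 < w i) (a : ι → ℝ) :
    ∫ x : ι → ℝ, Real.exp (-(1 / 2 * ∑ i, w i * x i ^ 2) + ∑ i, a i * x i) =
      gaussNorm w * Real.exp (1 / 2 * ∑ i, a i ^ 2 / w i) := by
  simp_rw [exp_quadratic_eq_prod]
  rw [integral_fintype_prod_volume_eq_prod
    (fun i (y : ℝ) => Real.exp (-(1 / 2 * (w i * y ^ 2)) + a i * y))]
  simp_rw [integral_exp_quadratic (hw _)]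
  rw [Finset.prod_mul_distrib, ← Real.exp_sum, Finset.mul_sum, gaussNorm]

theorem integrable_gaussWeight {w : ι → ℝ} (hw : ∀ i, 0 < w i) :
    Integrable fun x : ι → ℝ => Real.exp (-(1 / 2 * ∑ i, w i * x i ^ 2)) := by
  simpa using integrable_exp_quadratic_pi hw 0

theorem integral_gaussWeight {w : ι → ℝ} (hw : ∀ i, 0 < w i) :
    ∫ x : ι → ℝ, Real.exp (-(1 / 2 * ∑ i, w i * x i ^ 2)) = gaussNorm w := by
  simpa using integral_exp_quadratic_pi hw 0

/-- The density of the centred Gaussian measure with independent coordinates of variance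
`1 / w i`. -/
def gaussDensity (w x : ι → ℝ) : ℝ :=
  (gaussNorm w)⁻¹ * Real.exp (-(1 / 2 * ∑ i, w i * x i ^ 2))

/-- The centred Gaussian measure with independent coordinates of variance `1 / w i`. -/
def gaussPi (w : ι → ℝ) : Measure (ι → ℝ) :=
  volume.withDensity fun x => ENNReal.ofReal (gaussDensity w x)

theorem gaussDensity_pos {w : ι → ℝ} (hw : ∀ i, 0 < w i) (x : ι → ℝ) : 0 < gaussDensity w x :=
  mul_pos (inv_pos.mpr (gaussNorm_pos hw)) (Real.exp_pos _)

@[fun_prop]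
theorem continuous_gaussDensity (w : ι → ℝ) : Continuous (gaussDensity w) := by
  unfold gaussDensity; fun_prop

theorem lintegral_gaussPi (w : ι → ℝ) (F : (ι → ℝ) → ENNReal) :
    ∫⁻ x, F x ∂(gaussPi w) = ∫⁻ x, ENNReal.ofReal (gaussDensity w x) * F x := by
  rw [gaussPi, lintegral_withDensity_eq_lintegral_mul_non_measurable _
    (continuous_gaussDensity w).measurable.ennreal_ofReal
    (Filter.Eventually.of_forall fun _ => ENNReal.ofReal_lt_top)]
  rfl

theorem integral_gaussPi {w : ι → ℝ} (hw : ∀ i, 0 < w i) (F : (ι → ℝ) → ℝ) :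
    ∫ x, F x ∂(gaussPi w) = ∫ x, gaussDensity w x * F x := by
  rw [gaussPi, integral_withDensity_eq_integral_toReal_smul
    (continuous_gaussDensity w).measurable.ennreal_ofReal
    (Filter.Eventually.of_forall fun _ => ENNReal.ofReal_lt_top)]
  simp [ENNReal.toReal_ofReal (gaussDensity_pos hw _).le]

theorem integrable_gaussPi_iff {w : ι → ℝ} (hw : ∀ i, 0 < w i) {F : (ι → ℝ) → ℝ} :
    Integrable F (gaussPi w) ↔ Integrable fun x => gaussDensity w x * F x := by
  rw [gaussPi, integrable_withDensity_iff_integrable_smul'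
    (continuous_gaussDensity w).measurable.ennreal_ofReal
    (Filter.Eventually.of_forall fun _ => ENNReal.ofReal_lt_top)]
  simp [ENNReal.toReal_ofReal (gaussDensity_pos hw _).le]

theorem isProbabilityMeasure_gaussPi {w : ι → ℝ} (hw : ∀ i, 0 < w i) :
    IsProbabilityMeasure (gaussPi w) := by
  constructor
  rw [← lintegral_one, lintegral_gaussPi]
  simp only [mul_one]
  rw [← ofReal_integral_eq_lintegral_ofReal (f := gaussDensity w)
    ((integrable_gaussWeight hw).const_mul _) (Filter.Eventually.of_forall fun x => (gaussDensity_pos hw x).le)]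
  unfold gaussDensity
  rw [integral_const_mul, integral_gaussWeight hw, inv_mul_cancel₀ (gaussNorm_pos hw).ne',
    ENNReal.ofReal_one]

theorem integrable_exp_linear {w : ι → ℝ} (hw : ∀ i, 0 < w i) (a : ι → ℝ) :
    Integrable (fun x => Real.exp (∑ i, a i * x i)) (gaussPi w) := by
  rw [integrable_gaussPi_iff hw]
  refine ((integrable_exp_quadratic_pi hw a).const_mul (gaussNorm w)⁻¹).congr
    (Filter.Eventually.of_forall fun x => ?_)
  simp only [gaussDensity, Real.exp_add]; ring

theorem integral_exp_linear {w : ι → ℝ} (hw : ∀ i, 0 < w i) (a : ι → ℝ) :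
    ∫ x, Real.exp (∑ i, a i * x i) ∂(gaussPi w) = Real.exp (1 / 2 * ∑ i, a i ^ 2 / w i) := by
  rw [integral_gaussPi hw]
  have h : ∀ x : ι → ℝ, gaussDensity w x * Real.exp (∑ i, a i * x i) =
      (gaussNorm w)⁻¹ * Real.exp (-(1 / 2 * ∑ i, w i * x i ^ 2) + ∑ i, a i * x i) := fun x => by
    simp only [gaussDensity, Real.exp_add]; ring
  simp_rw [h]
  rw [integral_const_mul, integral_exp_quadratic_pi hw, ← mul_assoc,
    inv_mul_cancel₀ (gaussNorm_pos hw).ne', one_mul]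

theorem integrable_cosh_linear {w : ι → ℝ} (hw : ∀ i, 0 < w i) (a : ι → ℝ) :
    Integrable (fun x => Real.cosh (∑ i, a i * x i)) (gaussPi w) := by
  have h := ((integrable_exp_linear hw a).add (integrable_exp_linear hw (-a))).div_const 2
  refine h.congr (Filter.Eventually.of_forall fun x => ?_)
  simp [Real.cosh_eq]

theorem integral_cosh_linear {w : ι → ℝ} (hw : ∀ i, 0 < w i) (a : ι → ℝ) :
    ∫ x, Real.cosh (∑ i, a i * x i) ∂(gaussPi w) = Real.exp (1 / 2 * ∑ i, a i ^ 2 / w i) := by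
  have h : ∀ x : ι → ℝ, Real.cosh (∑ i, a i * x i) =
      (Real.exp (∑ i, a i * x i) + Real.exp (∑ i, (-a) i * x i)) / 2 := fun x => by
    simp [Real.cosh_eq]
  simp_rw [h]
  rw [integral_div, integral_add (integrable_exp_linear hw a) (integrable_exp_linear hw (-a)),
    integral_exp_linear hw, integral_exp_linear hw]
  simp

/-- With t = 2b/w each factor is (1 - t)^{-1/2} ≤ e^t. The condition 4b ≤ w gives t ≤ 1/2, away from
the singularity, so the bound depends on the dimension only through Σ b/w. -/
theorem gaussNorm_div_le {w b : ι → ℝ} (hw : ∀ i, 0 < w i) (hb : ∀ i, 0 ≤ b i)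
    (hbw : ∀ i, 4 * b i ≤ w i) :
    (gaussNorm w)⁻¹ * gaussNorm (fun i => w i - 2 * b i) ≤ Real.exp (2 * ∑ i, b i / w i) := by
  rw [gaussNorm, gaussNorm, ← Finset.prod_inv_distrib, ← Finset.prod_mul_distrib, Finset.mul_sum,
    Real.exp_sum]
  refine Finset.prod_le_prod (fun i _ => by positivity) fun i _ => ?_
  have hwi := hw i
  have hd : 0 < w i - 2 * b i := by linarith [hbw i, hb i]
  rw [← Real.sqrt_inv, ← Real.sqrt_mul (by positivity)]
  refine Real.sqrt_le_iff.mpr ⟨(Real.exp_pos _).le, ?_⟩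
  rw [← Real.exp_nat_mul]
  set t := 2 * (b i / w i) with ht
  have ht0 : 0 ≤ t := by have := hb i; positivity
  have ht1 : t ≤ 1 / 2 := by
    rw [ht, ← mul_div_assoc, div_le_iff₀ hwi]; linarith [hbw i]
  have h1 : (2 * Real.pi / w i)⁻¹ * (2 * Real.pi / (w i - 2 * b i)) = (1 - t)⁻¹ := by
    have : w i - 2 * b i = w i * (1 - t) := by rw [ht]; field_simp
    rw [this]
    have : 1 - t ≠ 0 := by linarith
    field_simp
  rw [h1, inv_le_iff_one_le_mul₀ (by linarith)]
  -- From e^{2t} ≥ 1 + 2t + 2t² follows (1 - t) e^{2t} ≥ 1 + t - 2t³ ≥ 1.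
  have h2 := Real.quadratic_le_exp_of_nonneg (x := ((2 : ℕ) : ℝ) * t) (by positivity)
  push_cast at h2 ⊢
  have h3 : t ^ 2 ≤ 1 / 4 := by nlinarith
  nlinarith [mul_le_mul_of_nonneg_left h2 (by linarith : 0 ≤ 1 - t)]

theorem gaussDensity_mul_exp_sq (w b x : ι → ℝ) :
    gaussDensity w x * Real.exp (∑ i, b i * x i ^ 2) =
      (gaussNorm w)⁻¹ * Real.exp (-(1 / 2 * ∑ i, (w i - 2 * b i) * x i ^ 2)) := by
  rw [gaussDensity, mul_assoc, ← Real.exp_add]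
  congr 2
  rw [Finset.mul_sum, Finset.mul_sum, ← Finset.sum_neg_distrib, ← Finset.sum_neg_distrib,
    ← Finset.sum_add_distrib]
  exact Finset.sum_congr rfl fun i _ => by ring

theorem integrable_exp_sq {w b : ι → ℝ} (hw : ∀ i, 0 < w i)
    (hbw : ∀ i, 4 * b i ≤ w i) : Integrable (fun x => Real.exp (∑ i, b i * x i ^ 2)) (gaussPi w) := by
  have hd : ∀ i, 0 < w i - 2 * b i := fun i => by linarith [hbw i, hw i]
  rw [integrable_gaussPi_iff hw]
  refine ((integrable_gaussWeight hd).const_mul (gaussNorm w)⁻¹).congr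
    (Filter.Eventually.of_forall fun x => ?_)
  exact (gaussDensity_mul_exp_sq w b x).symm

theorem integral_exp_sq_le {w b : ι → ℝ} (hw : ∀ i, 0 < w i) (hb : ∀ i, 0 ≤ b i)
    (hbw : ∀ i, 4 * b i ≤ w i) :
    ∫ x, Real.exp (∑ i, b i * x i ^ 2) ∂(gaussPi w) ≤ Real.exp (2 * ∑ i, b i / w i) := by
  have hd : ∀ i, 0 < w i - 2 * b i := fun i => by linarith [hbw i, hb i, hw i]
  refine le_trans (le_of_eq ?_) (gaussNorm_div_le hw hb hbw)
  rw [integral_gaussPi hw, ← integral_gaussWeight hd, ← integral_const_mul]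
  refine integral_congr_ae (Filter.Eventually.of_forall fun x => ?_)
  exact gaussDensity_mul_exp_sq w b x

theorem integral_gaussPi_of_odd {w : ι → ℝ} (hw : ∀ i, 0 < w i) {F : (ι → ℝ) → ℝ}
    (hF : ∀ x, F (-x) = -F x) : ∫ x, F x ∂(gaussPi w) = 0 := by
  have h : ∫ x, F x ∂(gaussPi w) = -∫ x, F x ∂(gaussPi w) := by
    rw [integral_gaussPi hw, ← integral_neg, ← integral_neg_eq_self]
    refine integral_congr_ae (Filter.Eventually.of_forall fun x => ?_)
    simp [gaussDensity, hF]
  linarith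

/-- A single term of the power series of cosh, all of whose terms are nonnegative. -/
theorem pow_le_factorial_mul_cosh (n : ℕ) (t : ℝ) :
    t ^ (2 * n) ≤ (2 * n).factorial * Real.cosh t := by
  have h := le_hasSum (Real.hasSum_cosh t) n fun j _ => by
    rw [pow_mul]; positivity
  rwa [div_le_iff₀' (by positivity)] at h

section CoshEnergy

variable {L : ℝ}

/-- The functional `∫₀ᴸ cosh(ψ(x)) dx`, which controls all polynomial functionals. -/
def coshEnergy (L : ℝ) (κ : ι → ℤ) (ψ : ι → ℝ) : ℝ := ∫ x in (0 : ℝ)..L, Real.cosh (trigSum L κ ψ x)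

theorem integral_trigSum_pow_le (hL : 0 < L) (κ : ι → ℤ) (ψ : ι → ℝ) (n : ℕ) :
    ∫ x in (0 : ℝ)..L, trigSum L κ ψ x ^ (2 * n) ≤ (2 * n).factorial * coshEnergy L κ ψ := by
  rw [coshEnergy, ← intervalIntegral.integral_const_mul]
  exact intervalIntegral.integral_mono hL.le (Continuous.intervalIntegrable (by fun_prop) _ _)
    (Continuous.intervalIntegrable (by fun_prop) _ _) fun x => pow_le_factorial_mul_cosh n _

theorem coshEnergy_ge (hL : 0 < L) (κ : ι → ℤ) (ψ : ι → ℝ) : L ≤ coshEnergy L κ ψ := by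
  have h := integral_trigSum_pow_le hL κ ψ 0
  simpa using h

theorem sum_sq_le_coshEnergy (hL : 0 < L) {κ : ι → ℤ} (hκ : Function.Injective κ) (ψ : ι → ℝ) :
    ∑ i, ψ i ^ 2 ≤ 2 * coshEnergy L κ ψ := by
  rw [← integral_trigSum_sq hL hκ]
  simpa using integral_trigSum_pow_le hL κ ψ 1

/-- At fixed x the field is a centred Gaussian variable, for which E cosh = e^{Var/2}, and its
variance is at most (2/L) Σ 1/w. Fubini in x gives a bound that sees the number of modes only
through Σ 1/w. The factors `m` allow modes to be switched off, as needed for squeezed curves. -/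
theorem integrable_coshEnergy_and_le (hL : 0 < L) (κ : ι → ℤ) {w m : ι → ℝ} (hw : ∀ i, 0 < w i)
    (hm : ∀ i, m i ^ 2 ≤ 1) :
    Integrable (fun ψ => coshEnergy L κ fun i => m i * ψ i) (gaussPi w) ∧
      ∫ ψ, coshEnergy L κ (fun i => m i * ψ i) ∂(gaussPi w) ≤
        L * Real.exp (1 / L * ∑ i, 1 / w i) := by
  have hprob := isProbabilityMeasure_gaussPi hw
  set ν : Measure ℝ := volume.restrict (Set.Ioc 0 L) with hν
  have hcont : Continuous fun p : (ι → ℝ) × ℝ =>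
      Real.cosh (trigSum L κ (fun i => m i * p.1 i) p.2) := by
    refine Real.continuous_cosh.comp ?_
    exact (continuous_uncurry_trigSum L κ).comp
      ((by fun_prop : Continuous fun p : (ι → ℝ) × ℝ => fun i => m i * p.1 i).prodMk continuous_snd)
  have hlin : ∀ (ψ : ι → ℝ) x, trigSum L κ (fun i => m i * ψ i) x =
      ∑ i, (m i * realFourierBasis L (κ i) x) * ψ i := fun ψ x =>
    Finset.sum_congr rfl fun i _ => by ring
  have hbd : ∀ x, ∫ ψ, Real.cosh (trigSum L κ (fun i => m i * ψ i) x) ∂(gaussPi w) ≤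
      Real.exp (1 / L * ∑ i, 1 / w i) := by
    intro x
    simp_rw [hlin]
    rw [integral_cosh_linear hw]
    refine Real.exp_le_exp.mpr ?_
    rw [Finset.mul_sum, Finset.mul_sum]
    refine Finset.sum_le_sum fun i _ => ?_
    have h1 : realFourierBasis L (κ i) x ^ 2 ≤ 2 / L := by
      have := pow_le_pow_left₀ (abs_nonneg _) (abs_realFourierBasis_le L (κ i) x) 2
      rwa [sq_abs, Real.sq_sqrt (by positivity)] at this
    have h2 : (m i * realFourierBasis L (κ i) x) ^ 2 ≤ 2 / L := by
      rw [mul_pow]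
      exact (mul_le_of_le_one_left (sq_nonneg _) (hm i)).trans h1
    have h3 : 1 / 2 * ((m i * realFourierBasis L (κ i) x) ^ 2 / w i) ≤ 1 / 2 * (2 / L / w i) := by
      have := hw i
      gcongr
    refine h3.trans (le_of_eq ?_)
    have := (hw i).ne'
    field_simp
  have hint : Integrable (fun p : (ι → ℝ) × ℝ =>
      Real.cosh (trigSum L κ (fun i => m i * p.1 i) p.2)) ((gaussPi w).prod ν) := by
    rw [integrable_prod_iff' hcont.aestronglyMeasurable]
    refine ⟨Filter.Eventually.of_forall fun x => ?_, ?_⟩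
    · simp only [hlin]
      exact integrable_cosh_linear hw _
    · refine Integrable.mono' (integrable_const (Real.exp (1 / L * ∑ i, 1 / w i))) ?_
        (Filter.Eventually.of_forall fun x => ?_)
      · exact hcont.norm.aestronglyMeasurable.prod_swap.integral_prod_right'
      · rw [Real.norm_of_nonneg (integral_nonneg fun _ => norm_nonneg _)]
        simp_rw [Real.norm_of_nonneg (Real.cosh_pos _).le]
        exact hbd x
  have heq : ∀ ψ : ι → ℝ, coshEnergy L κ (fun i => m i * ψ i) =
      ∫ x, Real.cosh (trigSum L κ (fun i => m i * ψ i) x) ∂ν := fun ψ => by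
    rw [coshEnergy, intervalIntegral.integral_of_le hL.le]
  simp_rw [heq]
  refine ⟨hint.integral_prod_left, ?_⟩
  rw [integral_integral_swap hint]
  calc ∫ x, ∫ ψ, Real.cosh (trigSum L κ (fun i => m i * ψ i) x) ∂(gaussPi w) ∂ν
      ≤ ∫ _, Real.exp (1 / L * ∑ i, 1 / w i) ∂ν :=
        integral_mono hint.integral_prod_right (integrable_const _) hbd
    _ = _ := by
        rw [integral_const, hν, measureReal_restrict_apply_univ, Real.volume_real_Ioc_of_le hL.le]
        simp

end CoshEnergy

end Gaussian

/-! ### Spectral bounds uniform in the cutoff -/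

section Spectrum

variable {L : ℝ}

/-- The spectral gap constant: `μ_k ≥ m k²` for `k ≠ 0`. -/
def gapConst (L : ℝ) : ℝ := (2 * Real.pi / L) ^ 2 - 1

theorem gapConst_pos (hL : 0 < L) (hL' : L < 2 * Real.pi) : 0 < gapConst L := by
  have : 1 < 2 * Real.pi / L := by rwa [one_lt_div hL]
  unfold gapConst
  nlinarith

theorem gapConst_mul_sq_le_mu {k : ℤ} (hk : k ≠ 0) :
    gapConst L * (k : ℝ) ^ 2 ≤ mu L k := by
  have h1 : (1 : ℝ) ≤ (k : ℝ) ^ 2 := by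
    have h : (1 : ℤ) ≤ k ^ 2 := by
      have := Int.one_le_abs hk
      nlinarith [sq_abs k]
    exact_mod_cast h
  have h2 : mu L k = (2 * Real.pi / L) ^ 2 * (k : ℝ) ^ 2 - 1 := by unfold mu; ring
  rw [h2, gapConst]
  nlinarith

theorem mu_pos (hL : 0 < L) (hL' : L < 2 * Real.pi) {k : ℤ} (hk : k ≠ 0) : 0 < mu L k := by
  refine lt_of_lt_of_le ?_ (gapConst_mul_sq_le_mu hk)
  have := gapConst_pos hL hL'
  have : (k : ℝ) ≠ 0 := by exact_mod_cast hk
  positivity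

theorem nu_pos (L : ℝ) (k : ℤ) : 0 < nu L k := by unfold nu; positivity

theorem nu_eq (L : ℝ) (k : ℤ) : nu L k = mu L k + 3 := by unfold nu mu; ring

/-- Weight over eigenvalue decays like |k|^{2s-2}, which is summable because s < 1/2. -/
theorem one_add_sq_rpow_div_mu_le (hL : 0 < L) (hL' : L < 2 * Real.pi) {s : ℝ} (hs : 0 ≤ s)
    (hs' : s < 1 / 2) {k : ℤ} (hk : k ≠ 0) :
    (1 + (k : ℝ) ^ 2) ^ s / mu L k ≤ 2 / gapConst L * |(k : ℝ)| ^ (-(2 - 2 * s)) := by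
  have hm := gapConst_pos hL hL'
  have hk1 : (1 : ℝ) ≤ |(k : ℝ)| := by exact_mod_cast Int.one_le_abs hk
  have hk0 : 0 < |(k : ℝ)| := by linarith
  have h1 : (1 + (k : ℝ) ^ 2) ^ s ≤ 2 * |(k : ℝ)| ^ (2 * s) := by
    have h2 : 1 + (k : ℝ) ^ 2 ≤ 2 * |(k : ℝ)| ^ (2 : ℝ) := by
      rw [Real.rpow_two]; nlinarith [sq_abs (k : ℝ)]
    calc (1 + (k : ℝ) ^ 2) ^ s ≤ (2 * |(k : ℝ)| ^ (2 : ℝ)) ^ s :=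
          Real.rpow_le_rpow (by positivity) h2 hs
      _ = 2 ^ s * |(k : ℝ)| ^ (2 * s) := by
          rw [Real.mul_rpow (by norm_num) (by positivity), ← Real.rpow_mul hk0.le]
      _ ≤ 2 ^ (1 : ℝ) * |(k : ℝ)| ^ (2 * s) := by
          gcongr
          · norm_num
          · linarith
      _ = _ := by rw [Real.rpow_one]
  have h3 := gapConst_mul_sq_le_mu (L := L) hk
  have hks : 0 < (k : ℝ) ^ 2 := by rw [← sq_abs]; positivity
  calc (1 + (k : ℝ) ^ 2) ^ s / mu L k ≤ 2 * |(k : ℝ)| ^ (2 * s) / (gapConst L * (k : ℝ) ^ 2) :=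
        div_le_div₀ (by positivity) h1 (by positivity) h3
    _ = _ := by
        rw [neg_sub, Real.rpow_sub hk0, Real.rpow_two, sq_abs]
        field_simp

theorem exists_sum_one_add_sq_rpow_div_mu_le (hL : 0 < L) (hL' : L < 2 * Real.pi) {s : ℝ}
    (hs : 0 ≤ s) (hs' : s < 1 / 2) :
    ∃ S, ∀ N : ℕ, ∑ k : PerpModes N, (1 + ((k : ℤ) : ℝ) ^ 2) ^ s / mu L k ≤ S := by
  have hm := gapConst_pos hL hL'
  have hsum : Summable fun k : ℤ => 2 / gapConst L * |(k : ℝ)| ^ (-(2 - 2 * s)) :=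
    (Real.summable_abs_int_rpow (by linarith)).mul_left _
  refine ⟨∑' k : ℤ, 2 / gapConst L * |(k : ℝ)| ^ (-(2 - 2 * s)), fun N => ?_⟩
  calc ∑ k : PerpModes N, (1 + ((k : ℤ) : ℝ) ^ 2) ^ s / mu L k
      ≤ ∑ k : PerpModes N, 2 / gapConst L * |((k : ℤ) : ℝ)| ^ (-(2 - 2 * s)) :=
        Finset.sum_le_sum fun k _ => one_add_sq_rpow_div_mu_le hL hL' hs hs' (perpModes_ne_zero k)
    _ = ∑ k ∈ (Finset.Icc (-(N : ℤ)) (N : ℤ)).erase 0,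
          2 / gapConst L * |(k : ℝ)| ^ (-(2 - 2 * s)) :=
        Finset.sum_coe_sort ((Finset.Icc (-(N : ℤ)) (N : ℤ)).erase 0)
          fun k : ℤ => 2 / gapConst L * |(k : ℝ)| ^ (-(2 - 2 * s))
    _ ≤ ∑' k : ℤ, 2 / gapConst L * |(k : ℝ)| ^ (-(2 - 2 * s)) :=
        hsum.sum_le_tsum _ fun k _ => by positivity

theorem exists_sum_inv_mu_le (hL : 0 < L) (hL' : L < 2 * Real.pi) :
    ∃ S, ∀ N : ℕ, ∑ k : PerpModes N, 1 / mu L k ≤ S := by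
  simpa using exists_sum_one_add_sq_rpow_div_mu_le hL hL' le_rfl (by norm_num)

end Spectrum

/-! ### Expansion of exponential moments of a small variable -/

section ExpectationEstimate

theorem exp_neg_sub_one_add_nonneg (x : ℝ) : 0 ≤ Real.exp (-x) - 1 + x := by
  linarith [Real.add_one_le_exp (-x)]

/-- A second-order Taylor bound on the whole line. The term with e^{-x} is retained because the
variable inserted later has no lower bound uniform in ε; its exponential is absorbed by a change of
Gaussian measure. -/
theorem exp_neg_sub_one_add_le (x : ℝ) :
    Real.exp (-x) - 1 + x ≤ x ^ 2 * (1 + Real.exp (-x)) := by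
  have he := Real.exp_pos (-x)
  rcases le_or_gt |x| 1 with h | h
  · have h1 := Real.abs_exp_sub_one_sub_id_le (x := -x) (by rwa [abs_neg])
    have h2 := (abs_le.mp h1).2
    nlinarith [mul_nonneg (sq_nonneg x) he.le]
  · rcases lt_abs.mp h with h | h
    · have : Real.exp (-x) ≤ 1 := Real.exp_le_one_iff.mpr (by linarith)
      nlinarith [mul_nonneg (sq_nonneg x) he.le]
    · nlinarith [mul_nonneg (by nlinarith : (0 : ℝ) ≤ x ^ 2 - 1) he.le, sq_nonneg x]

/-- A truncated exponential moment of a small variable with small mean is close to one. -/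
theorem abs_integral_mul_exp_neg_sub_one_le {Ω : Type*} [MeasurableSpace Ω] {γ : Measure Ω}
    [IsProbabilityMeasure γ] {s X : Ω → ℝ} (hs : Measurable s) (hX : Measurable X)
    (hs0 : ∀ z, 0 ≤ s z) (hs1 : ∀ z, s z ≤ 1) {η : ℝ}
    (hX2 : Integrable (fun z => X z ^ 2) γ)
    (h1 : ∫ z, (1 - s z) ∂γ ≤ η) (h2 : ∫ z, X z ^ 2 ∂γ ≤ η) (h3 : |∫ z, X z ∂γ| ≤ η)
    (h4i : Integrable (fun z => s z * (X z ^ 2 * Real.exp (-X z))) γ)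
    (h4 : ∫ z, s z * (X z ^ 2 * Real.exp (-X z)) ∂γ ≤ η) :
    |∫ z, s z * Real.exp (-X z) ∂γ - 1| ≤ 5 * η := by
  have hXi : Integrable X γ := by
    refine Integrable.mono' ((integrable_const (1 : ℝ)).add hX2) hX.aestronglyMeasurable
      (Filter.Eventually.of_forall fun z => ?_)
    simp only [Pi.add_apply, Real.norm_eq_abs]
    nlinarith [sq_abs (X z), sq_nonneg (|X z| - 1), abs_nonneg (X z)]
  have hsb : ∀ {f : Ω → ℝ}, Integrable f γ → Integrable (fun z => s z * f z) γ := fun hf =>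
    hf.bdd_mul hs.aestronglyMeasurable (c := 1) (Filter.Eventually.of_forall fun z => by
      rw [Real.norm_of_nonneg (hs0 z)]; exact hs1 z)
  have hs' : Integrable s γ := by simpa using hsb (integrable_const (1 : ℝ))
  have hu : Integrable (fun z => (1 - s z)) γ := (integrable_const 1).sub hs'
  have hR : Integrable (fun z => s z * (Real.exp (-X z) - 1 + X z)) γ := by
    refine Integrable.mono' ((hsb hX2).add h4i) ?_ (Filter.Eventually.of_forall fun z => ?_)
    · exact (hs.mul ((hX.neg.exp.sub_const 1).add hX)).aestronglyMeasurable
    · rw [Real.norm_of_nonneg (mul_nonneg (hs0 z) (exp_neg_sub_one_add_nonneg _))]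
      have := mul_le_mul_of_nonneg_left (exp_neg_sub_one_add_le (X z)) (hs0 z)
      simp only [Pi.add_apply]
      linarith
  -- Of the four errors, the Taylor remainder costs 2η, while (1 - s) X, X and 1 - s cost η each: 5η
  -- in total.
  have hdec : ∀ z, s z * Real.exp (-X z) = s z * (Real.exp (-X z) - 1 + X z) +
      ((1 - s z) * X z - X z - (1 - s z) + 1) := fun z => by ring
  have hsX : Integrable (fun z => (1 - s z) * X z) γ := by
    refine (hXi.sub (hsb hXi)).congr (Filter.Eventually.of_forall fun z => ?_)
    simp only [Pi.sub_apply]; ring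
  have a1 : Integrable (fun z => (1 - s z) * X z - X z) γ := hsX.sub hXi
  have a2 : Integrable (fun z => (1 - s z) * X z - X z - (1 - s z)) γ := a1.sub hu
  have a3 : Integrable (fun z => (1 - s z) * X z - X z - (1 - s z) + 1) γ :=
    a2.add (integrable_const 1)
  have hint : ∫ z, s z * Real.exp (-X z) ∂γ - 1 =
      ∫ z, s z * (Real.exp (-X z) - 1 + X z) ∂γ + (∫ z, (1 - s z) * X z ∂γ - ∫ z, X z ∂γ -
        ∫ z, (1 - s z) ∂γ) := by
    simp_rw [hdec]
    rw [integral_add hR a3, integral_add a2 (integrable_const 1), integral_sub a1 hu,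
      integral_sub hsX hXi]
    simp only [integral_const, probReal_univ, smul_eq_mul, mul_one]
    ring
  have hR0 : 0 ≤ ∫ z, s z * (Real.exp (-X z) - 1 + X z) ∂γ :=
    integral_nonneg fun z => mul_nonneg (hs0 z) (exp_neg_sub_one_add_nonneg _)
  have hR1 : ∫ z, s z * (Real.exp (-X z) - 1 + X z) ∂γ ≤ 2 * η := by
    have : ∫ z, s z * (Real.exp (-X z) - 1 + X z) ∂γ ≤
        ∫ z, (X z ^ 2 + s z * (X z ^ 2 * Real.exp (-X z))) ∂γ := by
      refine integral_mono hR (hX2.add h4i) fun z => ?_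
      have := mul_le_mul_of_nonneg_left (exp_neg_sub_one_add_le (X z)) (hs0 z)
      have := mul_le_of_le_one_left (sq_nonneg (X z)) (hs1 z)
      simp only
      linarith
    rw [integral_add hX2 h4i] at this
    linarith
  have hC : |∫ z, (1 - s z) * X z ∂γ| ≤ η := by
    have hle : ∀ z, |(1 - s z) * X z| ≤ 1 / 2 * ((1 - s z) + X z ^ 2) := fun z => by
      have a0 : 0 ≤ 1 - s z := by linarith [hs1 z]
      rw [abs_mul, abs_of_nonneg a0]
      nlinarith [sq_nonneg ((1 - s z) - |X z|), sq_abs (X z), hs0 z]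
    calc |∫ z, (1 - s z) * X z ∂γ| ≤ ∫ z, |(1 - s z) * X z| ∂γ := abs_integral_le_integral_abs
      _ ≤ ∫ z, 1 / 2 * ((1 - s z) + X z ^ 2) ∂γ :=
          integral_mono hsX.abs ((hu.add hX2).const_mul _) hle
      _ ≤ η := by
          rw [integral_const_mul, integral_add hu hX2]; linarith
  have hU0 : 0 ≤ ∫ z, (1 - s z) ∂γ := integral_nonneg fun z => by simpa using hs1 z
  rw [hint, abs_le]
  obtain ⟨hC1, hC2⟩ := abs_le.mp hC
  obtain ⟨hE1, hE2⟩ := abs_le.mp h3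
  constructor <;> linarith

end ExpectationEstimate

/-! ### Gaussian normalisation as a power and a determinant -/

section GaussNormFormula

theorem gaussNorm_eq {ι : Type*} [Fintype ι] {w : ι → ℝ} (hw : ∀ i, 0 < w i) :
    gaussNorm w = √(2 * Real.pi) ^ Fintype.card ι / √(∏ i, w i) := by
  unfold gaussNorm
  rw [Real.sqrt_prod _ fun i _ => (hw i).le]
  simp_rw [Real.sqrt_div (by positivity : (0 : ℝ) ≤ 2 * Real.pi)]
  rw [Finset.prod_div_distrib, Finset.prod_const, Finset.card_univ]

theorem sqrt_pow_odd {x : ℝ} (hx : 0 ≤ x) (N : ℕ) :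
    √x ^ (2 * N + 1) = x ^ ((N : ℝ) + 1 / 2) := by
  rw [Real.sqrt_eq_rpow, ← Real.rpow_natCast, ← Real.rpow_mul hx]
  congr 1
  push_cast; ring

end GaussNormFormula

/-! ### The cubic and quartic functionals -/

section PolynomialFunctionals

variable {ι : Type*} [Fintype ι] {L : ℝ}

theorem continuous_integral_trigSum_pow (L : ℝ) (κ : ι → ℤ) (n : ℕ) :
    Continuous fun ψ : ι → ℝ => ∫ x in (0 : ℝ)..L, trigSum L κ ψ x ^ n := by
  refine intervalIntegral.continuous_parametric_intervalIntegral_of_continuous' ?_ _ _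
  exact (continuous_uncurry_trigSum L κ).pow n

theorem sq_intervalIntegral_le (hL : 0 < L) {f : ℝ → ℝ} (hf : Continuous f) :
    (∫ x in (0 : ℝ)..L, f x) ^ 2 ≤ L * ∫ x in (0 : ℝ)..L, f x ^ 2 := by
  set m := (∫ x in (0 : ℝ)..L, f x) / L with hm
  have h0 : 0 ≤ ∫ x in (0 : ℝ)..L, (f x - m) ^ 2 :=
    intervalIntegral.integral_nonneg hL.le fun x _ => sq_nonneg _
  have h1 : ∀ x, (f x - m) ^ 2 = f x ^ 2 - (2 * m * f x - m ^ 2) := fun x => by ring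
  simp_rw [h1] at h0
  rw [intervalIntegral.integral_sub (Continuous.intervalIntegrable (by fun_prop) _ _)
    (Continuous.intervalIntegrable (by fun_prop) _ _),
    intervalIntegral.integral_sub (Continuous.intervalIntegrable (by fun_prop) _ _)
    (Continuous.intervalIntegrable (by fun_prop) _ _), intervalIntegral.integral_const_mul,
    intervalIntegral.integral_const, smul_eq_mul, sub_zero] at h0
  have h2 : ∫ x in (0 : ℝ)..L, f x = m * L := by rw [hm]; field_simp
  rw [h2] at h0 ⊢
  nlinarith

theorem trigSum_neg (L : ℝ) (κ : ι → ℤ) (ψ : ι → ℝ) (x : ℝ) :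
    trigSum L κ (-ψ) x = -trigSum L κ ψ x := by
  simp [trigSum]

/-- The anharmonic part of the rescaled potential around a well. -/
def anharmonic (L ε : ℝ) (κ : ι → ℤ) (ψ : ι → ℝ) : ℝ :=
  √ε * (∫ x in (0 : ℝ)..L, trigSum L κ ψ x ^ 3) +
    ε / 4 * ∫ x in (0 : ℝ)..L, trigSum L κ ψ x ^ 4

theorem continuous_anharmonic (L ε : ℝ) (κ : ι → ℤ) : Continuous (anharmonic L ε κ) :=
  ((continuous_integral_trigSum_pow L κ 3).const_mul _).add
    ((continuous_integral_trigSum_pow L κ 4).const_mul _)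

/-- Cauchy–Schwarz in x leads to sixth and eighth powers, bounded by 6! and 8! times the cosh
functional. The constant is 2 · 720 + 2 · 40320/16 = 6480, with ε² ≤ ε in the quartic part. -/
theorem anharmonic_sq_le (hL : 0 < L) {ε : ℝ} (hε : 0 < ε) (hε1 : ε ≤ 1) (κ : ι → ℤ)
    (ψ : ι → ℝ) : anharmonic L ε κ ψ ^ 2 ≤ ε * (6480 * L * coshEnergy L κ ψ) := by
  have h3 := sq_intervalIntegral_le hL (f := fun x => trigSum L κ ψ x ^ 3) (by fun_prop)
  have h4 := sq_intervalIntegral_le hL (f := fun x => trigSum L κ ψ x ^ 4) (by fun_prop)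
  have h6 := integral_trigSum_pow_le hL κ ψ 3
  have h8 := integral_trigSum_pow_le hL κ ψ 4
  simp_rw [← pow_mul] at h3 h4
  norm_num [Nat.factorial] at h3 h4 h6 h8
  unfold anharmonic
  set A := ∫ x in (0 : ℝ)..L, trigSum L κ ψ x ^ 3
  set B := ∫ x in (0 : ℝ)..L, trigSum L κ ψ x ^ 4
  have hW := (hL.le.trans (coshEnergy_ge hL κ ψ))
  set W := coshEnergy L κ ψ
  have hA : A ^ 2 ≤ L * (720 * W) := h3.trans (mul_le_mul_of_nonneg_left h6 hL.le)
  have hB : B ^ 2 ≤ L * (40320 * W) := h4.trans (mul_le_mul_of_nonneg_left h8 hL.le)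
  have hs : √ε ^ 2 = ε := Real.sq_sqrt hε.le
  have h5 : (√ε * A + ε / 4 * B) ^ 2 ≤ 2 * (ε * A ^ 2) + 2 * (ε ^ 2 / 16 * B ^ 2) := by
    have : 2 * (ε * A ^ 2) + 2 * (ε ^ 2 / 16 * B ^ 2) - (√ε * A + ε / 4 * B) ^ 2 =
        (√ε * A - ε / 4 * B) ^ 2 := by linear_combination (-2 * A ^ 2) * hs
    nlinarith [sq_nonneg (√ε * A - ε / 4 * B)]
  have h7 : ε ^ 2 / 16 * B ^ 2 ≤ ε * (1 / 16 * B ^ 2) := by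
    nlinarith [mul_nonneg (mul_nonneg hε.le (sq_nonneg B)) (by linarith : 0 ≤ 1 - ε)]
  have h9 := mul_le_mul_of_nonneg_left hA hε.le
  have h10 := mul_le_mul_of_nonneg_left hB hε.le
  linarith

end PolynomialFunctionals

/-! ### Reduction of the partition function to one well -/

section WellIntegral

variable {L : ℝ} {N : ℕ}

/-- Half of the sign decomposition: `1 = halfLine y + halfLine (-y)`. -/
def halfLine (y : ℝ) : ℝ := if 0 < y then 1 else if y = 0 then 1 / 2 else 0

theorem measurable_halfLine : Measurable halfLine :=
  Measurable.ite measurableSet_Ioi measurable_const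
    (Measurable.ite (measurableSet_singleton 0) measurable_const measurable_const)

theorem halfLine_nonneg (y : ℝ) : 0 ≤ halfLine y := by unfold halfLine; split_ifs <;> norm_num

theorem halfLine_le_one (y : ℝ) : halfLine y ≤ 1 := by unfold halfLine; split_ifs <;> norm_num

theorem halfLine_of_pos {y : ℝ} (h : 0 < y) : halfLine y = 1 := by simp [halfLine, h]

theorem halfLine_of_neg {y : ℝ} (h : y < 0) : halfLine y = 0 := by
  simp [halfLine, h.not_gt, h.ne]

theorem halfLine_add_neg (y : ℝ) : halfLine y + halfLine (-y) = 1 := by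
  rcases lt_trichotomy y 0 with h | h | h
  · rw [halfLine_of_neg h, halfLine_of_pos (by linarith)]; norm_num
  · simp [halfLine, h]; norm_num
  · rw [halfLine_of_pos h, halfLine_of_neg (by linarith)]; norm_num

theorem integral_galerkin_eq (g : GalerkinSpace N → ℝ) :
    ∫ φ, g φ = ∫ ψ : Modes N → ℝ, g (WithLp.toLp 2 ψ) :=
  ((PiLp.volume_preserving_toLp (Modes N)).integral_comp
    (MeasurableEquiv.toLp 2 (Modes N → ℝ)).measurableEmbedding g).symm

theorem integrable_galerkin_iff (g : GalerkinSpace N → ℝ) :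
    Integrable g ↔ Integrable fun ψ : Modes N → ℝ => g (WithLp.toLp 2 ψ) :=
  ((PiLp.volume_preserving_toLp (Modes N)).integrable_comp_emb
    (MeasurableEquiv.toLp 2 (Modes N → ℝ)).measurableEmbedding).symm

/-- Weights that are `a` on the zero mode and `μ_k` on the others. -/
def barrierWeight (L a : ℝ) {N : ℕ} (k : Modes N) : ℝ := if (k : ℤ) = 0 then a else mu L k

theorem barrierWeight_pos (hL : 0 < L) (hL' : L < 2 * Real.pi) {a : ℝ} (ha : 0 < a) (k : Modes N) :
    0 < barrierWeight L a k := by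
  unfold barrierWeight
  split_ifs with h
  · exact ha
  · exact mu_pos hL hL' h

theorem barrierWeight_zero (a : ℝ) : barrierWeight L a (zeroIndex N) = a := by
  simp [barrierWeight, zeroIndex]

theorem barrierWeight_perp (a : ℝ) (k : PerpModes N) :
    barrierWeight L a (perpIndex k) = mu L k := by
  simp [barrierWeight, perpIndex, perpModes_ne_zero k]

theorem sum_barrierWeight (a : ℝ) (f : Modes N → ℝ) :
    ∑ k, barrierWeight L a k * f k =
      a * f (zeroIndex N) + ∑ k : PerpModes N, mu L k * f (perpIndex k) := by
  rw [sum_modes, barrierWeight_zero]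
  simp_rw [barrierWeight_perp]

theorem zeroMode_eq (φ : GalerkinSpace N) : zeroMode φ = φ (zeroIndex N) := rfl

/-- The bound V₀(y) ≥ y²/2 - 3L/4, together with `potential_ge` and μ_k > 0, dominates the density
by a Gaussian. -/
theorem integrable_exp_neg_potential (hL : 0 < L) (hL' : L < 2 * Real.pi) (N : ℕ) {ε : ℝ}
    (hε : 0 < ε) : Integrable fun φ => Real.exp (-potential L N φ / ε) := by
  have hw : ∀ k : Modes N, 0 < barrierWeight L 1 k / ε := fun k =>
    div_pos (barrierWeight_pos hL hL' one_pos k) hε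
  have hcont : Continuous fun φ => Real.exp (-potential L N φ / ε) :=
    Real.continuous_exp.comp (((continuous_potential hL N).neg).div_const ε)
  rw [integrable_galerkin_iff]
  refine Integrable.mono' ((integrable_gaussWeight hw).const_mul (Real.exp (3 * L / 4 / ε)))
    (hcont.comp (PiLp.continuous_toLp 2 _)).aestronglyMeasurable
    (Filter.Eventually.of_forall fun ψ => ?_)
  rw [Real.norm_of_nonneg (Real.exp_pos _).le, ← Real.exp_add]
  refine Real.exp_le_exp.mpr ?_
  have h1 := potential_ge hL (WithLp.toLp 2 ψ : GalerkinSpace N)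
  have h2 : ∀ y : ℝ, 1 / 2 * y ^ 2 - 3 * L / 4 ≤ potentialZero L y := by
    intro y
    have h3 : potentialZero L y - (1 / 2 * y ^ 2 - 3 * L / 4) = L / 4 * (y ^ 2 / L - 2) ^ 2 := by
      unfold potentialZero; field_simp; ring
    nlinarith [mul_nonneg (by positivity : 0 ≤ L / 4) (sq_nonneg (y ^ 2 / L - 2))]
  have h3 := h2 (zeroMode (WithLp.toLp 2 ψ : GalerkinSpace N))
  have h4 : ∑ k : Modes N, barrierWeight L 1 k / ε * ψ k ^ 2 =
      (ψ (zeroIndex N) ^ 2 + ∑ k : PerpModes N, mu L k * ψ (perpIndex k) ^ 2) / ε := by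
    simp_rw [div_mul_eq_mul_div]
    rw [← Finset.sum_div, sum_barrierWeight, one_mul]
  rw [h4, div_eq_mul_inv, div_eq_mul_inv, div_eq_mul_inv _ ε]
  have h5 : 0 < ε⁻¹ := by positivity
  rw [zeroMode_eq] at h1 h3
  simp only at h1 h3
  nlinarith

/-- The rescaled potential around the well `+1`. -/
theorem potential_well_rescaled (hL : 0 < L) {ε : ℝ} (hε : 0 < ε) (ψ : Modes N → ℝ) :
    potential L N (oneVector L N + √ε • WithLp.toLp 2 ψ) / ε =
      1 / 2 * ∑ k : Modes N, nu L k * ψ k ^ 2 + anharmonic L ε (fun k : Modes N => (k : ℤ)) ψ := by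
  have hs : √ε ^ 2 = ε := Real.sq_sqrt hε.le
  have h1 : ∀ x, toFun L (√ε • (WithLp.toLp 2 ψ : GalerkinSpace N)) x =
      √ε * trigSum L (fun k : Modes N => (k : ℤ)) ψ x := fun x => by
    simp [toFun, trigSum, Finset.mul_sum, mul_assoc]
  rw [potential_oneVector_add hL]
  simp_rw [h1, mul_pow]
  rw [intervalIntegral.integral_const_mul, intervalIntegral.integral_const_mul]
  have h2 : ∑ k : Modes N, nu L k * (√ε • (WithLp.toLp 2 ψ : GalerkinSpace N)) k ^ 2 =
      ε * ∑ k : Modes N, nu L k * ψ k ^ 2 := by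
    rw [Finset.mul_sum]
    refine Finset.sum_congr rfl fun k _ => ?_
    simp only [PiLp.smul_apply, smul_eq_mul, mul_pow, hs]; ring
  rw [h2, anharmonic, show √ε ^ 3 = ε * √ε by rw [pow_succ, hs],
    show √ε ^ 4 = ε * ε by rw [show (4 : ℕ) = 2 * 2 by rfl, pow_mul, hs, sq]]
  field_simp

theorem zeroMode_well_rescaled (ε : ℝ) (ψ : Modes N → ℝ) :
    zeroMode (oneVector L N + √ε • WithLp.toLp 2 ψ) = √L + √ε * ψ (zeroIndex N) := by
  simp [zeroMode_eq, oneVector]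

/-- For y ≥ 0 the factorisation V₀(y) = (y - √L)² (y/√L + 1)²/4 gives V₀(y) ≥ (y - √L)²/4, hence
weight 1/2 on the zero mode; the other modes keep μ_k by `potential_ge`. This quadratic form tames
e^{-X} for the anharmonic part X. -/
theorem half_sum_barrierWeight_le (hL : 0 < L) {ε : ℝ} (hε : 0 < ε)
    (ψ : Modes N → ℝ) (h0 : 0 ≤ √L + √ε * ψ (zeroIndex N)) :
    1 / 2 * ∑ k : Modes N, barrierWeight L (1 / 2) k * ψ k ^ 2 ≤
      1 / 2 * ∑ k : Modes N, nu L k * ψ k ^ 2 + anharmonic L ε (fun k : Modes N => (k : ℤ)) ψ := by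
  have hs : √ε ^ 2 = ε := Real.sq_sqrt hε.le
  have hsL : √L ^ 2 = L := Real.sq_sqrt hL.le
  have hL0 : 0 < √L := Real.sqrt_pos.mpr hL
  rw [← potential_well_rescaled hL hε, le_div_iff₀ hε, sum_barrierWeight]
  refine le_trans ?_ (potential_ge hL _)
  rw [zeroMode_well_rescaled]
  have h1 : ∀ k : PerpModes N,
      (oneVector L N + √ε • (WithLp.toLp 2 ψ : GalerkinSpace N)) (perpIndex k) =
        √ε * ψ (perpIndex k) := fun k => by
    have : perpIndex k ≠ zeroIndex N := fun h => perpModes_ne_zero k (congrArg Subtype.val h)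
    simp [oneVector, this]
  simp_rw [h1, mul_pow, hs]
  have h2 : ∑ k : PerpModes N, mu L k * (ε * ψ (perpIndex k) ^ 2) =
      (∑ k : PerpModes N, mu L k * ψ (perpIndex k) ^ 2) * ε := by
    rw [Finset.sum_mul]
    exact Finset.sum_congr rfl fun k _ => by ring
  rw [h2]
  set z := ψ (zeroIndex N)
  have h3 : 1 / 4 * (√ε * z) ^ 2 ≤ potentialZero L (√L + √ε * z) := by
    set y := √L + √ε * z with hy
    have h4 : √ε * z = y - √L := by rw [hy]; ring
    have h5 : potentialZero L y = 1 / 4 * (y - √L) ^ 2 * (y / √L + 1) ^ 2 := by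
      have h6 : y ^ 2 / L - 1 = (y - √L) * (y / √L + 1) / √L := by
        rw [show y ^ 2 / L = y ^ 2 / √L ^ 2 by rw [hsL]]
        field_simp
        ring
      rw [potentialZero, h6, div_pow, mul_pow, hsL]
      field_simp
    rw [h4, h5]
    have h7 : 1 ≤ (y / √L + 1) ^ 2 := by
      have : 0 ≤ y / √L := div_nonneg h0 hL0.le
      nlinarith
    nlinarith [sq_nonneg (y - √L)]
  rw [mul_pow, hs] at h3
  linarith

/-- Evenness of V leaves twice a half space; the value 1/2 of `halfLine` at the origin makes the two
halves add up to 1 everywhere. Translation to the well and scaling by √ε in dimension 2N + 1 give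
the power. -/
theorem integral_exp_neg_potential_eq (hL : 0 < L) (hL' : L < 2 * Real.pi) {ε : ℝ} (hε : 0 < ε) :
    ∫ φ, Real.exp (-potential L N φ / ε) =
      2 * (√ε ^ (2 * N + 1) * (gaussNorm (fun k : Modes N => nu L k) *
        ∫ ψ, halfLine (√L + √ε * ψ (zeroIndex N)) *
          Real.exp (-anharmonic L ε (fun k : Modes N => (k : ℤ)) ψ)
            ∂(gaussPi fun k : Modes N => nu L k))) := by
  have hν : ∀ k : Modes N, 0 < nu L k := fun k => nu_pos L k
  have hse : 0 < √ε := Real.sqrt_pos.mpr hε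
  have hint := integrable_exp_neg_potential hL hL' N hε
  have hzm : Measurable (zeroMode : GalerkinSpace N → ℝ) := by
    have : Continuous (zeroMode : GalerkinSpace N → ℝ) := by
      unfold zeroMode; fun_prop
    exact this.measurable
  have hsi : Integrable fun φ => halfLine (zeroMode φ) * Real.exp (-potential L N φ / ε) :=
    hint.bdd_mul (measurable_halfLine.comp hzm).aestronglyMeasurable (c := 1)
      (Filter.Eventually.of_forall fun φ => by
        show ‖halfLine _‖ ≤ 1
        rw [Real.norm_of_nonneg (halfLine_nonneg _)]; exact halfLine_le_one _)
  have hsym : ∫ φ, Real.exp (-potential L N φ / ε) =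
      2 * ∫ φ, halfLine (zeroMode φ) * Real.exp (-potential L N φ / ε) := by
    have hneg : ∫ φ : GalerkinSpace N, halfLine (-zeroMode φ) * Real.exp (-potential L N φ / ε) =
        ∫ φ, halfLine (zeroMode φ) * Real.exp (-potential L N φ / ε) := by
      rw [← integral_neg_eq_self]
      refine integral_congr_ae (Filter.Eventually.of_forall fun φ => ?_)
      simp only [potential_neg]
      simp [zeroMode]
    have hni : Integrable fun φ => halfLine (-zeroMode φ) * Real.exp (-potential L N φ / ε) := by
      refine hint.bdd_mul (measurable_halfLine.comp hzm.neg).aestronglyMeasurable (c := 1)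
        (Filter.Eventually.of_forall fun φ => by
          show ‖halfLine _‖ ≤ 1
          rw [Real.norm_of_nonneg (halfLine_nonneg _)]; exact halfLine_le_one _)
    rw [two_mul]
    nth_rewrite 2 [← hneg]
    rw [← integral_add hsi hni]
    refine integral_congr_ae (Filter.Eventually.of_forall fun φ => ?_)
    simp only
    rw [← add_mul, halfLine_add_neg, one_mul]
  rw [hsym, integral_gaussPi hν, ← integral_const_mul (gaussNorm _)]
  congr 1
  rw [← integral_add_left_eq_self _ (oneVector L N)]
  have hscale := Measure.integral_comp_smul (volume : Measure (GalerkinSpace N))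
    (fun φ => halfLine (zeroMode (oneVector L N + φ)) *
      Real.exp (-potential L N (oneVector L N + φ) / ε)) (√ε)
  rw [finrank_euclideanSpace, card_modes, abs_of_pos (by positivity), smul_eq_mul,
    eq_inv_mul_iff_mul_eq₀ (by positivity)] at hscale
  rw [← hscale, integral_galerkin_eq]
  congr 1
  refine integral_congr_ae (Filter.Eventually.of_forall fun ψ => ?_)
  simp only
  rw [zeroMode_well_rescaled, neg_div, potential_well_rescaled hL hε, gaussDensity, neg_add,
    Real.exp_add]
  have := (gaussNorm_pos hν).ne'
  field_simp

/-- The ratio is 2 ∏ (1 + 3/μ_k)^{1/2}: the zero mode contributes √(2/(1/2)), and ν_k = μ_k + 3 for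
the others. Passing to the comparison Gaussian costs a factor bounded in N. -/
theorem gaussNorm_barrier_div_le (hL : 0 < L) (hL' : L < 2 * Real.pi) {S : ℝ}
    (hS : ∑ k : PerpModes N, 1 / mu L k ≤ S) :
    (gaussNorm fun k : Modes N => nu L k)⁻¹ * gaussNorm (barrierWeight L (1 / 2) (N := N)) ≤
      2 * Real.exp (3 / 2 * S) := by
  rw [gaussNorm, gaussNorm, ← Finset.prod_inv_distrib, ← Finset.prod_mul_distrib, prod_modes]
  refine mul_le_mul ?_ ?_ (Finset.prod_nonneg fun _ _ => by positivity) (by norm_num)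
  · rw [barrierWeight_zero, ← Real.sqrt_inv, ← Real.sqrt_mul
      (inv_nonneg.mpr (div_nonneg (by positivity) (nu_pos L _).le))]
    refine Real.sqrt_le_iff.mpr ⟨by norm_num, le_of_eq ?_⟩
    simp only [zeroIndex, nu]
    field_simp
    norm_num
  · calc ∏ k : PerpModes N, ((√(2 * Real.pi / nu L (perpIndex k)))⁻¹ *
          √(2 * Real.pi / barrierWeight L (1 / 2) (perpIndex k)))
        ≤ ∏ k : PerpModes N, Real.exp (3 / 2 * (1 / mu L k)) := by
          refine Finset.prod_le_prod (fun _ _ => by positivity) fun k _ => ?_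
          have hm := mu_pos hL hL' (perpModes_ne_zero k)
          rw [barrierWeight_perp, ← Real.sqrt_inv,
            ← Real.sqrt_mul (inv_nonneg.mpr (div_nonneg (by positivity) (nu_pos L _).le))]
          refine Real.sqrt_le_iff.mpr ⟨(Real.exp_pos _).le, ?_⟩
          rw [← Real.exp_nat_mul]
          have h1 : (2 * Real.pi / nu L (perpIndex k))⁻¹ * (2 * Real.pi / mu L k) =
              3 / mu L k + 1 := by
            simp only [perpIndex, nu_eq]
            field_simp
            ring
          rw [h1]
          refine (Real.add_one_le_exp _).trans (Real.exp_le_exp.mpr (le_of_eq ?_))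
          push_cast; ring
      _ = Real.exp (3 / 2 * ∑ k : PerpModes N, 1 / mu L k) := by
          rw [← Real.exp_sum, Finset.mul_sum]
      _ ≤ _ := Real.exp_le_exp.mpr (by linarith)

end WellIntegral

/-! ### Asymptotics of the partition function -/

section PartitionFunction

variable {ι : Type*} [Fintype ι] {L : ℝ} {N : ℕ}

theorem integrable_coshEnergy (hL : 0 < L) (κ : ι → ℤ) {w : ι → ℝ} (hw : ∀ i, 0 < w i) :
    Integrable (coshEnergy L κ) (gaussPi w) := by
  simpa using (integrable_coshEnergy_and_le hL κ (m := fun _ => 1) hw (by simp)).1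

theorem integral_coshEnergy_le (hL : 0 < L) (κ : ι → ℤ) {w : ι → ℝ} (hw : ∀ i, 0 < w i) :
    ∫ ψ, coshEnergy L κ ψ ∂(gaussPi w) ≤ L * Real.exp (1 / L * ∑ i, 1 / w i) := by
  simpa using (integrable_coshEnergy_and_le hL κ (m := fun _ => 1) hw (by simp)).2

theorem coshEnergy_nonneg (hL : 0 < L) (κ : ι → ℤ) (ψ : ι → ℝ) : 0 ≤ coshEnergy L κ ψ :=
  hL.le.trans (coshEnergy_ge hL κ ψ)

theorem integrable_anharmonic_sq (hL : 0 < L) {ε : ℝ} (hε : 0 < ε) (hε1 : ε ≤ 1) (κ : ι → ℤ)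
    {w : ι → ℝ} (hw : ∀ i, 0 < w i) :
    Integrable (fun ψ => anharmonic L ε κ ψ ^ 2) (gaussPi w) := by
  refine Integrable.mono' (((integrable_coshEnergy hL κ hw).const_mul (6480 * L)).const_mul ε)
    ((continuous_anharmonic L ε κ).pow 2).aestronglyMeasurable
    (Filter.Eventually.of_forall fun ψ => ?_)
  rw [Real.norm_of_nonneg (sq_nonneg _)]
  exact anharmonic_sq_le hL hε hε1 κ ψ

theorem integral_anharmonic_sq_le (hL : 0 < L) {ε : ℝ} (hε : 0 < ε) (hε1 : ε ≤ 1) (κ : ι → ℤ)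
    {w : ι → ℝ} (hw : ∀ i, 0 < w i) :
    ∫ ψ, anharmonic L ε κ ψ ^ 2 ∂(gaussPi w) ≤
      ε * (6480 * L * ∫ ψ, coshEnergy L κ ψ ∂(gaussPi w)) := by
  rw [← integral_const_mul, ← integral_const_mul]
  exact integral_mono (integrable_anharmonic_sq hL hε hε1 κ hw)
    (((integrable_coshEnergy hL κ hw).const_mul (6480 * L)).const_mul ε)
    fun ψ => anharmonic_sq_le hL hε hε1 κ ψ

/-- The cubic term is odd and has mean zero, so the mean is of order ε although the square is itself
only bounded by order ε. -/
theorem abs_integral_anharmonic_le (hL : 0 < L) {ε : ℝ} (hε : 0 < ε) (κ : ι → ℤ)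
    {w : ι → ℝ} (hw : ∀ i, 0 < w i) :
    |∫ ψ, anharmonic L ε κ ψ ∂(gaussPi w)| ≤
      ε * (6 * ∫ ψ, coshEnergy L κ ψ ∂(gaussPi w)) := by
  have hprob := isProbabilityMeasure_gaussPi hw
  have hW := integrable_coshEnergy hL κ hw
  have h4 : ∀ ψ : ι → ℝ, ∫ x in (0 : ℝ)..L, trigSum L κ ψ x ^ 4 ≤ 24 * coshEnergy L κ ψ :=
    fun ψ => by simpa [Nat.factorial] using integral_trigSum_pow_le hL κ ψ 2
  have h40 : ∀ ψ : ι → ℝ, 0 ≤ ∫ x in (0 : ℝ)..L, trigSum L κ ψ x ^ 4 := fun ψ =>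
    intervalIntegral.integral_nonneg hL.le fun x _ => by positivity
  have h4i : Integrable (fun ψ : ι → ℝ => ε / 4 * ∫ x in (0 : ℝ)..L, trigSum L κ ψ x ^ 4)
      (gaussPi w) := by
    refine Integrable.const_mul ?_ _
    refine Integrable.mono' (hW.const_mul 24)
      (continuous_integral_trigSum_pow L κ 4).aestronglyMeasurable
      (Filter.Eventually.of_forall fun ψ => ?_)
    rw [Real.norm_of_nonneg (h40 ψ)]
    exact h4 ψ
  have h3i : Integrable (fun ψ : ι → ℝ => √ε * ∫ x in (0 : ℝ)..L, trigSum L κ ψ x ^ 3)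
      (gaussPi w) := by
    refine Integrable.const_mul ?_ _
    -- From |t|³ ≤ t⁴ + t², with 4! and 2! bounding the even powers by cosh.
    refine Integrable.mono' (hW.const_mul (24 + 2))
      (continuous_integral_trigSum_pow L κ 3).aestronglyMeasurable
      (Filter.Eventually.of_forall fun ψ => ?_)
    have h2 := integral_trigSum_pow_le hL κ ψ 1
    norm_num at h2
    refine (intervalIntegral.norm_integral_le_integral_norm hL.le).trans ?_
    calc ∫ x in (0 : ℝ)..L, ‖trigSum L κ ψ x ^ 3‖
        ≤ ∫ x in (0 : ℝ)..L, (trigSum L κ ψ x ^ 4 + trigSum L κ ψ x ^ 2) := by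
          refine intervalIntegral.integral_mono_on hL.le
            (Continuous.intervalIntegrable (by fun_prop) _ _)
            (Continuous.intervalIntegrable (by fun_prop) _ _) fun x _ => ?_
          rw [Real.norm_eq_abs, abs_le]
          set t := trigSum L κ ψ x
          constructor
          · nlinarith [mul_nonneg (sq_nonneg t) (sq_nonneg (t + 1)), sq_nonneg (t ^ 2), sq_nonneg t]
          · nlinarith [mul_nonneg (sq_nonneg t) (sq_nonneg (t - 1)), sq_nonneg (t ^ 2), sq_nonneg t]
      _ = (∫ x in (0 : ℝ)..L, trigSum L κ ψ x ^ 4) + ∫ x in (0 : ℝ)..L, trigSum L κ ψ x ^ 2 :=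
          intervalIntegral.integral_add (Continuous.intervalIntegrable (by fun_prop) _ _)
            (Continuous.intervalIntegrable (by fun_prop) _ _)
      _ ≤ _ := by linarith [h4 ψ]
  unfold anharmonic
  rw [integral_add h3i h4i, integral_gaussPi_of_odd hw, zero_add, integral_const_mul, abs_mul,
    abs_of_pos (by positivity), abs_of_nonneg (integral_nonneg h40)]
  · have h5 : ∫ ψ, (∫ x in (0 : ℝ)..L, trigSum L κ ψ x ^ 4) ∂(gaussPi w) ≤
        24 * ∫ ψ, coshEnergy L κ ψ ∂(gaussPi w) := by
      rw [← integral_const_mul]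
      refine integral_mono_of_nonneg (Filter.Eventually.of_forall h40) (hW.const_mul 24)
        (Filter.Eventually.of_forall h4)
    calc _ ≤ ε / 4 * (24 * ∫ ψ, coshEnergy L κ ψ ∂(gaussPi w)) :=
          mul_le_mul_of_nonneg_left h5 (by positivity)
      _ = _ := by ring
  · intro ψ
    simp_rw [trigSum_neg, neg_pow (trigSum _ _ _ _)]
    norm_num

theorem sum_inv_barrierWeight_le {a S : ℝ} (hS : ∑ k : PerpModes N, 1 / mu L k ≤ S) :
    ∑ k : Modes N, 1 / barrierWeight L a k ≤ 1 / a + S := by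
  rw [sum_modes, barrierWeight_zero]
  simp_rw [barrierWeight_perp]
  linarith

theorem sum_inv_nu_le (hL : 0 < L) (hL' : L < 2 * Real.pi) {S : ℝ}
    (hS : ∑ k : PerpModes N, 1 / mu L k ≤ S) : ∑ k : Modes N, 1 / nu L k ≤ 2 + S := by
  rw [sum_modes]
  have h0 : 1 / nu L (zeroIndex N) ≤ 2 := by simp [nu, zeroIndex]; norm_num
  have h1 : ∑ k : PerpModes N, 1 / nu L (perpIndex k) ≤ ∑ k : PerpModes N, 1 / mu L k := by
    refine Finset.sum_le_sum fun k _ => ?_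
    refine one_div_le_one_div_of_le (mu_pos hL hL' (perpModes_ne_zero k)) ?_
    simp only [perpIndex, nu_eq]
    linarith
  linarith

/-- Apply `abs_integral_mul_exp_neg_sub_one_le` with s the half-space cutoff and X the anharmonic
part. Every hypothesis reduces to an expectation of `coshEnergy`, under the Gaussian of -Δ + 2 or
under the comparison Gaussian. -/
theorem exists_abs_well_integral_sub_one_le (hL : 0 < L) (hL' : L < 2 * Real.pi) :
    ∃ C, ∀ (N : ℕ) (ε : ℝ), 0 < ε → ε < 1 →
      |∫ ψ, halfLine (√L + √ε * ψ (zeroIndex N)) *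
          Real.exp (-anharmonic L ε (fun k : Modes N => (k : ℤ)) ψ)
            ∂(gaussPi fun k : Modes N => nu L k) - 1| ≤ C * ε := by
  obtain ⟨S, hS⟩ := exists_sum_inv_mu_le hL hL'
  set M := L * Real.exp (1 / L * (2 + S)) with hM
  have hM0 : 0 < M := by positivity
  set C₁ := 2 / L * M
  set C₂ := 6480 * L * M
  set C₃ := 2 * Real.exp (3 / 2 * S) * C₂
  have hC₁ : 0 < C₁ := by positivity
  have hC₂ : 0 < C₂ := by positivity
  have hC₃ : 0 < C₃ := by positivity
  refine ⟨5 * (C₁ + C₂ + 6 * M + C₃), fun N ε hε hε1 => ?_⟩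
  set κ : Modes N → ℤ := fun k => (k : ℤ)
  have hκ : Function.Injective κ := Subtype.val_injective
  set ν : Modes N → ℝ := fun k => nu L k
  have hν : ∀ k, 0 < ν k := fun k => nu_pos L k
  set w : Modes N → ℝ := barrierWeight L (1 / 2)
  have hw : ∀ k, 0 < w k := fun k => barrierWeight_pos hL hL' (by norm_num) k
  have hprob := isProbabilityMeasure_gaussPi hν
  have hs : √ε ^ 2 = ε := Real.sq_sqrt hε.le
  have hsL : √L ^ 2 = L := Real.sq_sqrt hL.le
  have hWν : ∫ ψ, coshEnergy L κ ψ ∂(gaussPi ν) ≤ M := by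
    refine (integral_coshEnergy_le hL κ hν).trans ?_
    have := sum_inv_nu_le hL hL' (hS N)
    rw [hM]; gcongr
  have hWw : ∫ ψ, coshEnergy L κ ψ ∂(gaussPi w) ≤ M := by
    refine (integral_coshEnergy_le hL κ hw).trans ?_
    have h := sum_inv_barrierWeight_le (a := 1 / 2) (hS N)
    rw [show (1 : ℝ) / (1 / 2) = 2 by norm_num] at h
    rw [hM]; gcongr
  have hsm : Measurable fun ψ : Modes N → ℝ => halfLine (√L + √ε * ψ (zeroIndex N)) :=
    measurable_halfLine.comp (by fun_prop)
  have hXm : Measurable (anharmonic L ε κ) := (continuous_anharmonic L ε κ).measurable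
  -- On the half space the full exponent dominates the comparison form, so the density of ν times
  -- e^{-X} is at most the ratio of normalisations times the density of w; on the other side the
  -- cutoff vanishes.
  have key : ∀ ψ : Modes N → ℝ, gaussDensity ν ψ * (halfLine (√L + √ε * ψ (zeroIndex N)) *
      (anharmonic L ε κ ψ ^ 2 * Real.exp (-anharmonic L ε κ ψ))) ≤
      (gaussNorm ν)⁻¹ * gaussNorm w * (gaussDensity w ψ * anharmonic L ε κ ψ ^ 2) := by
    intro ψ
    have hgw := gaussNorm_pos hw
    have hgν := gaussNorm_pos hν
    rcases lt_or_ge (√L + √ε * ψ (zeroIndex N)) 0 with h | h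
    · rw [halfLine_of_neg h, zero_mul, mul_zero]
      have := gaussDensity_pos hw ψ
      positivity
    · have h1 := half_sum_barrierWeight_le hL hε ψ h
      have e1 : (gaussNorm ν)⁻¹ * gaussNorm w * (gaussDensity w ψ * anharmonic L ε κ ψ ^ 2) =
          (gaussNorm ν)⁻¹ * (anharmonic L ε κ ψ ^ 2 *
            Real.exp (-(1 / 2 * ∑ k, w k * ψ k ^ 2))) := by
        rw [gaussDensity]; field_simp
      have e2 : gaussDensity ν ψ * (halfLine (√L + √ε * ψ (zeroIndex N)) *
          (anharmonic L ε κ ψ ^ 2 * Real.exp (-anharmonic L ε κ ψ))) =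
          (gaussNorm ν)⁻¹ * (anharmonic L ε κ ψ ^ 2 * (halfLine (√L + √ε * ψ (zeroIndex N)) *
            Real.exp (-(1 / 2 * ∑ k, ν k * ψ k ^ 2 + anharmonic L ε κ ψ)))) := by
        rw [gaussDensity, neg_add, Real.exp_add]; ring
      rw [e1, e2]
      refine mul_le_mul_of_nonneg_left (mul_le_mul_of_nonneg_left ?_ (sq_nonneg _))
        (inv_pos.mpr hgν).le
      refine (mul_le_of_le_one_left (Real.exp_pos _).le (halfLine_le_one _)).trans ?_
      exact Real.exp_le_exp.mpr (neg_le_neg h1)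
  have hint : Integrable fun ψ => (gaussNorm ν)⁻¹ * gaussNorm w *
      (gaussDensity w ψ * anharmonic L ε κ ψ ^ 2) :=
    ((integrable_gaussPi_iff hw).mp (integrable_anharmonic_sq hL hε hε1.le κ hw)).const_mul _
  have h4i : Integrable (fun ψ => halfLine (√L + √ε * ψ (zeroIndex N)) *
      (anharmonic L ε κ ψ ^ 2 * Real.exp (-anharmonic L ε κ ψ))) (gaussPi ν) := by
    rw [integrable_gaussPi_iff hν]
    refine hint.mono' ?_ (Filter.Eventually.of_forall fun ψ => ?_)
    · exact ((continuous_gaussDensity ν).measurable.mul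
        (hsm.mul ((hXm.pow_const 2).mul (hXm.neg.exp)))).aestronglyMeasurable
    · rw [Real.norm_of_nonneg]
      · exact key ψ
      · have := gaussDensity_pos hν ψ
        have := halfLine_nonneg (√L + √ε * ψ (zeroIndex N))
        positivity
  have hE : ∀ {c : ℝ}, c ≤ C₁ + C₂ + 6 * M + C₃ → ε * c ≤ (C₁ + C₂ + 6 * M + C₃) * ε :=
    fun h => by rw [mul_comm]; exact mul_le_mul_of_nonneg_right h hε.le
  have hfin := abs_integral_mul_exp_neg_sub_one_le (γ := gaussPi ν)
    (η := (C₁ + C₂ + 6 * M + C₃) * ε) hsm hXm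
    (fun _ => halfLine_nonneg _) (fun _ => halfLine_le_one _)
    (integrable_anharmonic_sq hL hε hε1.le κ hν) ?_ ?_ ?_ h4i ?_
  · rwa [← mul_assoc] at hfin
  -- A Chebyshev bound: on the other half space ε ψ₀² ≥ L, while ψ₀² is at most twice the cosh
  -- functional.
  · have hb : ∀ ψ : Modes N → ℝ, 1 - halfLine (√L + √ε * ψ (zeroIndex N)) ≤
        ε * (2 / L) * coshEnergy L κ ψ := by
      intro ψ
      have hW := coshEnergy_nonneg hL κ ψ
      rcases lt_or_ge 0 (√L + √ε * ψ (zeroIndex N)) with h | h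
      · rw [halfLine_of_pos h, sub_self]; positivity
      · have h1 : ψ (zeroIndex N) ^ 2 ≤ 2 * coshEnergy L κ ψ :=
          (Finset.single_le_sum (f := fun k => ψ k ^ 2) (fun k _ => sq_nonneg _)
            (Finset.mem_univ _)).trans (sum_sq_le_coshEnergy hL hκ ψ)
        have h2 : L ≤ ε * ψ (zeroIndex N) ^ 2 := by
          have : √L ^ 2 ≤ (-(√ε * ψ (zeroIndex N))) ^ 2 :=
            pow_le_pow_left₀ (Real.sqrt_nonneg L) (by linarith) 2
          rw [neg_sq, mul_pow, hs, hsL] at this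
          exact this
        have h3 : L ≤ ε * (2 * coshEnergy L κ ψ) := h2.trans (mul_le_mul_of_nonneg_left h1 hε.le)
        have h4 : 1 ≤ ε * (2 / L) * coshEnergy L κ ψ := by
          rw [show ε * (2 / L) * coshEnergy L κ ψ = ε * (2 * coshEnergy L κ ψ) / L by ring,
            le_div_iff₀ hL]
          linarith
        linarith [halfLine_nonneg (√L + √ε * ψ (zeroIndex N))]
    refine (integral_mono_of_nonneg (Filter.Eventually.of_forall fun ψ => ?_)
      ((integrable_coshEnergy hL κ hν).const_mul (ε * (2 / L)))
      (Filter.Eventually.of_forall hb)).trans ?_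
    · exact sub_nonneg.mpr (halfLine_le_one _)
    · rw [integral_const_mul, mul_assoc]
      refine (mul_le_mul_of_nonneg_left (mul_le_mul_of_nonneg_left hWν (by positivity))
        hε.le).trans (hE ?_)
      linarith [hC₁]
  · refine (integral_anharmonic_sq_le hL hε hε1.le κ hν).trans ((mul_le_mul_of_nonneg_left
      (mul_le_mul_of_nonneg_left hWν (by positivity)) hε.le).trans (hE ?_))
    linarith
  · refine (abs_integral_anharmonic_le hL hε κ hν).trans ((mul_le_mul_of_nonneg_left
      (mul_le_mul_of_nonneg_left hWν (by positivity)) hε.le).trans (hE ?_))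
    linarith
  · rw [integral_gaussPi hν]
    refine (integral_mono ((integrable_gaussPi_iff hν).mp h4i) hint key).trans ?_
    rw [integral_const_mul, ← integral_gaussPi hw]
    calc _ ≤ 2 * Real.exp (3 / 2 * S) * (ε * C₂) := by
          refine mul_le_mul (gaussNorm_barrier_div_le hL hL' (hS N)) ?_
            (integral_nonneg fun _ => sq_nonneg _) (by positivity)
          exact (integral_anharmonic_sq_le hL hε hε1.le κ hw).trans (mul_le_mul_of_nonneg_left
            (mul_le_mul_of_nonneg_left hWw (by positivity)) hε.le)
      _ = ε * C₃ := by ring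
      _ ≤ _ := hE (by linarith)

theorem partition_prefactor {ε : ℝ} (hL : 0 < L) (hε : 0 < ε) (N : ℕ) :
    √ε ^ (2 * N + 1) * gaussNorm (fun k : Modes N => nu L k) =
      (2 * Real.pi * ε) ^ ((N : ℝ) + 1 / 2) /
        √(nu L 0 * (-laplacianPerp L N + (2 : ℝ) • (1 : Matrix _ _ ℝ)).det) := by
  rw [gaussNorm_eq fun k : Modes N => nu_pos L k, card_modes, det_neg_laplacianPerp_add hL,
    prod_modes, ← sqrt_pow_odd (by positivity),
    Real.sqrt_mul (by positivity : (0 : ℝ) ≤ 2 * Real.pi) ε, mul_pow]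
  simp only [zeroIndex, perpIndex]
  ring

theorem exists_partitionFunction_estimate (hL : 0 < L) (hL' : L < 2 * Real.pi) :
    ∃ C ε₀ : ℝ, 0 < ε₀ ∧ ∀ (N : ℕ) (ε : ℝ), 0 < ε → ε < ε₀ →
      Integrable (fun φ => Real.exp (-potential L N φ / ε)) ∧
      ∃ r : ℝ, |r| ≤ C * ε ∧
        partitionFunction (potential L N) ε =
          2 * (2 * Real.pi * ε) ^ ((N : ℝ) + 1 / 2) /
            √(nu L 0 * (-laplacianPerp L N + (2 : ℝ) • (1 : Matrix _ _ ℝ)).det) * (1 + r) := by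
  obtain ⟨C, hC⟩ := exists_abs_well_integral_sub_one_le hL hL'
  refine ⟨C, 1, one_pos, fun N ε hε hε1 => ⟨integrable_exp_neg_potential hL hL' N hε, _,
    hC N ε hε hε1, ?_⟩⟩
  rw [partitionFunction, integral_exp_neg_potential_eq hL hL' hε, ← mul_assoc (√ε ^ _),
    partition_prefactor hL hε]
  ring

end PartitionFunction

/-! ### Separation of the two sets by the zero mode -/

section Separator

variable {L : ℝ} {N : ℕ}

theorem exists_lipschitzWith_smoothTransition : ∃ K, LipschitzWith K Real.smoothTransition := by
  have hd : ContDiff ℝ 1 Real.smoothTransition := Real.smoothTransition.contDiff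
  have hc : HasCompactSupport (deriv Real.smoothTransition) := by
    refine HasCompactSupport.intro (isCompact_Icc (a := (0 : ℝ)) (b := 1)) fun x hx => ?_
    rcases lt_or_ge x 0 with h | h
    · have : Real.smoothTransition =ᶠ[𝓝 x] fun _ => 0 := by
        filter_upwards [Iio_mem_nhds h] with y hy
        exact Real.smoothTransition.zero_of_nonpos (le_of_lt hy)
      rw [this.deriv_eq, deriv_const]
    · have h1 : 1 < x := lt_of_not_ge fun h1 => hx ⟨h, h1⟩
      have : Real.smoothTransition =ᶠ[𝓝 x] fun _ => 1 := by
        filter_upwards [Ioi_mem_nhds h1] with y hy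
        exact Real.smoothTransition.one_of_one_le (le_of_lt hy)
      rw [this.deriv_eq, deriv_const]
  obtain ⟨C, hC⟩ := (hd.continuous_deriv le_rfl).bounded_above_of_compact_support hc
  refine ⟨C.toNNReal, lipschitzWith_of_nnnorm_deriv_le (hd.differentiable one_ne_zero) fun x => ?_⟩
  rw [← NNReal.coe_le_coe, coe_nnnorm]
  exact (hC x).trans (Real.le_coe_toNNReal C)

theorem contDiff_zeroMode : ContDiff ℝ ∞ (zeroMode : GalerkinSpace N → ℝ) := by
  unfold zeroMode; fun_prop

theorem continuous_zeroMode : Continuous (zeroMode : GalerkinSpace N → ℝ) :=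
  contDiff_zeroMode.continuous

theorem lipschitzWith_zeroMode : LipschitzWith 1 (zeroMode : GalerkinSpace N → ℝ) := by
  refine LipschitzWith.of_dist_le_mul fun x y => ?_
  rw [NNReal.coe_one, one_mul, dist_eq_norm, dist_eq_norm]
  exact PiLp.norm_apply_le (x - y) _

theorem continuous_perpPart (ε : ℝ) : Continuous (perpPart ε : GalerkinSpace N → PerpSpace N) := by
  unfold perpPart
  exact (PiLp.continuous_toLp 2 _).comp (by fun_prop)

theorem isClosed_wellSet (ε δ : ℝ) {D : Set (PerpSpace N)} (hD : IsClosed D) :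
    IsClosed (wellSet L ε δ D) := by
  refine IsClosed.inter ?_ (hD.preimage (continuous_perpPart ε))
  exact isClosed_le ((continuous_zeroMode.add continuous_const).abs) continuous_const

theorem zeroMode_le_of_mem_wellSet {ε δ : ℝ} {D : Set (PerpSpace N)} {φ : GalerkinSpace N}
    (h : φ ∈ wellSet L ε δ D) : zeroMode φ ≤ -(√L - δ) := by
  have := (abs_le.mp h.1).2
  linarith

theorem zeroMode_neg (φ : GalerkinSpace N) : zeroMode (-φ) = -zeroMode φ := rfl

theorem le_zeroMode_of_mem_neg_wellSet {ε δ : ℝ} {D : Set (PerpSpace N)} {φ : GalerkinSpace N}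
    (h : φ ∈ -wellSet L ε δ D) : √L - δ ≤ zeroMode φ := by
  have := zeroMode_le_of_mem_wellSet (Set.mem_neg.mp h)
  rw [zeroMode_neg] at this
  linarith

/-- The sets may be unbounded transversally, but the slab |φ₀| < b lies between them, so a smoothed
step in the zero mode is enough. -/
theorem exists_isSeparator_of_zeroMode {A B : Set (GalerkinSpace N)} {b : ℝ} (hb : 0 < b)
    (hA : ∀ φ ∈ A, zeroMode φ ≤ -b) (hB : ∀ φ ∈ B, b ≤ zeroMode φ) :
    ∃ χ, IsSeparator A B χ := by
  obtain ⟨K, hK⟩ := exists_lipschitzWith_smoothTransition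
  refine ⟨fun φ => Real.smoothTransition (1 / 2 - zeroMode φ / b), ?_, ?_, ?_, ?_, ?_⟩
  · exact Real.smoothTransition.contDiff.comp
      (contDiff_const.sub (contDiff_zeroMode.div_const b))
  · have h1 : LipschitzWith (Real.toNNReal b⁻¹) fun φ : GalerkinSpace N =>
        1 / 2 - zeroMode φ / b := by
      refine LipschitzWith.of_dist_le_mul fun x y => ?_
      have h2 := lipschitzWith_zeroMode.dist_le_mul x y
      rw [NNReal.coe_one, one_mul] at h2
      rw [Real.coe_toNNReal _ (by positivity), dist_sub_left, Real.dist_eq, ← sub_div, abs_div,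
        abs_of_pos hb, div_eq_inv_mul]
      exact mul_le_mul_of_nonneg_left h2 (by positivity)
    exact ⟨_, hK.comp h1⟩
  · exact fun φ => ⟨Real.smoothTransition.nonneg _, Real.smoothTransition.le_one _⟩
  · have h1 : tsupport (fun φ : GalerkinSpace N =>
        Real.smoothTransition (1 / 2 - zeroMode φ / b)) ⊆ {φ | zeroMode φ ≤ b / 2} := by
      refine closure_minimal (fun φ hφ => ?_) (isClosed_le continuous_zeroMode continuous_const)
      by_contra h
      rw [Set.mem_ofPred_eq, not_le] at h
      refine hφ (Real.smoothTransition.zero_of_nonpos ?_)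
      have : 1 / 2 ≤ zeroMode φ / b := by rw [le_div_iff₀ hb]; linarith
      linarith
    refine Set.disjoint_left.mpr fun φ h2 h3 => ?_
    have h4 : zeroMode φ ≤ b / 2 := h1 h2
    linarith [hB φ h3]
  · have h1 : tsupport (fun φ : GalerkinSpace N =>
        1 - Real.smoothTransition (1 / 2 - zeroMode φ / b)) ⊆ {φ | -(b / 2) ≤ zeroMode φ} := by
      refine closure_minimal (fun φ hφ => ?_) (isClosed_le continuous_const continuous_zeroMode)
      by_contra h
      rw [Set.mem_ofPred_eq, not_le] at h
      refine hφ ?_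
      have : zeroMode φ / b ≤ -(1 / 2) := by rw [div_le_iff₀ hb]; linarith
      simp only []
      rw [Real.smoothTransition.one_of_one_le (by linarith), sub_self]
    refine Set.disjoint_left.mpr fun φ h2 h3 => ?_
    have h4 : -(b / 2) ≤ zeroMode φ := h1 h2
    linarith [hA φ h3]

end Separator

/-! ### Upper bound: the one-dimensional trial function -/

section UpperBound

variable {L : ℝ} {N : ℕ}

/-- The Eyring–Kramers prefactor of the capacity. -/
def saddleCapacity (L : ℝ) (N : ℕ) (ε : ℝ) : ℝ :=
  ε * Real.exp (-potentialZero L 0 / ε) / √(2 * Real.pi * ε) *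
    ∏ k : PerpModes N, √(2 * Real.pi * ε / mu L k)

theorem saddleCapacity_eq (hL : 0 < L) (hL' : L < 2 * Real.pi) {ε : ℝ} (hε : 0 < ε) :
    saddleCapacity L N ε = (2 * Real.pi * ε) ^ ((N : ℝ) + 1 / 2) * √|mu L 0| *
      Real.exp (-potentialZero L 0 / ε) /
        (2 * Real.pi * √((-laplacianPerp L N - (1 : Matrix _ _ ℝ)).det)) := by
  have hx : 0 < 2 * Real.pi * ε := by positivity
  have hm : ∀ k : PerpModes N, 0 < mu L k := fun k => mu_pos hL hL' (perpModes_ne_zero k)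
  have h0 : √|mu L 0| = 1 := by simp [mu]
  rw [saddleCapacity, det_neg_laplacianPerp_sub hL, h0, ← sqrt_pow_odd hx.le,
    Real.sqrt_prod _ fun k _ => (hm k).le]
  simp_rw [Real.sqrt_div hx.le]
  rw [Finset.prod_div_distrib, Finset.prod_const, Finset.card_univ, card_perpModes]
  have h1 : √(2 * Real.pi * ε) ≠ 0 := (Real.sqrt_pos.mpr hx).ne'
  have h2 : √(2 * Real.pi * ε) ^ 2 = 2 * Real.pi * ε := Real.sq_sqrt hx.le
  have h3 : ∏ k : PerpModes N, √(mu L k) ≠ 0 :=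
    Finset.prod_ne_zero_iff.mpr fun k _ => (Real.sqrt_pos.mpr (hm k)).ne'
  have hpi := Real.pi_pos.ne'
  rw [pow_succ]
  set q := √(2 * Real.pi * ε) with hq
  clear_value q
  field_simp
  linarith

theorem saddleCapacity_pos (hL : 0 < L) (hL' : L < 2 * Real.pi) {ε : ℝ} (hε : 0 < ε) :
    0 < saddleCapacity L N ε := by
  have h : 0 < ∏ k : PerpModes N, √(2 * Real.pi * ε / mu L k) :=
    Finset.prod_pos fun k _ => Real.sqrt_pos.mpr
      (div_pos (by positivity) (mu_pos hL hL' (perpModes_ne_zero k)))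
  unfold saddleCapacity
  positivity

theorem integral_exp_neg_sq_div {ε : ℝ} (hε : 0 < ε) :
    Integrable (fun t : ℝ => Real.exp (-(t ^ 2 / (2 * ε)))) ∧
      ∫ t : ℝ, Real.exp (-(t ^ 2 / (2 * ε))) = √(2 * Real.pi * ε) := by
  have h : ∀ t : ℝ, Real.exp (-(t ^ 2 / (2 * ε))) = Real.exp (-(1 / (2 * ε)) * t ^ 2) :=
    fun t => by congr 1; ring
  simp_rw [h]
  refine ⟨integrable_exp_neg_mul_sq (by positivity), ?_⟩
  rw [integral_gaussian]
  congr 1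
  field_simp

/-- The resistance of the one-dimensional parabolic barrier. -/
def barrierIntegral (ε b : ℝ) : ℝ := ∫ t in -b..b, Real.exp (-(t ^ 2 / (2 * ε)))

theorem barrierIntegral_pos {ε b : ℝ} (hb : 0 < b) : 0 < barrierIntegral ε b :=
  intervalIntegral.intervalIntegral_pos_of_pos
    (Continuous.intervalIntegrable (by fun_prop) _ _) (fun _ => Real.exp_pos _) (by linarith)

theorem barrierIntegral_eq_indicator {ε b : ℝ} (hb : 0 < b) :
    barrierIntegral ε b =
      ∫ t : ℝ, (Set.Ioo (-b) b).indicator (fun t => Real.exp (-(t ^ 2 / (2 * ε)))) t := by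
  rw [integral_indicator measurableSet_Ioo, barrierIntegral,
    intervalIntegral.integral_of_le (by linarith), integral_Ioc_eq_integral_Ioo]

theorem barrierIntegral_ge {ε b : ℝ} (hε : 0 < ε) (hb : 0 < b) :
    √(2 * Real.pi * ε) * (1 - 8 * ε / b ^ 2) ≤ barrierIntegral ε b := by
  obtain ⟨hi, hI⟩ := integral_exp_neg_sq_div hε
  obtain ⟨hi', hI'⟩ := integral_exp_neg_sq_div (by positivity : 0 < 2 * ε)
  rw [barrierIntegral_eq_indicator hb]
  -- For |t| ≥ b one half of the exponent gives e^{-t²/(4ε)} ≤ 4ε/b², the other half a Gaussian of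
  -- doubled variance. The mass of the latter is at most twice the original, whence the 8.
  have hpt : ∀ t : ℝ, Real.exp (-(t ^ 2 / (2 * ε))) -
      4 * ε / b ^ 2 * Real.exp (-(t ^ 2 / (2 * (2 * ε)))) ≤
      (Set.Ioo (-b) b).indicator (fun t => Real.exp (-(t ^ 2 / (2 * ε)))) t := by
    intro t
    by_cases ht : t ∈ Set.Ioo (-b) b
    · rw [Set.indicator_of_mem ht]
      have : 0 ≤ 4 * ε / b ^ 2 * Real.exp (-(t ^ 2 / (2 * (2 * ε)))) := by positivity
      linarith
    · rw [Set.indicator_of_notMem ht, sub_nonpos]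
      have h1 : b ^ 2 ≤ t ^ 2 := by
        rw [← sq_abs t]
        refine pow_le_pow_left₀ hb.le ?_ 2
        by_contra h
        exact ht (abs_lt.mp (not_le.mp h))
      have h2 : Real.exp (-(t ^ 2 / (2 * ε))) =
          Real.exp (-(t ^ 2 / (4 * ε))) * Real.exp (-(t ^ 2 / (2 * (2 * ε)))) := by
        rw [← Real.exp_add]; congr 1; field_simp; ring
      rw [h2]
      refine mul_le_mul_of_nonneg_right ?_ (Real.exp_pos _).le
      have h3 : b ^ 2 / (4 * ε) ≤ Real.exp (t ^ 2 / (4 * ε)) := by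
        have h4 := Real.add_one_le_exp (t ^ 2 / (4 * ε))
        have h5 : b ^ 2 / (4 * ε) ≤ t ^ 2 / (4 * ε) := by gcongr
        linarith
      rw [Real.exp_neg, show 4 * ε / b ^ 2 = (b ^ 2 / (4 * ε))⁻¹ by rw [inv_div]]
      exact inv_anti₀ (by positivity) h3
  have h := integral_mono (hi.sub (hi'.const_mul (4 * ε / b ^ 2)))
    (hi.indicator measurableSet_Ioo) hpt
  refine le_trans ?_ h
  have h6 : ∫ t : ℝ, (Real.exp (-(t ^ 2 / (2 * ε))) -
      4 * ε / b ^ 2 * Real.exp (-(t ^ 2 / (2 * (2 * ε))))) =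
      √(2 * Real.pi * ε) - 4 * ε / b ^ 2 * √(2 * Real.pi * (2 * ε)) := by
    rw [integral_sub hi (hi'.const_mul _), integral_const_mul, hI, hI']
  have h7 : √(2 * Real.pi * (2 * ε)) ≤ 2 * √(2 * Real.pi * ε) := by
    refine Real.sqrt_le_iff.mpr ⟨by positivity, ?_⟩
    rw [mul_pow, Real.sq_sqrt (by positivity)]
    nlinarith [Real.pi_pos, mul_pos Real.pi_pos hε]
  have h8 : 4 * ε / b ^ 2 * √(2 * Real.pi * (2 * ε)) ≤ 4 * ε / b ^ 2 * (2 * √(2 * Real.pi * ε)) :=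
    mul_le_mul_of_nonneg_left h7 (by positivity)
  refine le_trans ?_ h6.ge
  have h9 : √(2 * Real.pi * ε) * (1 - 8 * ε / b ^ 2) =
      √(2 * Real.pi * ε) - 4 * ε / b ^ 2 * (2 * √(2 * Real.pi * ε)) := by ring
  linarith

/-- The equilibrium potential of the one-dimensional parabolic barrier. -/
def barrierPotential (ε b y : ℝ) : ℝ :=
  (barrierIntegral ε b)⁻¹ * ∫ t in y..b, Real.exp (-(t ^ 2 / (2 * ε)))

theorem hasDerivAt_barrierPotential (ε b y : ℝ) :
    HasDerivAt (barrierPotential ε b)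
      (-((barrierIntegral ε b)⁻¹ * Real.exp (-(y ^ 2 / (2 * ε))))) y := by
  have hc : Continuous fun t : ℝ => Real.exp (-(t ^ 2 / (2 * ε))) := by fun_prop
  have h := (intervalIntegral.integral_hasDerivAt_left (hc.intervalIntegrable y b)
    (hc.stronglyMeasurableAtFilter _ _) hc.continuousAt).const_mul (barrierIntegral ε b)⁻¹
  rw [mul_neg] at h
  exact h

theorem barrierPotential_antitone {ε b : ℝ} (hb : 0 < b) : Antitone (barrierPotential ε b) :=
  antitone_of_deriv_nonpos (fun y => (hasDerivAt_barrierPotential ε b y).differentiableAt)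
    fun y => by
      rw [(hasDerivAt_barrierPotential ε b y).deriv]
      have := barrierIntegral_pos (ε := ε) hb
      exact neg_nonpos.mpr (by positivity)

theorem barrierPotential_right (ε b : ℝ) : barrierPotential ε b b = 0 := by
  simp [barrierPotential]

theorem barrierPotential_left {ε b : ℝ} (hb : 0 < b) : barrierPotential ε b (-b) = 1 :=
  inv_mul_cancel₀ (barrierIntegral_pos hb).ne'

/-- The one-dimensional equilibrium potential as a function of the zero mode. -/
def trialPotential (ε b : ℝ) (φ : GalerkinSpace N) : ℝ :=
  barrierPotential ε b (max (-b) (min (zeroMode φ) b))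

theorem trialPotential_mem_Icc {ε b : ℝ} (hb : 0 < b) (φ : GalerkinSpace N) :
    trialPotential ε b φ ∈ Set.Icc (0 : ℝ) 1 := by
  constructor
  · rw [← barrierPotential_right ε b]
    exact barrierPotential_antitone hb (max_le (by linarith) (min_le_right _ _))
  · rw [← barrierPotential_left (ε := ε) hb]
    exact barrierPotential_antitone hb (le_max_left _ _)

theorem trialPotential_of_le {ε b : ℝ} (hb : 0 < b) {φ : GalerkinSpace N} (h : zeroMode φ ≤ -b) :
    trialPotential ε b φ = 1 := by
  rw [trialPotential, max_eq_left ((min_le_left _ _).trans h), barrierPotential_left hb]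

theorem trialPotential_of_ge {ε b : ℝ} (hb : 0 < b) {φ : GalerkinSpace N} (h : b ≤ zeroMode φ) :
    trialPotential ε b φ = 0 := by
  rw [trialPotential, min_eq_right h, max_eq_right (by linarith), barrierPotential_right]

theorem exists_lipschitzWith_trialPotential {ε b : ℝ} (hε : 0 < ε) (hb : 0 < b) :
    ∃ K, LipschitzWith K (trialPotential ε b : GalerkinSpace N → ℝ) := by
  have hJ := barrierIntegral_pos (ε := ε) hb
  have h1 : LipschitzWith (Real.toNNReal (barrierIntegral ε b)⁻¹) (barrierPotential ε b) := by
    refine lipschitzWith_of_nnnorm_deriv_le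
      (fun y => (hasDerivAt_barrierPotential ε b y).differentiableAt) fun y => ?_
    rw [← NNReal.coe_le_coe, coe_nnnorm, (hasDerivAt_barrierPotential ε b y).deriv, norm_neg,
      Real.coe_toNNReal _ (by positivity), Real.norm_of_nonneg (by positivity)]
    refine mul_le_of_le_one_right (by positivity) (Real.exp_le_one_iff.mpr ?_)
    exact neg_nonpos.mpr (by positivity)
  exact ⟨_, h1.comp ((lipschitzWith_zeroMode.min_const b).const_max (-b))⟩

theorem isAdmissible_trialPotential {ε b : ℝ} (hε : 0 < ε) (hb : 0 < b)
    {A B : Set (GalerkinSpace N)} (hA : ∀ φ ∈ A, zeroMode φ ≤ -b) (hB : ∀ φ ∈ B, b ≤ zeroMode φ) :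
    IsAdmissible A B (trialPotential ε b) :=
  ⟨exists_lipschitzWith_trialPotential hε hb, trialPotential_mem_Icc hb,
    fun φ h => trialPotential_of_le hb (hA φ h), fun φ h => trialPotential_of_ge hb (hB φ h)⟩

/-- Outside the open slab, faces included, the trial function attains its extreme value 0 or 1, so
its derivative vanishes there. -/
theorem norm_gradient_trialPotential_le {ε b : ℝ} (hb : 0 < b) (φ : GalerkinSpace N) :
    ‖gradient (trialPotential ε b) φ‖ ≤ (Set.Ioo (-b) b).indicator
      (fun y => (barrierIntegral ε b)⁻¹ * Real.exp (-(y ^ 2 / (2 * ε)))) (zeroMode φ) := by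
  have hJ := barrierIntegral_pos (ε := ε) hb
  rw [norm_gradient]
  by_cases h : zeroMode φ ∈ Set.Ioo (-b) b
  · rw [Set.indicator_of_mem h]
    have h1 : trialPotential ε b =ᶠ[𝓝 φ] barrierPotential ε b ∘ zeroMode := by
      filter_upwards [continuous_zeroMode.continuousAt.preimage_mem_nhds (Ioo_mem_nhds h.1 h.2)]
        with η hη
      simp only [Function.comp_apply, trialPotential]
      rw [min_eq_left (le_of_lt hη.2), max_eq_right (le_of_lt hη.1)]
    have h2 : HasFDerivAt (zeroMode : GalerkinSpace N → ℝ)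
        (EuclideanSpace.proj (zeroIndex N) : GalerkinSpace N →L[ℝ] ℝ) φ :=
      (EuclideanSpace.proj (zeroIndex N) : GalerkinSpace N →L[ℝ] ℝ).hasFDerivAt
    rw [h1.fderiv_eq, ((hasDerivAt_barrierPotential ε b (zeroMode φ)).comp_hasFDerivAt φ h2).fderiv,
      norm_smul, norm_neg, Real.norm_of_nonneg (by positivity)]
    refine mul_le_of_le_one_right (by positivity)
      (ContinuousLinearMap.opNorm_le_bound _ zero_le_one fun v => ?_)
    rw [one_mul]
    exact PiLp.norm_apply_le v _
  · rw [Set.indicator_of_notMem h]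
    have h0 : fderiv ℝ (trialPotential ε b) φ = 0 := by
      rcases le_or_gt (zeroMode φ) (-b) with h1 | h1
      · refine IsLocalMax.fderiv_eq_zero (Filter.Eventually.of_forall fun η => ?_)
        rw [trialPotential_of_le hb h1]
        exact (trialPotential_mem_Icc hb η).2
      · have h2 : b ≤ zeroMode φ := not_lt.mp fun h2 => h ⟨h1, h2⟩
        refine IsLocalMin.fderiv_eq_zero (Filter.Eventually.of_forall fun η => ?_)
        rw [trialPotential_of_ge hb h2]
        exact (trialPotential_mem_Icc hb η).1
    rw [h0, norm_zero]

/-- In the slab V ≥ V₀(0) - z²/2 + ½ Σ μ_k φ_k² with z the zero mode. Of the two factors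
e^{-z²/(2ε)} in the squared gradient one cancels e^{z²/(2ε)}; the other integrates to the barrier
integral and cancels one power of the normalisation. The transversal integral is Gaussian. -/
theorem energy_trialPotential_le (hL : 0 < L) (hL' : L < 2 * Real.pi) {ε b : ℝ} (hε : 0 < ε)
    (hb : 0 < b) :
    ε * ∫ φ, ‖gradient (trialPotential ε b) φ‖ ^ 2 ∂(gibbsMeasure (potential L N) ε) ≤
      ε * Real.exp (-potentialZero L 0 / ε) / barrierIntegral ε b *
        ∏ k : PerpModes N, √(2 * Real.pi * ε / mu L k) := by
  have hJ := barrierIntegral_pos (ε := ε) hb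
  set J := barrierIntegral ε b
  have hm : ∀ k : PerpModes N, 0 < mu L k / ε := fun k =>
    div_pos (mu_pos hL hL' (perpModes_ne_zero k)) hε
  set p : ℝ → ℝ := fun t => Real.exp (-(t ^ 2 / (2 * ε))) with hp
  set F : Modes N → ℝ → ℝ := fun k t =>
    if (k : ℤ) = 0 then (Set.Ioo (-b) b).indicator p t
    else Real.exp (-(1 / 2 * (mu L k / ε * t ^ 2))) with hF
  have hF0 : ∀ t, F (zeroIndex N) t = (Set.Ioo (-b) b).indicator p t := fun t => by
    simp [hF, zeroIndex]
  have hFp : ∀ (k : PerpModes N) t,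
      F (perpIndex k) t = Real.exp (-(1 / 2 * (mu L k / ε * t ^ 2))) := fun k t => by
    simp [hF, perpIndex, perpModes_ne_zero k]
  have hFi : ∀ k, Integrable (F k) := by
    intro k
    by_cases hk : (k : ℤ) = 0
    · simp only [hF, hk, if_true]
      exact (integral_exp_neg_sq_div hε).1.indicator measurableSet_Ioo
    · simp only [hF, hk, if_false]
      have := integrable_exp_quadratic (div_pos (mu_pos hL hL' hk) hε) 0
      simpa using this
  set Cst := Real.exp (-potentialZero L 0 / ε) * (J⁻¹) ^ 2 with hCst
  have hCst0 : 0 < Cst := by positivity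
  have hbound : ∀ ψ : Modes N → ℝ,
      Real.exp (-potential L N (WithLp.toLp 2 ψ) / ε) *
        ‖gradient (trialPotential ε b) (WithLp.toLp 2 ψ : GalerkinSpace N)‖ ^ 2 ≤
      Cst * ∏ k, F k (ψ k) := by
    intro ψ
    have hprod : ∏ k, F k (ψ k) = (Set.Ioo (-b) b).indicator p (ψ (zeroIndex N)) *
        Real.exp (-(1 / 2 * ∑ k : PerpModes N, mu L k / ε * ψ (perpIndex k) ^ 2)) := by
      rw [prod_modes, hF0]
      simp_rw [hFp]
      rw [← Real.exp_sum, Finset.sum_neg_distrib, Finset.mul_sum]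
    have h1 := norm_gradient_trialPotential_le (ε := ε) hb (WithLp.toLp 2 ψ : GalerkinSpace N)
    have h2 := potential_ge hL (WithLp.toLp 2 ψ : GalerkinSpace N)
    rw [zeroMode_eq] at h1 h2
    simp only at h1 h2
    rw [hprod]
    set z := ψ (zeroIndex N)
    by_cases hz : z ∈ Set.Ioo (-b) b
    · rw [Set.indicator_of_mem hz] at h1 ⊢
      have h3 : potentialZero L 0 - z ^ 2 / 2 ≤ potentialZero L z := by
        have : potentialZero L z = potentialZero L 0 - z ^ 2 / 2 + z ^ 4 / (4 * L) := by
          unfold potentialZero; field_simp; ring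
        rw [this]
        have : 0 ≤ z ^ 4 / (4 * L) := by positivity
        linarith
      have h4 : ∑ k : PerpModes N, mu L k / ε * ψ (perpIndex k) ^ 2 =
          (∑ k : PerpModes N, mu L k * ψ (perpIndex k) ^ 2) / ε := by
        rw [Finset.sum_div]
        exact Finset.sum_congr rfl fun k _ => by ring
      have h5 : -potential L N (WithLp.toLp 2 ψ) / ε ≤ -potentialZero L 0 / ε +
          z ^ 2 / (2 * ε) + -(1 / 2 * ∑ k : PerpModes N, mu L k / ε * ψ (perpIndex k) ^ 2) := by
        rw [h4]
        set T := ∑ k : PerpModes N, mu L k * ψ (perpIndex k) ^ 2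
        rw [div_le_iff₀ hε]
        have h6 : (-potentialZero L 0 / ε + z ^ 2 / (2 * ε) + -(1 / 2 * (T / ε))) * ε =
            -potentialZero L 0 + z ^ 2 / 2 - 1 / 2 * T := by field_simp; ring
        rw [h6]
        linarith
      calc _ ≤ Real.exp (-potentialZero L 0 / ε + z ^ 2 / (2 * ε) +
              -(1 / 2 * ∑ k : PerpModes N, mu L k / ε * ψ (perpIndex k) ^ 2)) *
              (J⁻¹ * p z) ^ 2 :=
            mul_le_mul (Real.exp_le_exp.mpr h5) (pow_le_pow_left₀ (norm_nonneg _) h1 2)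
              (by positivity) (Real.exp_pos _).le
        _ = _ := by
            have h7 : Real.exp (z ^ 2 / (2 * ε)) * p z = 1 := by
              rw [hp, ← Real.exp_add]; simp
            rw [Real.exp_add, Real.exp_add, hCst]
            linear_combination (Real.exp (-potentialZero L 0 / ε) * p z * (J⁻¹) ^ 2 *
              Real.exp (-(1 / 2 * ∑ k : PerpModes N, mu L k / ε * ψ (perpIndex k) ^ 2))) * h7
    · rw [Set.indicator_of_notMem hz] at h1 ⊢
      have h3 : ‖gradient (trialPotential ε b) (WithLp.toLp 2 ψ : GalerkinSpace N)‖ = 0 :=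
        le_antisymm h1 (norm_nonneg _)
      rw [h3]; simp
  have hint : Integrable fun ψ : Modes N → ℝ => Cst * ∏ k, F k (ψ k) :=
    (Integrable.fintype_prod hFi).const_mul _
  have hval : ∫ ψ : Modes N → ℝ, Cst * ∏ k, F k (ψ k) =
      Cst * (J * ∏ k : PerpModes N, √(2 * Real.pi * ε / mu L k)) := by
    rw [integral_const_mul, integral_fintype_prod_volume_eq_prod, prod_modes]
    simp_rw [hF0, hFp]
    rw [← barrierIntegral_eq_indicator hb]
    congr 2
    refine Finset.prod_congr rfl fun k _ => ?_
    have := integral_exp_quadratic (hm k) 0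
    simp only [zero_mul, add_zero] at this
    rw [this]
    simp only [ne_eq, OfNat.ofNat_ne_zero, not_false_eq_true, zero_pow, zero_div, mul_zero,
      Real.exp_zero, mul_one]
    rw [div_div_eq_mul_div]
  rw [integral_gibbsMeasure (continuous_potential hL N), integral_galerkin_eq]
  have h := integral_mono_of_nonneg (μ := volume) (Filter.Eventually.of_forall fun ψ : Modes N → ℝ =>
    (by positivity : 0 ≤ Real.exp (-potential L N (WithLp.toLp 2 ψ) / ε) *
        ‖gradient (trialPotential ε b) (WithLp.toLp 2 ψ : GalerkinSpace N)‖ ^ 2)) hint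
    (Filter.Eventually.of_forall hbound)
  rw [hval] at h
  refine (mul_le_mul_of_nonneg_left h hε.le).trans (le_of_eq ?_)
  rw [hCst]
  field_simp

theorem energy_trialPotential_le_saddleCapacity (hL : 0 < L) (hL' : L < 2 * Real.pi) {ε b : ℝ}
    (hε : 0 < ε) (hb : 0 < b) (hεb : 16 * ε ≤ b ^ 2) :
    ε * ∫ φ, ‖gradient (trialPotential ε b) φ‖ ^ 2 ∂(gibbsMeasure (potential L N) ε) ≤
      saddleCapacity L N ε * (1 + 16 / b ^ 2 * ε) := by
  refine (energy_trialPotential_le hL hL' hε hb).trans ?_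
  have hJ := barrierIntegral_ge hε hb
  have hJ0 := barrierIntegral_pos (ε := ε) hb
  have hx : 0 < √(2 * Real.pi * ε) := Real.sqrt_pos.mpr (by positivity)
  have hP : 0 ≤ ∏ k : PerpModes N, √(2 * Real.pi * ε / mu L k) :=
    Finset.prod_nonneg fun _ _ => Real.sqrt_nonneg _
  rw [saddleCapacity, mul_right_comm _ (∏ k : PerpModes N, √(2 * Real.pi * ε / mu L k))]
  refine mul_le_mul_of_nonneg_right ?_ hP
  rw [div_mul_eq_mul_div, div_le_div_iff₀ hJ0 hx]
  set u := 8 * ε / b ^ 2 with hu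
  have hu0 : 0 ≤ u := by positivity
  have hu1 : u ≤ 1 / 2 := by rw [hu, div_le_iff₀ (by positivity)]; linarith
  have h1 : 1 + 16 / b ^ 2 * ε = 1 + 2 * u := by rw [hu]; ring
  rw [h1]
  -- This is 1/(1 - u) ≤ 1 + 2u for 0 ≤ u ≤ 1/2.
  have h2 : √(2 * Real.pi * ε) ≤ (1 + 2 * u) * (√(2 * Real.pi * ε) * (1 - u)) := by
    nlinarith [mul_nonneg hx.le (mul_nonneg hu0 (by linarith : 0 ≤ 1 - 2 * u))]
  have h3 : √(2 * Real.pi * ε) ≤ (1 + 2 * u) * barrierIntegral ε b :=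
    h2.trans (mul_le_mul_of_nonneg_left hJ (by linarith))
  refine (mul_le_mul_of_nonneg_left h3
    (by positivity : 0 ≤ ε * Real.exp (-potentialZero L 0 / ε))).trans (le_of_eq ?_)
  ring

end UpperBound

/-! ### Fubini along families of curves -/

section ChangeOfVariables

variable {L : ℝ} {N : ℕ}

/-- The element of `E_N` with prescribed zero mode and mean-zero part. -/
def assemble (y : ℝ) (ψ : PerpModes N → ℝ) : GalerkinSpace N :=
  WithLp.toLp 2 fun k => if h : (k : ℤ) = 0 then y else ψ ⟨k, Finset.mem_erase.mpr ⟨h, k.2⟩⟩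

@[simp] theorem assemble_zeroIndex (y : ℝ) (ψ : PerpModes N → ℝ) :
    assemble y ψ (zeroIndex N) = y := by
  simp [assemble, zeroIndex]

@[simp] theorem assemble_perpIndex (y : ℝ) (ψ : PerpModes N → ℝ) (k : PerpModes N) :
    assemble y ψ (perpIndex k) = ψ k := by
  simp [assemble, perpIndex, perpModes_ne_zero k]

theorem modes_cases (k : Modes N) : k = zeroIndex N ∨ ∃ j : PerpModes N, k = perpIndex j := by
  by_cases h : (k : ℤ) = 0
  · exact Or.inl (Subtype.ext h)
  · exact Or.inr ⟨⟨k, Finset.mem_erase.mpr ⟨h, k.2⟩⟩, rfl⟩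

theorem continuous_assemble :
    Continuous fun p : ℝ × (PerpModes N → ℝ) => assemble p.1 p.2 := by
  refine (PiLp.continuous_toLp 2 _).comp (continuous_pi fun k => ?_)
  by_cases h : (k : ℤ) = 0
  · simp only [h, dite_true]; fun_prop
  · simp only [h, dite_false]; fun_prop

theorem lintegral_galerkin_eq {g : GalerkinSpace N → ENNReal} (hg : Measurable g) :
    ∫⁻ φ, g φ = ∫⁻ y : ℝ, ∫⁻ ψ : PerpModes N → ℝ, g (assemble y ψ) := by
  have h1 := (PiLp.volume_preserving_toLp (Modes N)).lintegral_comp hg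
  have h2 := (volume_measurePreserving_piCongrLeft (fun _ : Modes N => ℝ)
    (modesEquiv N)).lintegral_comp (hg.comp (PiLp.continuous_toLp 2 _).measurable)
  have h3 := Measure.pi_map_piOptionEquivProd (β := fun _ : Option (PerpModes N) => ℝ)
    (fun _ => volume)
  have hm : Measurable (Function.uncurry fun (y : ℝ) (ψ : PerpModes N → ℝ) => g (assemble y ψ)) :=
    hg.comp continuous_assemble.measurable
  rw [← h1]
  refine h2.symm.trans ?_
  rw [volume_pi, ← h3, lintegral_map_equiv, lintegral_prod_symm]
  · refine lintegral_congr fun y => lintegral_congr fun ψ => ?_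
    refine congrArg g (PiLp.ext fun k => ?_)
    have hk : ∀ o, MeasurableEquiv.piCongrLeft (fun _ : Modes N => ℝ) (modesEquiv N)
        ((MeasurableEquiv.piOptionEquivProd fun _ : Option (PerpModes N) => ℝ).symm (ψ, y))
          (modesEquiv N o) = (MeasurableEquiv.piOptionEquivProd
            fun _ : Option (PerpModes N) => ℝ).symm (ψ, y) o := fun o =>
      Equiv.piCongrLeft_apply_apply _ _ _ _
    rcases modes_cases k with rfl | ⟨j, rfl⟩
    · rw [assemble_zeroIndex]; exact hk none
    · rw [assemble_perpIndex]; exact hk (some j)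
  · refine Measurable.aemeasurable ?_
    refine (hg.comp (PiLp.continuous_toLp 2 _).measurable).comp ?_
    exact (MeasurableEquiv.measurable _).comp (MeasurableEquiv.measurable _)

theorem lintegral_pi_diagonal {ι : Type*} [Fintype ι] {d : ι → ℝ} (hd : ∀ i, 0 < d i)
    {g : (ι → ℝ) → ENNReal} (hg : Measurable g) :
    ∫⁻ x, g x = ENNReal.ofReal (∏ i, d i) * ∫⁻ x : ι → ℝ, g fun i => d i * x i := by
  classical
  have hp : 0 < ∏ i, d i := Finset.prod_pos fun i _ => hd i
  have h := Real.smul_map_diagonal_volume_pi (D := d) (by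
    rw [Matrix.det_diagonal]; exact hp.ne')
  rw [Matrix.det_diagonal, abs_of_pos hp] at h
  conv_lhs => rw [← h]
  rw [lintegral_smul_measure, smul_eq_mul, lintegral_map hg]
  · congr 1
    refine lintegral_congr fun x => congrArg g (funext fun i => ?_)
    simp [Matrix.mulVec_diagonal]
  · exact (LinearMap.continuous_of_finiteDimensional _).measurable

/-- Fubini along the curves `y ↦ (y, (d y k ψ_k)_k)`. -/
theorem lintegral_galerkin_curves {d : ℝ → PerpModes N → ℝ} (hd : ∀ k, Continuous fun y => d y k)
    {I : Set ℝ} (hI : MeasurableSet I) (hd0 : ∀ y ∈ I, ∀ k, 0 < d y k)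
    {g : GalerkinSpace N → ENNReal} (hg : Measurable g) :
    ∫⁻ ψ : PerpModes N → ℝ, ∫⁻ y in I,
      ENNReal.ofReal (∏ k, d y k) * g (assemble y fun k => d y k * ψ k) ≤ ∫⁻ φ, g φ := by
  have hm : Measurable (Function.uncurry fun (ψ : PerpModes N → ℝ) (y : ℝ) =>
      ENNReal.ofReal (∏ k, d y k) * g (assemble y fun k => d y k * ψ k)) := by
    refine Measurable.mul ?_ (hg.comp ?_)
    · exact (Continuous.measurable (by fun_prop)).ennreal_ofReal
    · have h : Continuous fun p : (PerpModes N → ℝ) × ℝ => (p.2, fun k => d p.2 k * p.1 k) := by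
        fun_prop
      exact (continuous_assemble.comp h).measurable
  rw [lintegral_lintegral_swap hm.aemeasurable, lintegral_galerkin_eq hg]
  refine le_trans (le_of_eq ?_) (setLIntegral_le_lintegral I _)
  refine setLIntegral_congr_fun hI fun y hy => ?_
  have hga : Measurable fun ψ : PerpModes N → ℝ => g (assemble y ψ) :=
    hg.comp (continuous_assemble.comp (Continuous.prodMk_right y)).measurable
  rw [lintegral_pi_diagonal (hd0 y hy) hga, lintegral_const_mul]
  refine hga.comp (Continuous.measurable ?_)
  fun_prop

end ChangeOfVariables

/-! ### Energy along a single curve -/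

section Curves

variable {ι : Type*} [Fintype ι]

theorem lipschitzOnWith_of_continuous_deriv {E : Type*} [NormedAddCommGroup E] [NormedSpace ℝ E]
    {γ γ' : ℝ → E} {a b : ℝ} (hγ : ∀ y, HasDerivAt γ (γ' y) y)
    (hγ' : Continuous γ') : ∃ K, LipschitzOnWith K γ (Set.uIcc a b) := by
  obtain ⟨C, hC⟩ := isCompact_uIcc.exists_bound_of_continuousOn (s := Set.uIcc a b)
    hγ'.continuousOn
  refine ⟨C.toNNReal, (convex_uIcc a b).lipschitzOnWith_of_nnnorm_hasDerivWithin_le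
    (fun y _ => (hγ y).hasDerivWithinAt) fun y hy => ?_⟩
  rw [← NNReal.coe_le_coe, coe_nnnorm]
  exact (hC y hy).trans (Real.le_coe_toNNReal C)

/-- The one-dimensional Thomson bound along a curve from `{f = 1}` to `{f = 0}`. -/
theorem curve_energy_ge {f : EuclideanSpace ℝ ι → ℝ} {K : NNReal} (hf : LipschitzWith K f)
    {γ γ' : ℝ → EuclideanSpace ℝ ι} (hγ : ∀ y, HasDerivAt γ (γ' y) y) (hγ' : Continuous γ')
    {a b : ℝ} (hab : a ≤ b) {w : ℝ → ℝ} (hw : Continuous w) (hw0 : ∀ y ∈ Set.Icc a b, 0 < w y)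
    (hd : ∀ᵐ y ∂(volume.restrict (Set.Ioc a b)), DifferentiableAt ℝ f (γ y))
    (ha : f (γ a) = 1) (hb : f (γ b) = 0) {t : ℝ} (ht : 0 ≤ t) :
    IntervalIntegrable (fun y => w y * ‖gradient f (γ y)‖ ^ 2) volume a b ∧
    2 * t - t ^ 2 * ∫ y in a..b, ‖γ' y‖ ^ 2 / w y ≤ ∫ y in a..b, w y * ‖gradient f (γ y)‖ ^ 2 := by
  have hγc : Continuous γ := continuous_iff_continuousAt.mpr fun y => (hγ y).continuousAt
  have hgm : Measurable fun y => gradient f (γ y) := (measurable_gradient f).comp hγc.measurable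
  have hgb : ∀ y, ‖gradient f (γ y)‖ ≤ K := fun y => norm_gradient_le hf _
  obtain ⟨K', hK'⟩ := lipschitzOnWith_of_continuous_deriv (a := a) (b := b) hγ hγ'
  -- Since f ∘ γ is Lipschitz on the interval, the fundamental theorem of calculus applies; the
  -- chain rule is needed only for the almost all y at which f is differentiable at γ(y).
  have hac : AbsolutelyContinuousOnInterval (f ∘ γ) a b :=
    (hf.comp_lipschitzOnWith hK').absolutelyContinuousOnInterval
  have hftc := hac.integral_deriv_eq_sub
  simp only [Function.comp_apply, ha, hb, zero_sub] at hftc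
  have hderiv : ∀ᵐ y ∂(volume.restrict (Set.Ioc a b)),
      deriv (f ∘ γ) y = inner ℝ (gradient f (γ y)) (γ' y) := by
    filter_upwards [hd] with y hy
    rw [inner_gradient]
    exact (hy.hasFDerivAt.comp_hasDerivAt y (hγ y)).deriv
  have hint1 : IntervalIntegrable (fun y => w y * ‖gradient f (γ y)‖ ^ 2) volume a b := by
    have hi : IntervalIntegrable (fun y => w y * (K : ℝ) ^ 2) volume a b :=
      (hw.mul continuous_const).intervalIntegrable a b
    refine hi.mono_fun
      (hw.measurable.mul (hgm.norm.pow_const 2)).aestronglyMeasurable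
      (Filter.Eventually.of_forall fun y => ?_)
    simp only [norm_mul]
    refine mul_le_mul_of_nonneg_left ?_ (norm_nonneg _)
    rw [Real.norm_of_nonneg (by positivity), Real.norm_of_nonneg (by positivity)]
    exact pow_le_pow_left₀ (norm_nonneg _) (hgb y) 2
  have hint2 : IntervalIntegrable (fun y => inner ℝ (gradient f (γ y)) (γ' y)) volume a b := by
    have hi : IntervalIntegrable (fun y => (K : ℝ) * ‖γ' y‖) volume a b :=
      (continuous_const.mul hγ'.norm).intervalIntegrable a b
    refine hi.mono_fun
      (hgm.inner hγ'.measurable).aestronglyMeasurable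
      (Filter.Eventually.of_forall fun y => ?_)
    refine (norm_inner_le_norm _ _).trans ?_
    simp only [norm_mul, norm_norm, Real.norm_of_nonneg K.coe_nonneg]
    exact mul_le_mul_of_nonneg_right (hgb y) (norm_nonneg _)
  have hint3 : IntervalIntegrable (fun y => ‖γ' y‖ ^ 2 / w y) volume a b := by
    refine ContinuousOn.intervalIntegrable ?_
    rw [Set.uIcc_of_le hab]
    exact ContinuousOn.div (hγ'.norm.pow 2).continuousOn hw.continuousOn fun y hy => (hw0 y hy).ne'
  refine ⟨hint1, ?_⟩
  have hone : ∫ y in a..b, inner ℝ (gradient f (γ y)) (γ' y) = -1 := by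
    rw [← hftc, intervalIntegral.integral_of_le hab, intervalIntegral.integral_of_le hab]
    exact integral_congr_ae (hderiv.mono fun y hy => hy.symm)
  -- Completing the square: w A² + t² c²/w ≥ 2 t A c ≥ -2 t ⟨∇f, γ'⟩. The optimal t is the inverse
  -- resistance, but any t ≥ 0 is allowed, which later makes the bound linear in the resistance.
  have hpt : ∀ y ∈ Set.Icc a b, -(2 * t) * inner ℝ (gradient f (γ y)) (γ' y) -
      t ^ 2 * (‖γ' y‖ ^ 2 / w y) ≤ w y * ‖gradient f (γ y)‖ ^ 2 := by
    intro y hy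
    have h1 := (abs_le.mp (abs_real_inner_le_norm (gradient f (γ y)) (γ' y))).1
    have h2 := hw0 y hy
    set A := ‖gradient f (γ y)‖
    set c := ‖γ' y‖
    have h3 : w y * A ^ 2 - 2 * t * (A * c) + t ^ 2 * (c ^ 2 / w y) = (w y * A - t * c) ^ 2 / w y := by
      field_simp; ring
    have h4 : 0 ≤ (w y * A - t * c) ^ 2 / w y := by positivity
    nlinarith
  have h := intervalIntegral.integral_mono_on hab
    ((hint2.const_mul (-(2 * t))).sub (hint3.const_mul (t ^ 2))) hint1 hpt
  rw [intervalIntegral.integral_sub (hint2.const_mul _) (hint3.const_mul _),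
    intervalIntegral.integral_const_mul, intervalIntegral.integral_const_mul, hone] at h
  linarith

end Curves

/-! ### Energy lower bound from a fibration by curves -/

section Fibration

variable {L : ℝ} {N : ℕ}

theorem hasDerivAt_assemble {d d' : ℝ → PerpModes N → ℝ} {y : ℝ}
    (hd : ∀ k, HasDerivAt (fun y => d y k) (d' y k) y) (ψ : PerpModes N → ℝ) :
    HasDerivAt (fun y => assemble y fun k => d y k * ψ k) (assemble 1 fun k => d' y k * ψ k) y := by
  have h : HasDerivAt (fun y => fun k : Modes N => assemble y (fun k => d y k * ψ k) k)
      (fun k => assemble 1 (fun k => d' y k * ψ k) k) y := by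
    refine hasDerivAt_pi.mpr fun k => ?_
    rcases modes_cases k with rfl | ⟨j, rfl⟩
    · simp only [assemble_zeroIndex]; exact hasDerivAt_id y
    · simp only [assemble_perpIndex]; exact (hd j).mul_const _
  exact ((PiLp.continuousLinearEquiv 2 ℝ (fun _ : Modes N => ℝ)).symm.toContinuousLinearMap
    |>.hasFDerivAt.comp_hasDerivAt y h)

theorem norm_assemble_sq (y : ℝ) (ψ : PerpModes N → ℝ) :
    ‖assemble y ψ‖ ^ 2 = y ^ 2 + ∑ k, ψ k ^ 2 := by
  rw [EuclideanSpace.real_norm_sq_eq, sum_modes]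
  simp

/-- On the right only the positive part of h counts. This permits a lower bound h for the
conductances that is negative on unsuitable curves. -/
theorem ofReal_integral_le_lintegral {α : Type*} [MeasurableSpace α] {μ : Measure α} {h : α → ℝ}
    (hh : Integrable h μ) : ENNReal.ofReal (∫ x, h x ∂μ) ≤ ∫⁻ x, ENNReal.ofReal (h x) ∂μ := by
  have h1 : ∫ x, h x ∂μ ≤ ∫ x, max (h x) 0 ∂μ :=
    integral_mono hh hh.pos_part fun x => le_max_left _ _
  refine (ENNReal.ofReal_le_ofReal h1).trans (le_of_eq ?_)
  rw [ofReal_integral_eq_lintegral_ofReal hh.pos_part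
    (Filter.Eventually.of_forall fun x => le_max_right _ _)]
  refine lintegral_congr fun x => ?_
  rcases le_total (h x) 0 with hx | hx
  · rw [max_eq_right hx, ENNReal.ofReal_zero, ENNReal.ofReal_of_nonpos hx]
  · rw [max_eq_left hx]

/-- Lower bound on the Dirichlet energy by the resistances of a family of curves. -/
theorem energy_ge_of_curves {V : GalerkinSpace N → ℝ} (hV : Continuous V) {ε : ℝ}
    [IsFiniteMeasure (gibbsMeasure V ε)] {f : GalerkinSpace N → ℝ} {K : NNReal}
    (hf : LipschitzWith K f) {d d' : ℝ → PerpModes N → ℝ} {a b : ℝ} (hab : a ≤ b)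
    (hd : ∀ y k, HasDerivAt (fun y => d y k) (d' y k) y) (hd' : ∀ k, Continuous fun y => d' y k)
    (hd0 : ∀ y ∈ Set.Icc a b, ∀ k, 0 < d y k) {h : (PerpModes N → ℝ) → ℝ} (hh : Integrable h)
    (hcurve : ∀ ψ, 0 < h ψ → f (assemble a fun k => d a k * ψ k) = 1 ∧
      f (assemble b fun k => d b k * ψ k) = 0 ∧ ∃ t, 0 ≤ t ∧
        h ψ ≤ 2 * t - t ^ 2 * ∫ y in a..b, (1 + ∑ k, (d' y k * ψ k) ^ 2) /
          ((∏ k, d y k) * Real.exp (-V (assemble y fun k => d y k * ψ k) / ε))) :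
    ∫ ψ, h ψ ≤ ∫ φ, ‖gradient f φ‖ ^ 2 ∂(gibbsMeasure V ε) := by
  have hdc : ∀ k, Continuous fun y => d y k := fun k =>
    continuous_iff_continuousAt.mpr fun y => (hd y k).continuousAt
  have hI : ∀ y ∈ Set.Ioc a b, ∀ k, 0 < d y k := fun y hy => hd0 y (Set.Ioc_subset_Icc_self hy)
  have hgm := measurable_gradient f
  have hE : Measurable fun φ => ENNReal.ofReal (Real.exp (-V φ / ε) * ‖gradient f φ‖ ^ 2) :=
    (Measurable.mul (by fun_prop : Continuous fun φ => Real.exp (-V φ / ε)).measurable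
      (hgm.norm.pow_const 2)).ennreal_ofReal
  have hNm : MeasurableSet {φ | ¬ DifferentiableAt ℝ f φ} :=
    (measurableSet_of_differentiableAt ℝ f).compl
  -- Rademacher's theorem gives a null set in space; the change of variables turns it into a null
  -- set on almost every curve.
  have hdiff : ∀ᵐ ψ : PerpModes N → ℝ, ∀ᵐ y ∂(volume.restrict (Set.Ioc a b)),
      DifferentiableAt ℝ f (assemble y fun k => d y k * ψ k) := by
    have hz : ∫⁻ φ, Set.indicator {φ | ¬ DifferentiableAt ℝ f φ} (fun _ => (1 : ENNReal)) φ = 0 := by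
      rw [lintegral_indicator_const hNm, one_mul]
      exact hf.ae_differentiableAt
    have hgind : Measurable
        (Set.indicator {φ | ¬ DifferentiableAt ℝ f φ} (fun _ => (1 : ENNReal))) :=
      measurable_const.indicator hNm
    have h1 := lintegral_galerkin_curves hdc measurableSet_Ioc hI hgind
    rw [hz] at h1
    have h2 := nonpos_iff_eq_zero.mp h1
    have hcm : Continuous fun p : (PerpModes N → ℝ) × ℝ =>
        assemble p.2 (fun k => d p.2 k * p.1 k) := by
      have h : Continuous fun p : (PerpModes N → ℝ) × ℝ => (p.2, fun k => d p.2 k * p.1 k) := by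
        fun_prop
      exact continuous_assemble.comp h
    have hpm : Measurable fun y => ENNReal.ofReal (∏ k, d y k) :=
      (Continuous.measurable (by fun_prop)).ennreal_ofReal
    have hm : Measurable (Function.uncurry fun (ψ : PerpModes N → ℝ) (y : ℝ) =>
        ENNReal.ofReal (∏ k, d y k) * Set.indicator {φ | ¬ DifferentiableAt ℝ f φ}
          (fun _ => (1 : ENNReal)) (assemble y fun k => d y k * ψ k)) :=
      (hpm.comp measurable_snd).mul (hgind.comp hcm.measurable)
    rw [lintegral_eq_zero_iff hm.lintegral_prod_right] at h2
    filter_upwards [h2] with ψ hψ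
    have hmψ := hm.comp (measurable_prodMk_left (x := ψ))
    have h3 := (lintegral_eq_zero_iff hmψ).mp hψ
    filter_upwards [h3, ae_restrict_mem measurableSet_Ioc] with y hy hyI
    by_contra hnd
    simp only [Function.comp_apply, Function.uncurry_apply_pair, Pi.zero_apply] at hy
    rw [Set.indicator_of_mem (by exact hnd), mul_one, ENNReal.ofReal_eq_zero] at hy
    exact absurd (Finset.prod_pos fun k _ => hI y hyI k) (not_lt.mpr hy)
  have hlow : ∫⁻ ψ, ENNReal.ofReal (h ψ) ≤
      ∫⁻ φ, ENNReal.ofReal (Real.exp (-V φ / ε) * ‖gradient f φ‖ ^ 2) := by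
    refine le_trans (lintegral_mono_ae ?_)
      (lintegral_galerkin_curves hdc measurableSet_Ioc hI hE)
    filter_upwards [hdiff] with ψ hψ
    rcases le_or_gt (h ψ) 0 with h0 | h0
    · rw [ENNReal.ofReal_of_nonpos h0]; exact zero_le
    obtain ⟨ha, hb, t, ht, hle⟩ := hcurve ψ h0
    have hγc : Continuous fun y => assemble y fun k => d y k * ψ k := by
      have h : Continuous fun y : ℝ => (y, fun k => d y k * ψ k) := by fun_prop
      exact continuous_assemble.comp h
    have hγ'c : Continuous fun y => assemble 1 fun k => d' y k * ψ k := by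
      have h : Continuous fun y : ℝ => ((1 : ℝ), fun k => d' y k * ψ k) := by fun_prop
      exact continuous_assemble.comp h
    obtain ⟨hint, hmain⟩ := curve_energy_ge hf (fun y => hasDerivAt_assemble (hd y) ψ) hγ'c hab
      (w := fun y => (∏ k, d y k) * Real.exp (-V (assemble y fun k => d y k * ψ k) / ε))
      (by fun_prop) (fun y hy => mul_pos (Finset.prod_pos fun k _ => hd0 y hy k) (Real.exp_pos _))
      hψ ha hb ht
    simp_rw [norm_assemble_sq, one_pow] at hmain
    refine (ENNReal.ofReal_le_ofReal (hle.trans hmain)).trans (le_of_eq ?_)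
    rw [intervalIntegral.integral_of_le hab, ofReal_integral_eq_lintegral_ofReal hint.1]
    · refine setLIntegral_congr_fun measurableSet_Ioc fun y hy => ?_
      have hp : 0 ≤ ∏ k, d y k := Finset.prod_nonneg fun k _ => (hI y hy k).le
      rw [mul_assoc, ENNReal.ofReal_mul hp]
    · filter_upwards [ae_restrict_mem measurableSet_Ioc] with y hy
      have hp : 0 ≤ ∏ k, d y k := Finset.prod_nonneg fun k _ => (hI y hy k).le
      simp only [Pi.zero_apply]
      positivity
  have hfin : Integrable (fun φ => ‖gradient f φ‖ ^ 2) (gibbsMeasure V ε) :=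
    (memLp_gradient hf (p := 2)).integrable_norm_pow two_ne_zero
  rw [← ENNReal.ofReal_le_ofReal_iff (integral_nonneg fun _ => sq_nonneg _)]
  refine (ofReal_integral_le_lintegral hh).trans (hlow.trans (le_of_eq ?_))
  rw [ofReal_integral_eq_lintegral_ofReal hfin (Filter.Eventually.of_forall fun _ => sq_nonneg _),
    gibbsMeasure, lintegral_withDensity_eq_lintegral_mul₀ (measurable_gibbsDensity hV).aemeasurable
      (hgm.norm.pow_const 2).ennreal_ofReal.aemeasurable]
  refine lintegral_congr fun φ => ?_
  rw [Pi.mul_apply, ← ENNReal.ofReal_mul (Real.exp_pos _).le]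

end Fibration

/-! ### Resistance of the perturbed barrier and squeezing of modes -/

section Resistance

variable {L : ℝ} {N : ℕ}

theorem barrier_resistance_le (hL : 0 < L) {ε a b d : ℝ} (hε : 0 < ε) (hb : 0 < b)
    (hbL : b ^ 2 ≤ L) (ha : 0 ≤ a) (haε : 8 * a * ε ≤ 1) (hd : 0 ≤ d) (hd1 : d ≤ 1) :
    ∫ y in -b..b, Real.exp (-(y ^ 2 / (2 * ε)) + (y ^ 4 / (4 * L * ε) + a * y ^ 2 + d)) ≤
      √(2 * Real.pi * ε) * (1 + 9 * (128 * ε / L + 16 * a * ε + d)) := by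
  obtain ⟨hi, hI⟩ := integral_exp_neg_sq_div hε
  obtain ⟨hi', hI'⟩ := integral_exp_neg_sq_div (by positivity : 0 < 8 * ε)
  set q := 128 * ε / L + 16 * a * ε + d with hq
  have hq0 : 0 ≤ q := by positivity
  have hpt : ∀ y ∈ Set.Icc (-b) b,
      Real.exp (-(y ^ 2 / (2 * ε)) + (y ^ 4 / (4 * L * ε) + a * y ^ 2 + d)) ≤
        Real.exp (-(y ^ 2 / (2 * ε))) + 3 * q * Real.exp (-(y ^ 2 / (2 * (8 * ε)))) := by
    intro y hy
    have hy2 : y ^ 2 ≤ L := (sq_le_sq' hy.1 hy.2).trans hbL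
    set E := y ^ 4 / (4 * L * ε) + a * y ^ 2 + d with hE
    have hE0 : 0 ≤ E := by positivity
    -- In terms of z the Gaussian exponent is -8z, while y² ≤ L and 8aε ≤ 1 bound y⁴/(4Lε) by 4z and
    -- a y² by 2z. Of the remaining e^{-2z}, one factor e^{-z} absorbs the polynomial E and the
    -- other is left to integrate.
    set z := y ^ 2 / (2 * (8 * ε)) with hz
    have hz0 : 0 ≤ z := by positivity
    have hyz : y ^ 2 = 16 * ε * z := by rw [hz]; field_simp; ring
    have h1 : Real.exp E ≤ 1 + E * Real.exp E := by
      have h2 := Real.add_one_le_exp (-E)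
      have h3 : Real.exp (-E) * Real.exp E = 1 := by rw [← Real.exp_add]; simp
      nlinarith [Real.exp_pos E]
    have h4 : -(y ^ 2 / (2 * ε)) + E ≤ -z + -z + d := by
      have h5 : y ^ 4 / (4 * L * ε) ≤ 4 * z := by
        rw [div_le_iff₀ (by positivity)]
        have : 4 * z * (4 * L * ε) = L * y ^ 2 := by rw [hyz]; ring
        rw [this]
        nlinarith [sq_nonneg y]
      have h6 : a * y ^ 2 ≤ 2 * z := by
        rw [hyz]
        nlinarith
      have h7 : y ^ 2 / (2 * ε) = 8 * z := by rw [hyz]; field_simp; ring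
      rw [h7, hE]
      linarith
    have h8 : E ≤ q * Real.exp z := by
      have h9 := Real.add_one_le_exp z
      have h10 := Real.quadratic_le_exp_of_nonneg hz0
      have h11 : z ≤ Real.exp z := by linarith
      have h12 : z ^ 2 ≤ 2 * Real.exp z := by linarith
      have h13 : 1 ≤ Real.exp z := by linarith
      have h14 : E = 64 * ε / L * z ^ 2 + 16 * a * ε * z + d := by
        rw [hE, show y ^ 4 = (y ^ 2) ^ 2 by ring, hyz]
        field_simp; ring
      have h15 : 64 * ε / L * z ^ 2 ≤ 64 * ε / L * (2 * Real.exp z) :=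
        mul_le_mul_of_nonneg_left h12 (by positivity)
      have h16 : 16 * a * ε * z ≤ 16 * a * ε * Real.exp z :=
        mul_le_mul_of_nonneg_left h11 (by positivity)
      have h17 : d * 1 ≤ d * Real.exp z := mul_le_mul_of_nonneg_left h13 hd
      rw [h14, hq, add_mul, add_mul, show 128 * ε / L * Real.exp z =
        64 * ε / L * (2 * Real.exp z) by ring]
      linarith
    -- The constant 9 of the statement is 3 · 3: e^d ≤ 3 here, and √8 ≤ 3 for the wider Gaussian.
    have h18 : Real.exp d ≤ 3 :=
      (Real.exp_le_exp.mpr hd1).trans (by linarith [Real.exp_one_lt_d9])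
    calc Real.exp (-(y ^ 2 / (2 * ε)) + E)
        ≤ Real.exp (-(y ^ 2 / (2 * ε))) + E * Real.exp (-(y ^ 2 / (2 * ε)) + E) := by
          rw [Real.exp_add]
          nlinarith [Real.exp_pos (-(y ^ 2 / (2 * ε)))]
      _ ≤ Real.exp (-(y ^ 2 / (2 * ε))) + q * Real.exp z * Real.exp (-z + -z + d) := by
          gcongr
      _ = Real.exp (-(y ^ 2 / (2 * ε))) + Real.exp d * (q * Real.exp (-z)) := by
          have : Real.exp z * Real.exp (-z + -z + d) = Real.exp d * Real.exp (-z) := by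
            rw [← Real.exp_add, ← Real.exp_add]; congr 1; ring
          rw [mul_assoc, this]; ring
      _ ≤ Real.exp (-(y ^ 2 / (2 * ε))) + 3 * (q * Real.exp (-z)) := by
          gcongr
      _ = _ := by ring
  have hi2 : Integrable fun y : ℝ =>
      Real.exp (-(y ^ 2 / (2 * ε))) + 3 * q * Real.exp (-(y ^ 2 / (2 * (8 * ε)))) :=
    hi.add (hi'.const_mul _)
  have h1 : ∫ y in -b..b, Real.exp (-(y ^ 2 / (2 * ε)) + (y ^ 4 / (4 * L * ε) + a * y ^ 2 + d)) ≤
      ∫ y : ℝ, (Real.exp (-(y ^ 2 / (2 * ε))) + 3 * q * Real.exp (-(y ^ 2 / (2 * (8 * ε))))) := by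
    refine (intervalIntegral.integral_mono_on (by linarith)
      (Continuous.intervalIntegrable (by fun_prop) _ _) hi2.intervalIntegrable hpt).trans ?_
    rw [intervalIntegral.integral_of_le (by linarith)]
    exact setIntegral_le_integral hi2 (Filter.Eventually.of_forall fun y => by positivity)
  refine h1.trans ?_
  rw [integral_add hi (hi'.const_mul _), integral_const_mul, hI, hI']
  have h2 : √(2 * Real.pi * (8 * ε)) ≤ 3 * √(2 * Real.pi * ε) := by
    refine Real.sqrt_le_iff.mpr ⟨by positivity, ?_⟩
    rw [mul_pow, Real.sq_sqrt (by positivity)]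
    nlinarith [mul_pos Real.pi_pos hε]
  have h3 := mul_le_mul_of_nonneg_left h2 (by positivity : 0 ≤ 3 * q)
  linarith

/-- The factor multiplying the `k`-th mode along the curves joining the wells: modes with
`m k = 0` are squeezed away from the saddle, those with `m k = 1` are not. -/
def squeeze {ι : Type*} (m : ι → ℝ) (r : ℝ) (k : ι) : ℝ := 1 - r * (1 - m k)

section Squeeze

variable {ι : Type*} {m : ι → ℝ}

theorem squeeze_mem (hm : ∀ k, m k = 0 ∨ m k = 1) {r : ℝ} (hr0 : 0 ≤ r) (hr1 : r < 1) (k : ι) :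
    0 < squeeze m r k ∧ squeeze m r k ≤ 1 := by
  rcases hm k with h | h <;> (simp [squeeze, h]; try constructor) <;> linarith

/-- One factor of the Jacobian of the squeezing. The logarithmic loss is linear in u, so with u =
y²/b² it joins the y² corrections of the barrier exponent. -/
theorem exp_le_one_sub {R u : ℝ} (hR : 1 ≤ R) (hu0 : 0 ≤ u) (hu1 : u ≤ 1) :
    Real.exp (-((R - 1) * u)) ≤ 1 - (1 - 1 / R) * u := by
  have hR0 : 0 < R := by linarith
  have h1 := Real.add_one_le_exp ((R - 1) * u)
  have h2 : 1 ≤ (1 - (1 - 1 / R) * u) * ((R - 1) * u + 1) := by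
    have : (1 - (1 - 1 / R) * u) * ((R - 1) * u + 1) = 1 + (R - 1) ^ 2 / R * (u * (1 - u)) := by
      field_simp; ring
    rw [this]
    have : 0 ≤ (R - 1) ^ 2 / R * (u * (1 - u)) :=
      mul_nonneg (by positivity) (mul_nonneg hu0 (by linarith))
    linarith
  have h3 : 0 ≤ 1 - (1 - 1 / R) * u := by
    have h4 : 1 / R ≤ 1 := (div_le_one hR0).mpr hR
    have h5 : 0 < 1 / R := by positivity
    nlinarith
  rw [Real.exp_neg, inv_le_iff_one_le_mul₀ (Real.exp_pos _)]
  exact h2.trans (mul_le_mul_of_nonneg_left h1 h3)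

theorem exp_le_prod_squeeze [Fintype ι] (hm : ∀ k, m k = 0 ∨ m k = 1) {R u n : ℝ} (hR : 1 ≤ R)
    (hu0 : 0 ≤ u) (hu1 : u ≤ 1) (hn : ∑ k, (1 - m k) ≤ n) :
    Real.exp (-((R - 1) * n * u)) ≤ ∏ k, squeeze m ((1 - 1 / R) * u) k := by
  have h1 : ∀ k, Real.exp (-((R - 1) * u) * (1 - m k)) ≤ squeeze m ((1 - 1 / R) * u) k := by
    intro k
    rcases hm k with h | h
    · simpa [squeeze, h] using exp_le_one_sub hR hu0 hu1
    · simp [squeeze, h]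
  refine le_trans ?_ (Finset.prod_le_prod (fun k _ => (Real.exp_pos _).le) fun k _ => h1 k)
  rw [← Real.exp_sum, ← Finset.mul_sum]
  refine Real.exp_le_exp.mpr ?_
  have := mul_le_mul_of_nonneg_left hn (mul_nonneg (sub_nonneg.mpr hR) hu0)
  linarith

/-- A squeezed function is the convex combination (1 - r) ψ + r ψ', where ψ' keeps only the modes
with m = 1, and x⁴ is convex. Hence the cosh functional of the truncated function has to be
controlled along with that of ψ. -/
theorem integral_trigSum_squeeze_pow_four_le [Fintype ι] (hL : 0 < L) (κ : ι → ℤ) {r : ℝ}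
    (hr0 : 0 ≤ r) (hr1 : r ≤ 1) (ψ : ι → ℝ) :
    ∫ x in (0 : ℝ)..L, trigSum L κ (fun k => squeeze m r k * ψ k) x ^ 4 ≤
      24 * (coshEnergy L κ ψ + coshEnergy L κ fun k => m k * ψ k) := by
  have h1 : ∀ x, trigSum L κ (fun k => squeeze m r k * ψ k) x =
      (1 - r) * trigSum L κ ψ x + r * trigSum L κ (fun k => m k * ψ k) x := by
    intro x
    simp only [trigSum, Finset.mul_sum]
    rw [← Finset.sum_add_distrib]
    exact Finset.sum_congr rfl fun k _ => by unfold squeeze; ring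
  have h2 := integral_trigSum_pow_le hL κ ψ 2
  have h3 := integral_trigSum_pow_le hL κ (fun k => m k * ψ k) 2
  norm_num [Nat.factorial] at h2 h3
  have h4 : ∀ x ∈ Set.Icc 0 L, trigSum L κ (fun k => squeeze m r k * ψ k) x ^ 4 ≤
      trigSum L κ ψ x ^ 4 + trigSum L κ (fun k => m k * ψ k) x ^ 4 := by
    intro x _
    rw [h1]
    set A := trigSum L κ ψ x
    set B := trigSum L κ (fun k => m k * ψ k) x
    have hc : ConvexOn ℝ Set.univ fun x : ℝ => x ^ 4 := Even.convexOn_pow (by decide)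
    have h5 := hc.2 (Set.mem_univ A) (Set.mem_univ B) (sub_nonneg.mpr hr1) hr0 (by ring)
    simp only [smul_eq_mul] at h5
    have hA : 0 ≤ A ^ 4 := by positivity
    have hB : 0 ≤ B ^ 4 := by positivity
    nlinarith
  refine (intervalIntegral.integral_mono_on hL.le (Continuous.intervalIntegrable (by fun_prop) _ _)
    (Continuous.intervalIntegrable (by fun_prop) _ _) h4).trans ?_
  rw [intervalIntegral.integral_add (Continuous.intervalIntegrable (by fun_prop) _ _)
    (Continuous.intervalIntegrable (by fun_prop) _ _)]
  linarith

end Squeeze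

/-- `potential_le` at a squeezed point: squeezing only decreases the quadratic terms, and 18 = (3/4)
· 24. -/
theorem potential_assemble_le (hL : 0 < L) (hL' : L < 2 * Real.pi) {ε : ℝ} (hε : 0 < ε)
    {m : PerpModes N → ℝ} (hm : ∀ k, m k = 0 ∨ m k = 1) {r : ℝ} (hr0 : 0 ≤ r) (hr1 : r < 1)
    (y : ℝ) (ψ : PerpModes N → ℝ) :
    potential L N (assemble y fun k => √ε * squeeze m r k * ψ k) / ε ≤
      potentialZero L 0 / ε - y ^ 2 / (2 * ε) + y ^ 4 / (4 * L * ε) +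
        1 / 2 * ∑ k : PerpModes N, mu L k * ψ k ^ 2 + 2 * y ^ 2 / L * ∑ k, ψ k ^ 2 +
        18 * ε * (coshEnergy L (fun k : PerpModes N => (k : ℤ)) ψ +
          coshEnergy L (fun k : PerpModes N => (k : ℤ)) fun k => m k * ψ k) := by
  have hs : √ε ^ 2 = ε := Real.sq_sqrt hε.le
  have h1 := potential_le hL (assemble y fun k => √ε * squeeze m r k * ψ k)
  simp only [zeroMode_eq, assemble_zeroIndex, assemble_perpIndex] at h1
  have hsq : ∀ k, (√ε * squeeze m r k * ψ k) ^ 2 ≤ ε * ψ k ^ 2 := fun k => by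
    obtain ⟨h0, h2⟩ := squeeze_mem hm hr0 hr1 k
    rw [mul_pow, mul_pow, hs]
    have h3 : squeeze m r k ^ 2 ≤ 1 := pow_le_one₀ h0.le h2
    have h4 : ε * squeeze m r k ^ 2 ≤ ε * 1 := mul_le_mul_of_nonneg_left h3 hε.le
    rw [mul_one] at h4
    exact mul_le_mul_of_nonneg_right h4 (sq_nonneg _)
  have h2 : ∑ k : PerpModes N, mu L k * (√ε * squeeze m r k * ψ k) ^ 2 ≤
      ε * ∑ k : PerpModes N, mu L k * ψ k ^ 2 := by
    rw [Finset.mul_sum]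
    refine Finset.sum_le_sum fun k _ => ?_
    have := mul_le_mul_of_nonneg_left (hsq k) (mu_pos hL hL' (perpModes_ne_zero k)).le
    linarith
  have h3 : ∑ k : PerpModes N, (√ε * squeeze m r k * ψ k) ^ 2 ≤ ε * ∑ k, ψ k ^ 2 := by
    rw [Finset.mul_sum]
    exact Finset.sum_le_sum fun k _ => hsq k
  have h4 : ∫ x in (0 : ℝ)..L, perpFun L (fun k => √ε * squeeze m r k * ψ k) x ^ 4 ≤
      ε ^ 2 * (24 * (coshEnergy L (fun k : PerpModes N => (k : ℤ)) ψ +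
          coshEnergy L (fun k : PerpModes N => (k : ℤ)) fun k => m k * ψ k)) := by
    have h5 : ∀ x, perpFun L (fun k => √ε * squeeze m r k * ψ k) x =
        √ε * trigSum L (fun k : PerpModes N => (k : ℤ)) (fun k => squeeze m r k * ψ k) x :=
      fun x => by simp [perpFun, trigSum, Finset.mul_sum, mul_assoc]
    simp_rw [h5, mul_pow]
    rw [intervalIntegral.integral_const_mul, show √ε ^ 4 = ε ^ 2 by
      rw [show (4 : ℕ) = 2 * 2 by rfl, pow_mul, hs]]
    exact mul_le_mul_of_nonneg_left (integral_trigSum_squeeze_pow_four_le hL _ hr0 hr1.le ψ)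
      (sq_nonneg ε)
  set W := coshEnergy L (fun k : PerpModes N => (k : ℤ)) ψ +
    coshEnergy L (fun k : PerpModes N => (k : ℤ)) fun k => m k * ψ k
  have h6 : potentialZero L y = potentialZero L 0 - y ^ 2 / 2 + y ^ 4 / (4 * L) := by
    unfold potentialZero; field_simp; ring
  rw [h6] at h1
  rw [div_le_iff₀ hε]
  have h7 := mul_le_mul_of_nonneg_left h3 (by positivity : 0 ≤ 2 * y ^ 2 / L)
  have h8 : (potentialZero L 0 / ε - y ^ 2 / (2 * ε) + y ^ 4 / (4 * L * ε) +
        1 / 2 * ∑ k : PerpModes N, mu L k * ψ k ^ 2 + 2 * y ^ 2 / L * ∑ k, ψ k ^ 2 +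
        18 * ε * W) * ε = potentialZero L 0 - y ^ 2 / 2 + y ^ 4 / (4 * L) +
        1 / 2 * (ε * ∑ k : PerpModes N, mu L k * ψ k ^ 2) +
        2 * y ^ 2 / L * (ε * ∑ k, ψ k ^ 2) + 3 / 4 * (ε ^ 2 * (24 * W)) := by
    field_simp; ring
  rw [h8]
  linarith

end Resistance

/-! ### The family of curves and its resistance -/

section CurveFamily

variable {L : ℝ} {N : ℕ}

/-- Scaling of the `k`-th mode at height `y` along the curves joining the wells. -/
def curveScale (ε R b : ℝ) (m : PerpModes N → ℝ) (y : ℝ) (k : PerpModes N) : ℝ :=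
  √ε * squeeze m ((1 - 1 / R) * (y ^ 2 / b ^ 2)) k

/-- The derivative of `curveScale` in `y`. -/
def curveScaleDeriv (ε R b : ℝ) (m : PerpModes N → ℝ) (y : ℝ) (k : PerpModes N) : ℝ :=
  √ε * -((1 - 1 / R) * (2 * y / b ^ 2) * (1 - m k))

theorem hasDerivAt_curveScale (ε R b : ℝ) (m : PerpModes N → ℝ) (y : ℝ) (k : PerpModes N) :
    HasDerivAt (fun y => curveScale ε R b m y k) (curveScaleDeriv ε R b m y k) y := by
  have h := ((((hasDerivAt_pow 2 y).div_const (b ^ 2)).const_mul (1 - 1 / R)).mul_const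
    (1 - m k)).const_sub 1 |>.const_mul √ε
  simpa [curveScale, curveScaleDeriv, squeeze] using h

theorem continuous_curveScaleDeriv (ε R b : ℝ) (m : PerpModes N → ℝ) (k : PerpModes N) :
    Continuous fun y => curveScaleDeriv ε R b m y k := by
  unfold curveScaleDeriv; fun_prop

theorem curve_height_mem {R b y : ℝ} (hR : 1 ≤ R) (hb : 0 < b) (hy : y ∈ Set.Icc (-b) b) :
    0 ≤ (1 - 1 / R) * (y ^ 2 / b ^ 2) ∧ (1 - 1 / R) * (y ^ 2 / b ^ 2) < 1 ∧
      y ^ 2 / b ^ 2 ≤ 1 := by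
  have hR0 : 0 < R := by linarith
  have h1 : y ^ 2 / b ^ 2 ≤ 1 := (div_le_one (by positivity)).mpr (sq_le_sq' hy.1 hy.2)
  have h0 : 0 ≤ y ^ 2 / b ^ 2 := by positivity
  have h2 : 1 / R ≤ 1 := (div_le_one hR0).mpr hR
  have h3 : 0 < 1 / R := by positivity
  exact ⟨mul_nonneg (by linarith) h0, by nlinarith, h1⟩

theorem curveScale_pos {ε R b y : ℝ} (hε : 0 < ε) (hR : 1 ≤ R) (hb : 0 < b)
    {m : PerpModes N → ℝ} (hm : ∀ k, m k = 0 ∨ m k = 1) (hy : y ∈ Set.Icc (-b) b)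
    (k : PerpModes N) : 0 < curveScale ε R b m y k := by
  obtain ⟨h0, h1, _⟩ := curve_height_mem hR hb hy
  exact mul_pos (Real.sqrt_pos.mpr hε) (squeeze_mem hm h0 h1 k).1

/-- The exponential energy controlling the anharmonic corrections along a curve. -/
def curveEnergy (L : ℝ) (m ψ : PerpModes N → ℝ) : ℝ :=
  coshEnergy L (fun k : PerpModes N => (k : ℤ)) ψ +
    coshEnergy L (fun k : PerpModes N => (k : ℤ)) fun k => m k * ψ k

theorem curveEnergy_ge (hL : 0 < L) (m ψ : PerpModes N → ℝ) : L ≤ curveEnergy L m ψ :=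
  (coshEnergy_ge hL _ ψ).trans (le_add_of_nonneg_right (coshEnergy_nonneg hL _ _))

theorem sum_sq_le_curveEnergy (hL : 0 < L) (m ψ : PerpModes N → ℝ) :
    ∑ k, ψ k ^ 2 ≤ 2 * curveEnergy L m ψ := by
  refine (sum_sq_le_coshEnergy hL
    (κ := fun k : PerpModes N => (k : ℤ)) Subtype.val_injective ψ).trans ?_
  have := coshEnergy_nonneg hL (fun k : PerpModes N => (k : ℤ)) fun k => m k * ψ k
  unfold curveEnergy
  linarith

/-- The transversal coordinates carry the factor √ε, so transversal motion adds only O(ε) to the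
squared speed. -/
theorem curve_speed_le (hL : 0 < L) {ε R b y : ℝ} (hε : 0 < ε) (hR : 1 ≤ R) (hb : 0 < b)
    {m : PerpModes N → ℝ} (hm : ∀ k, m k = 0 ∨ m k = 1) (hy : y ∈ Set.Icc (-b) b)
    (ψ : PerpModes N → ℝ) :
    1 + ∑ k, (curveScaleDeriv ε R b m y k * ψ k) ^ 2 ≤ 1 + 8 / b ^ 2 * (ε * curveEnergy L m ψ) := by
  have hs : √ε ^ 2 = ε := Real.sq_sqrt hε.le
  have hR0 : 0 < R := by linarith
  have h1 : ∀ k, (curveScaleDeriv ε R b m y k * ψ k) ^ 2 ≤ 4 / b ^ 2 * ε * ψ k ^ 2 := by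
    intro k
    have h2 : (1 - 1 / R) ^ 2 ≤ 1 := by
      have h3 : 1 / R ≤ 1 := (div_le_one hR0).mpr hR
      have h4 : 0 < 1 / R := by positivity
      nlinarith
    have h5 : (1 - m k) ^ 2 ≤ 1 := by rcases hm k with h | h <;> simp [h]
    have h6 : (2 * y / b ^ 2) ^ 2 ≤ 4 / b ^ 2 := by
      have h7 : y ^ 2 ≤ b ^ 2 := sq_le_sq' hy.1 hy.2
      rw [div_pow, div_le_div_iff₀ (by positivity) (by positivity)]
      nlinarith [mul_le_mul_of_nonneg_right h7 (sq_nonneg b)]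
    have h8 : (curveScaleDeriv ε R b m y k * ψ k) ^ 2 =
        (1 - 1 / R) ^ 2 * ((2 * y / b ^ 2) ^ 2 * (1 - m k) ^ 2) * (ε * ψ k ^ 2) := by
      rw [curveScaleDeriv]
      linear_combination
        ((1 - 1 / R) ^ 2 * ((2 * y / b ^ 2) ^ 2 * (1 - m k) ^ 2) * ψ k ^ 2) * hs
    have h9 : (1 - 1 / R) ^ 2 * ((2 * y / b ^ 2) ^ 2 * (1 - m k) ^ 2) ≤ 1 * (4 / b ^ 2 * 1) :=
      mul_le_mul h2 (mul_le_mul h6 h5 (sq_nonneg _) (by positivity)) (by positivity) zero_le_one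
    rw [h8]
    have := mul_le_mul_of_nonneg_right h9 (by positivity : 0 ≤ ε * ψ k ^ 2)
    linarith
  have h2 : ∑ k, (curveScaleDeriv ε R b m y k * ψ k) ^ 2 ≤ 4 / b ^ 2 * ε * ∑ k, ψ k ^ 2 := by
    rw [Finset.mul_sum]
    exact Finset.sum_le_sum fun k _ => h1 k
  have h3 := mul_le_mul_of_nonneg_left (sum_sq_le_curveEnergy hL m ψ)
    (by positivity : 0 ≤ 4 / b ^ 2 * ε)
  have h4 : 4 / b ^ 2 * ε * (2 * curveEnergy L m ψ) = 8 / b ^ 2 * (ε * curveEnergy L m ψ) := by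
    ring
  linarith

/-- The product of the scales is the Jacobian of the fibration. Apart from √ε^(2N) it differs from 1
through at most n squeezed modes, at a cost (R - 1) n y²/b² in the exponent that does not depend on
N. Since the curve energy M is at least L, this cost is put in the form constant · M y². -/
theorem curve_weight_le (hL : 0 < L) (hL' : L < 2 * Real.pi) {ε R b y n : ℝ} (hε : 0 < ε)
    (hR : 1 ≤ R) (hb : 0 < b) (hn : 0 ≤ n) {m : PerpModes N → ℝ}
    (hm : ∀ k, m k = 0 ∨ m k = 1) (hmn : ∑ k, (1 - m k) ≤ n) (hy : y ∈ Set.Icc (-b) b)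
    (ψ : PerpModes N → ℝ) :
    ((∏ k, curveScale ε R b m y k) *
      Real.exp (-potential L N (assemble y fun k => curveScale ε R b m y k * ψ k) / ε))⁻¹ ≤
    (√ε ^ (2 * N))⁻¹ * Real.exp (potentialZero L 0 / ε +
        1 / 2 * ∑ k : PerpModes N, mu L k * ψ k ^ 2) *
      Real.exp (-(y ^ 2 / (2 * ε)) + (y ^ 4 / (4 * L * ε) +
        ((R - 1) * n / (b ^ 2 * L) + 4 / L) * curveEnergy L m ψ * y ^ 2 +
          18 * ε * curveEnergy L m ψ)) := by
  obtain ⟨h0, h1, h2⟩ := curve_height_mem hR hb hy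
  have hse : 0 < √ε := Real.sqrt_pos.mpr hε
  have hV := potential_assemble_le hL hL' hε hm h0 h1 y ψ
  have hS := exp_le_prod_squeeze hm hR (by positivity : 0 ≤ y ^ 2 / b ^ 2) h2 hmn
  have hM := curveEnergy_ge hL m ψ
  have hsum := sum_sq_le_curveEnergy hL m ψ
  change _ ≤ _ + 18 * ε * curveEnergy L m ψ at hV
  set M := curveEnergy L m ψ
  set r := (1 - 1 / R) * (y ^ 2 / b ^ 2)
  set Q := 1 / 2 * ∑ k : PerpModes N, mu L k * ψ k ^ 2
  have hprod : ∏ k, curveScale ε R b m y k = √ε ^ (2 * N) * ∏ k, squeeze m r k := by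
    unfold curveScale
    rw [Finset.prod_mul_distrib, Finset.prod_const, Finset.card_univ, card_perpModes]
  set U := potential L N (assemble y fun k => curveScale ε R b m y k * ψ k) with hU
  have hV' : U / ε ≤ _ := hV
  rw [hprod, mul_assoc, mul_inv, mul_assoc]
  refine mul_le_mul_of_nonneg_left ?_ (by positivity)
  rw [← Real.exp_add]
  have h3 : Real.exp (-((R - 1) * n * (y ^ 2 / b ^ 2)) + -U / ε) ≤
      (∏ k, squeeze m r k) * Real.exp (-U / ε) := by
    rw [Real.exp_add]
    exact mul_le_mul_of_nonneg_right hS (Real.exp_pos _).le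
  refine (inv_anti₀ (Real.exp_pos _) h3).trans ?_
  rw [← Real.exp_neg]
  refine Real.exp_le_exp.mpr ?_
  have h4 : (R - 1) * n * (y ^ 2 / b ^ 2) ≤ (R - 1) * n / (b ^ 2 * L) * M * y ^ 2 := by
    have h5 : (R - 1) * n / (b ^ 2 * L) * M * y ^ 2 =
        (R - 1) * n * (y ^ 2 / b ^ 2) * (M / L) := by field_simp
    rw [h5]
    refine le_mul_of_one_le_right ?_ ((one_le_div hL).mpr hM)
    exact mul_nonneg (mul_nonneg (by linarith) hn) (by positivity)
  have h5 : 2 * y ^ 2 / L * ∑ k, ψ k ^ 2 ≤ 4 / L * M * y ^ 2 := by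
    have := mul_le_mul_of_nonneg_left hsum (by positivity : 0 ≤ 2 * y ^ 2 / L)
    refine this.trans (le_of_eq ?_)
    ring
  have h6 : -(-((R - 1) * n * (y ^ 2 / b ^ 2)) + -U / ε) =
      (R - 1) * n * (y ^ 2 / b ^ 2) + U / ε := by ring
  rw [h6, add_mul, add_mul]
  linarith

theorem exists_curve_resistance_le (hL : 0 < L) (hL' : L < 2 * Real.pi) {R b n : ℝ}
    (hR : 1 ≤ R) (hb : 0 < b) (hbL : b ^ 2 ≤ L) (hn : 0 ≤ n) :
    ∃ C, 0 ≤ C ∧ ∀ (N : ℕ) (m : PerpModes N → ℝ), (∀ k, m k = 0 ∨ m k = 1) →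
      ∑ k, (1 - m k) ≤ n → ∀ (ε : ℝ) (ψ : PerpModes N → ℝ), 0 < ε →
      C * (ε * curveEnergy L m ψ) ≤ 1 →
      ∫ y in -b..b, (1 + ∑ k, (curveScaleDeriv ε R b m y k * ψ k) ^ 2) /
        ((∏ k, curveScale ε R b m y k) *
          Real.exp (-potential L N (assemble y fun k => curveScale ε R b m y k * ψ k) / ε)) ≤
      (√ε ^ (2 * N))⁻¹ * Real.exp (potentialZero L 0 / ε +
        1 / 2 * ∑ k : PerpModes N, mu L k * ψ k ^ 2) * √(2 * Real.pi * ε) *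
        (1 + C * (ε * curveEnergy L m ψ)) := by
  set A := (R - 1) * n / (b ^ 2 * L) + 4 / L with hA
  have hA0 : 0 ≤ A := by
    have : 0 ≤ (R - 1) * n / (b ^ 2 * L) :=
      div_nonneg (mul_nonneg (by linarith) hn) (by positivity)
    positivity
  set B := 9 * (128 / L ^ 2 + 16 * A + 18) with hB
  have hB0 : 0 ≤ B := by positivity
  -- The first three terms bound (1 + 8x/b²)(1 + Bx) for x ≤ 1; adding 8A + 18 makes the smallness
  -- hypothesis imply the conditions on a and d in `barrier_resistance_le`.
  refine ⟨8 / b ^ 2 + B + 8 / b ^ 2 * B + 8 * A + 18, by positivity, ?_⟩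
  intro N m hm hmn ε ψ hε hsmall
  have hM := curveEnergy_ge hL m ψ
  set M := curveEnergy L m ψ
  have hM0 : 0 < M := hL.trans_le hM
  set x := ε * M with hx
  have hx0 : 0 ≤ x := by positivity
  have hb2 : 0 ≤ 8 / b ^ 2 := by positivity
  have hsmall1 : (8 / b ^ 2 + B + 8 / b ^ 2 * B) * x + 8 * (A * x) + 18 * x ≤ 1 := by linarith
  have hp1 : 0 ≤ (8 / b ^ 2 + B + 8 / b ^ 2 * B) * x := by positivity
  have hp2 : 0 ≤ A * x := by positivity
  have h1d := barrier_resistance_le hL hε hb hbL (a := A * M) (d := 18 * ε * M) (by positivity)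
    (by rw [show 8 * (A * M) * ε = 8 * (A * x) by rw [hx]; ring]; linarith) (by positivity)
    (by rw [show 18 * ε * M = 18 * x by rw [hx]; ring]; linarith)
  set P := (√ε ^ (2 * N))⁻¹ * Real.exp (potentialZero L 0 / ε +
        1 / 2 * ∑ k : PerpModes N, mu L k * ψ k ^ 2)
  have hse : 0 < √ε := Real.sqrt_pos.mpr hε
  have hP : 0 ≤ P := by positivity
  have hpt : ∀ y ∈ Set.Icc (-b) b, (1 + ∑ k, (curveScaleDeriv ε R b m y k * ψ k) ^ 2) /
        ((∏ k, curveScale ε R b m y k) *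
          Real.exp (-potential L N (assemble y fun k => curveScale ε R b m y k * ψ k) / ε)) ≤
      (1 + 8 / b ^ 2 * x) * P * Real.exp (-(y ^ 2 / (2 * ε)) +
        (y ^ 4 / (4 * L * ε) + A * M * y ^ 2 + 18 * ε * M)) := by
    intro y hy
    have h1 := curve_speed_le hL hε hR hb hm hy ψ
    have h2 := curve_weight_le hL hL' hε hR hb hn hm hmn hy ψ
    rw [div_eq_mul_inv, mul_assoc (1 + 8 / b ^ 2 * x)]
    refine mul_le_mul h1 h2 (inv_nonneg.mpr ?_) (by positivity)
    exact mul_nonneg (Finset.prod_nonneg fun k _ => (curveScale_pos hε hR hb hm hy k).le)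
      (Real.exp_pos _).le
  have hdc : ∀ k, Continuous fun y => curveScale ε R b m y k := fun k =>
    continuous_iff_continuousAt.mpr fun y => (hasDerivAt_curveScale ε R b m y k).continuousAt
  have hd'c := continuous_curveScaleDeriv ε R b m
  have hγc : Continuous fun y => assemble y fun k => curveScale ε R b m y k * ψ k := by
    have h : Continuous fun y : ℝ => (y, fun k => curveScale ε R b m y k * ψ k) := by fun_prop
    exact continuous_assemble.comp h
  have hVc := continuous_potential hL N
  have hint : IntervalIntegrable (fun y => (1 + ∑ k, (curveScaleDeriv ε R b m y k * ψ k) ^ 2) /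
        ((∏ k, curveScale ε R b m y k) *
          Real.exp (-potential L N (assemble y fun k => curveScale ε R b m y k * ψ k) / ε)))
      volume (-b) b := by
    refine ContinuousOn.intervalIntegrable (ContinuousOn.div ?_ ?_ fun y hy => ?_)
    · exact Continuous.continuousOn (by fun_prop)
    · have : Continuous fun y => potential L N (assemble y fun k => curveScale ε R b m y k * ψ k) :=
        hVc.comp hγc
      exact Continuous.continuousOn (by fun_prop)
    · rw [Set.uIcc_of_le (by linarith)] at hy
      exact (mul_pos (Finset.prod_pos fun k _ => curveScale_pos hε hR hb hm hy k)
        (Real.exp_pos _)).ne'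
  refine (intervalIntegral.integral_mono_on (by linarith) hint
    (Continuous.intervalIntegrable (by fun_prop) _ _) hpt).trans ?_
  rw [intervalIntegral.integral_const_mul]
  refine (mul_le_mul_of_nonneg_left h1d (by positivity)).trans ?_
  have h9 : 9 * (128 * ε / L + 16 * (A * M) * ε + 18 * ε * M) ≤ B * x := by
    have h10 : 128 * ε / L ≤ 128 / L ^ 2 * x := by
      have : 128 / L ^ 2 * x = 128 * ε / L * (M / L) := by rw [hx]; field_simp
      rw [this]
      exact le_mul_of_one_le_right (by positivity) ((one_le_div hL).mpr hM)
    have h11 : B * x = 9 * (128 / L ^ 2 * x + 16 * (A * M) * ε + 18 * ε * M) := by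
      rw [hB, hx]; ring
    rw [h11]
    linarith
  have hκ : 0 ≤ √(2 * Real.pi * ε) := Real.sqrt_nonneg _
  calc (1 + 8 / b ^ 2 * x) * P * (√(2 * Real.pi * ε) *
        (1 + 9 * (128 * ε / L + 16 * (A * M) * ε + 18 * ε * M)))
      ≤ (1 + 8 / b ^ 2 * x) * P * (√(2 * Real.pi * ε) * (1 + B * x)) := by
        gcongr
    _ = P * √(2 * Real.pi * ε) * ((1 + 8 / b ^ 2 * x) * (1 + B * x)) := by ring
    _ ≤ P * √(2 * Real.pi * ε) *
        (1 + (8 / b ^ 2 + B + 8 / b ^ 2 * B + 8 * A + 18) * x) := by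
        refine mul_le_mul_of_nonneg_left ?_ (by positivity)
        have hx1 : x ≤ 1 := by linarith
        have h12 : (1 + 8 / b ^ 2 * x) * (1 + B * x) =
          1 + 8 / b ^ 2 * x + B * x + 8 / b ^ 2 * B * x * x := by ring
        have h13 : 8 / b ^ 2 * B * x * x ≤ 8 / b ^ 2 * B * x * 1 :=
          mul_le_mul_of_nonneg_left hx1 (by positivity)
        rw [h12]
        nlinarith

end CurveFamily

/-! ### Lower bound by curves and the capacity estimate -/

section LowerBound

variable {L : ℝ} {N : ℕ}

/-- The indicator of the modes `|k| > K`. -/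
def highModes (K : ℕ) {N : ℕ} (k : PerpModes N) : ℝ := if |(k : ℤ)| ≤ K then 0 else 1

theorem highModes_eq (K : ℕ) (k : PerpModes N) : highModes K k = 0 ∨ highModes K k = 1 := by
  unfold highModes; split_ifs <;> simp

theorem sum_one_sub_highModes_le (K N : ℕ) :
    ∑ k : PerpModes N, (1 - highModes K k) ≤ 2 * K + 1 := by
  have h1 : ∀ k : PerpModes N, 1 - highModes K k = if |(k : ℤ)| ≤ K then (1 : ℝ) else 0 := by
    intro k
    unfold highModes; split_ifs <;> simp
  simp_rw [h1]
  rw [Finset.sum_boole]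
  have h2 : (Finset.univ.filter fun k : PerpModes N => |(k : ℤ)| ≤ K).card ≤
      (Finset.Icc (-(K : ℤ)) K).card := by
    refine Finset.card_le_card_of_injOn (fun k => (k : ℤ)) (fun k hk => ?_)
      Subtype.val_injective.injOn
    have := (Finset.mem_filter.mp hk).2
    exact Finset.mem_coe.mpr (Finset.mem_Icc.mpr (abs_le.mp this))
  rw [Int.card_Icc] at h2
  have h3 : ((K : ℤ) + 1 - -(K : ℤ)).toNat = 2 * K + 1 := by omega
  rw [h3] at h2
  exact_mod_cast h2

theorem one_add_sq_rpow_le_two_mul_abs {s : ℝ} (hs' : s < 1 / 2) {k : ℤ} (hk : k ≠ 0) :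
    (1 + (k : ℝ) ^ 2) ^ s ≤ 2 * |(k : ℝ)| := by
  have h1 : (1 : ℝ) ≤ |(k : ℝ)| := by exact_mod_cast Int.one_le_abs hk
  have h2 : (1 : ℝ) ≤ 1 + (k : ℝ) ^ 2 := by nlinarith [sq_nonneg (k : ℝ)]
  refine (Real.rpow_le_rpow_of_exponent_le h2 hs'.le).trans ?_
  rw [← Real.sqrt_eq_rpow]
  refine Real.sqrt_le_iff.mpr ⟨by positivity, ?_⟩
  rw [mul_pow, sq_abs]
  have : (1 : ℝ) ≤ (k : ℝ) ^ 2 := by rw [← sq_abs]; nlinarith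
  linarith

/-- The Sobolev weights of the transversal part of a curve at its endpoints. -/
def endWeight (s R : ℝ) (m : PerpModes N → ℝ) (k : PerpModes N) : ℝ :=
  (1 + ((k : ℤ) : ℝ) ^ 2) ^ s * squeeze m (1 - 1 / R) k ^ 2

theorem squeeze_end_mem {R : ℝ} (hR : 1 ≤ R) {m : PerpModes N → ℝ}
    (hm : ∀ k, m k = 0 ∨ m k = 1) (k : PerpModes N) :
    0 < squeeze m (1 - 1 / R) k ∧ squeeze m (1 - 1 / R) k ≤ 1 := by
  have hR0 : 0 < R := by linarith
  have h1 : 1 / R ≤ 1 := (div_le_one hR0).mpr hR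
  have h2 : 0 < 1 / R := by positivity
  exact squeeze_mem hm (by linarith) (by linarith) k

theorem endWeight_nonneg (s R : ℝ) (m : PerpModes N → ℝ) (k : PerpModes N) :
    0 ≤ endWeight s R m k := by
  unfold endWeight; positivity

theorem endWeight_le {R s : ℝ} (hR : 1 ≤ R) {m : PerpModes N → ℝ}
    (hm : ∀ k, m k = 0 ∨ m k = 1) (k : PerpModes N) :
    endWeight s R m k ≤ (1 + ((k : ℤ) : ℝ) ^ 2) ^ s := by
  obtain ⟨h0, h1⟩ := squeeze_end_mem hR hm k
  exact mul_le_of_le_one_right (by positivity) (pow_le_one₀ h0.le h1)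

/-- Writing g for `gapConst L`, modes |k| > K ≥ 8/g satisfy 8|k| ≤ g k². Low modes may violate this,
but at the endpoints they are scaled by 1/R with R ≥ 8/g. The factor 4 is what `integral_exp_sq_le`
asks for. -/
theorem four_mul_endWeight_le (hL : 0 < L) (hL' : L < 2 * Real.pi) {R s : ℝ} {K : ℕ}
    (hs' : s < 1 / 2) (hR : 1 ≤ R) (hRg : 8 / gapConst L ≤ R) (hK : 8 / gapConst L ≤ K)
    (k : PerpModes N) : 4 * endWeight s R (highModes K) k ≤ mu L k := by
  have hg := gapConst_pos hL hL'
  have hk := perpModes_ne_zero k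
  have h1 := one_add_sq_rpow_le_two_mul_abs hs' hk
  refine le_trans ?_ (gapConst_mul_sq_le_mu hk)
  rw [div_le_iff₀ hg] at hRg hK
  have hk1 : (1 : ℝ) ≤ |((k : ℤ) : ℝ)| := by exact_mod_cast Int.one_le_abs hk
  rw [← sq_abs ((k : ℤ) : ℝ)]
  have h2 : 4 * endWeight s R (highModes K) k ≤
      8 * |((k : ℤ) : ℝ)| * squeeze (highModes K) (1 - 1 / R) k ^ 2 := by
    unfold endWeight
    have := mul_le_mul_of_nonneg_right h1 (sq_nonneg (squeeze (highModes K) (1 - 1 / R) k))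
    linarith
  refine h2.trans ?_
  rw [sq |((k : ℤ) : ℝ)|, mul_comm 8, mul_assoc, ← mul_assoc (gapConst L), mul_comm (gapConst L),
    mul_assoc |((k : ℤ) : ℝ)|]
  refine mul_le_mul_of_nonneg_left ?_ (abs_nonneg _)
  by_cases h : |(k : ℤ)| ≤ K
  · have h3 : squeeze (highModes K) (1 - 1 / R) k = 1 / R := by simp [squeeze, highModes, h]
    have hR0 : 0 < R := by linarith
    rw [h3, div_pow, one_pow, mul_one_div, div_le_iff₀ (by positivity)]
    have h4 : gapConst L * R ≤ gapConst L * |((k : ℤ) : ℝ)| * R ^ 2 := by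
      have h5 : R ≤ |((k : ℤ) : ℝ)| * R ^ 2 := by nlinarith [mul_nonneg hR0.le hR0.le]
      have := mul_le_mul_of_nonneg_left h5 hg.le
      linarith
    linarith
  · have h3 : squeeze (highModes K) (1 - 1 / R) k = 1 := by simp [squeeze, highModes, h]
    rw [h3, one_pow, mul_one]
    have h4 : (K : ℝ) ≤ |((k : ℤ) : ℝ)| := by exact_mod_cast (not_le.mp h).le
    have := mul_le_mul_of_nonneg_left h4 hg.le
    linarith

theorem integral_curveEnergy (hL : 0 < L) (hL' : L < 2 * Real.pi) {S : ℝ}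
    (hS : ∑ k : PerpModes N, 1 / mu L k ≤ S) {m : PerpModes N → ℝ}
    (hm : ∀ k, m k = 0 ∨ m k = 1) :
    Integrable (curveEnergy L m) (gaussPi fun k : PerpModes N => mu L k) ∧
      ∫ ψ, curveEnergy L m ψ ∂(gaussPi fun k : PerpModes N => mu L k) ≤
        2 * (L * Real.exp (1 / L * S)) := by
  have hμ : ∀ k : PerpModes N, 0 < mu L k := fun k => mu_pos hL hL' (perpModes_ne_zero k)
  have h1 := integrable_coshEnergy hL (fun k : PerpModes N => (k : ℤ)) hμ
  have h1' := integral_coshEnergy_le hL (fun k : PerpModes N => (k : ℤ)) hμ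
  obtain ⟨h2, h2'⟩ := integrable_coshEnergy_and_le hL (fun k : PerpModes N => (k : ℤ)) (m := m) hμ
    fun k => by rcases hm k with h | h <;> simp [h]
  refine ⟨h1.add h2, ?_⟩
  unfold curveEnergy
  rw [integral_add h1 h2]
  have h3 : L * Real.exp (1 / L * ∑ k : PerpModes N, 1 / mu L k) ≤ L * Real.exp (1 / L * S) := by
    gcongr
  linarith

theorem sobolevNorm_mono {s s' : ℝ} (h : s ≤ s') (ψ : PerpSpace N) :
    sobolevNorm s ψ ≤ sobolevNorm s' ψ := by
  refine Real.sqrt_le_sqrt (Finset.sum_le_sum fun k _ => ?_)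
  refine mul_le_mul_of_nonneg_right (Real.rpow_le_rpow_of_exponent_le ?_ h) (sq_nonneg _)
  exact le_add_of_nonneg_right (sq_nonneg _)

theorem neg_assemble (y : ℝ) (ψ : PerpModes N → ℝ) : -assemble y ψ = assemble (-y) (-ψ) := by
  refine PiLp.ext fun k => ?_
  rcases modes_cases k with rfl | ⟨j, rfl⟩
  · rw [PiLp.neg_apply, assemble_zeroIndex, assemble_zeroIndex]
  · rw [PiLp.neg_apply, assemble_perpIndex, assemble_perpIndex]; rfl

theorem perpPart_assemble {ε : ℝ} (hε : 0 < ε) (y : ℝ) (ψ : PerpModes N → ℝ) :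
    perpPart ε (assemble y fun k => √ε * ψ k) = WithLp.toLp 2 ψ := by
  have hse : √ε ≠ 0 := (Real.sqrt_pos.mpr hε).ne'
  refine PiLp.ext fun k => ?_
  change (assemble y fun k => √ε * ψ k) (perpIndex k) / √ε = ψ k
  rw [assemble_perpIndex]
  field_simp

theorem assemble_mem_wellSet {ε δ : ℝ} (hε : 0 < ε) (hδ : 0 ≤ δ) {D : Set (PerpSpace N)}
    {ψ : PerpModes N → ℝ} (h : WithLp.toLp 2 ψ ∈ D) :
    assemble (-(√L - δ)) (fun k => √ε * ψ k) ∈ wellSet L ε δ D := by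
  refine ⟨?_, ?_⟩
  · rw [zeroMode_eq, assemble_zeroIndex, show -(√L - δ) + √L = δ by ring, abs_of_nonneg hδ]
  · rwa [perpPart_assemble hε]

theorem gaussNorm_mu_mul {ε : ℝ} (hε : 0 < ε) :
    √ε ^ (2 * N) * gaussNorm (fun k : PerpModes N => mu L k) =
      ∏ k : PerpModes N, √(2 * Real.pi * ε / mu L k) := by
  rw [← card_perpModes N, ← Finset.card_univ, ← Finset.prod_const, gaussNorm,
    ← Finset.prod_mul_distrib]
  refine Finset.prod_congr rfl fun k _ => ?_
  rw [← Real.sqrt_mul hε.le]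
  congr 1
  ring

/-- Every transversal ψ labels one curve, usable if its squeezed endpoints lie in the wells. Usable
curves have the leading conductance up to a relative error εM, with M the curve energy, and Markov's
inequality with the weight e^{Σ β ψ²} makes the others cost O(ε). Without squeezing, low modes with
small μ_k may lack this exponential moment. -/
theorem exists_saddleCapacity_le_energy (hL : 0 < L) (hL' : L < 2 * Real.pi) {δ s : ℝ}
    (hδ : 0 < δ) (hδL : δ < √L) (hs' : s < 1 / 2) :
    ∃ C, ∀ (N : ℕ) (ε : ℝ), 0 < ε → ε < 1 → ∀ D : Set (PerpSpace N),
      {ψ : PerpSpace N | sobolevNorm s ψ < √(Real.log (ε⁻¹))} ⊆ D →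
      ∀ f, IsAdmissible (wellSet L ε δ D) (-wellSet L ε δ D) f →
        saddleCapacity L N ε * (1 - C * ε) ≤
          ε * ∫ φ, ‖gradient f φ‖ ^ 2 ∂(gibbsMeasure (potential L N) ε) := by
  set b := √L - δ with hb
  have hb0 : 0 < b := by linarith
  have hbL : b ^ 2 ≤ L := by
    rw [← Real.sq_sqrt hL.le]
    exact pow_le_pow_left₀ hb0.le (by linarith) 2
  -- The summation bound needs a nonnegative exponent. Raising s enlarges the norm, so the smaller
  -- ball is still contained in D.
  set σ := max s 0 with hσ
  have hσ' : σ < 1 / 2 := max_lt hs' (by norm_num)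
  have hg := gapConst_pos hL hL'
  obtain ⟨K, hK⟩ := exists_nat_ge (8 / gapConst L)
  set R := 1 + 8 / gapConst L with hR
  have hg8 : 0 < 8 / gapConst L := by positivity
  have hR1 : 1 ≤ R := by linarith
  have hRg : 8 / gapConst L ≤ R := by linarith
  obtain ⟨C, hC0, hC⟩ := exists_curve_resistance_le hL hL' (n := 2 * K + 1) hR1 hb0 hbL
    (by positivity)
  obtain ⟨S, hS⟩ := exists_sum_inv_mu_le hL hL'
  obtain ⟨T, hT⟩ := exists_sum_one_add_sq_rpow_div_mu_le hL hL' (le_max_right s 0) hσ'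
  refine ⟨2 * C * (2 * (L * Real.exp (1 / L * S))) + Real.exp (2 * T), ?_⟩
  intro N ε hε hε1 D hD f hf
  obtain ⟨⟨Kf, hfK⟩, -, hfA, hfB⟩ := hf
  have hfin := isFiniteMeasure_gibbsMeasure (integrable_exp_neg_potential hL hL' N hε)
  set m : PerpModes N → ℝ := highModes K with hm
  have hm01 : ∀ k, m k = 0 ∨ m k = 1 := highModes_eq K
  set μ : PerpModes N → ℝ := fun k => mu L k with hμdef
  have hμ : ∀ k, 0 < μ k := fun k => mu_pos hL hL' (perpModes_ne_zero k)
  have hprob := isProbabilityMeasure_gaussPi hμ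
  set β : PerpModes N → ℝ := endWeight σ R m with hβ
  have hβ0 : ∀ k, 0 ≤ β k := endWeight_nonneg σ R m
  have hβ4 : ∀ k, 4 * β k ≤ μ k := four_mul_endWeight_le hL hL' hσ' hR1 hRg hK
  obtain ⟨hMi, hM⟩ := integral_curveEnergy hL hL' (hS N) hm01
  have hEi := integrable_exp_sq hμ hβ4
  have hE : ∫ ψ, Real.exp (∑ k, β k * ψ k ^ 2) ∂(gaussPi μ) ≤ Real.exp (2 * T) := by
    refine (integral_exp_sq_le hμ hβ0 hβ4).trans (Real.exp_le_exp.mpr ?_)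
    refine mul_le_mul_of_nonneg_left (le_trans ?_ (hT N)) zero_le_two
    exact Finset.sum_le_sum fun k _ =>
      div_le_div_of_nonneg_right (endWeight_le hR1 hm01 k) (hμ k).le
  -- A lower bound for the relative conductance. If it is positive, then 2CεM < 1, which activates
  -- the resistance bound, and ε e^{Σ β ψ²} < 1, that is Σ β ψ² < log(1/ε), which puts both
  -- endpoints in the two sets.
  set G : (PerpModes N → ℝ) → ℝ := fun ψ =>
    1 - 2 * C * ε * curveEnergy L m ψ - ε * Real.exp (∑ k, β k * ψ k ^ 2) with hG
  have hGi1 : Integrable (fun ψ => 1 - 2 * C * ε * curveEnergy L m ψ) (gaussPi μ) :=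
    (integrable_const 1).sub (hMi.const_mul _)
  have hGi : Integrable G (gaussPi μ) := hGi1.sub (hEi.const_mul ε)
  have hGint : 1 - (2 * C * (2 * (L * Real.exp (1 / L * S))) + Real.exp (2 * T)) * ε ≤
      ∫ ψ, G ψ ∂(gaussPi μ) := by
    rw [hG, integral_sub hGi1 (hEi.const_mul ε), integral_sub (integrable_const 1)
      (hMi.const_mul _), integral_const_mul, integral_const_mul]
    simp only [integral_const, probReal_univ, smul_eq_mul, mul_one]
    have h1 := mul_le_mul_of_nonneg_left hM (by positivity : 0 ≤ 2 * C * ε)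
    have h2 := mul_le_mul_of_nonneg_left hE hε.le
    linarith
  set c₀ := √ε ^ (2 * N) * Real.exp (-potentialZero L 0 / ε) / √(2 * Real.pi * ε) with hc₀
  have hκ : 0 < √(2 * Real.pi * ε) := Real.sqrt_pos.mpr (by positivity)
  have hse : 0 < √ε := Real.sqrt_pos.mpr hε
  have hc₀pos : 0 < c₀ := by positivity
  have hgn := gaussNorm_pos hμ
  -- The multiplier is the inverse of the leading resistance; as a function of ψ it is a multiple of
  -- the Gaussian density, so averages over curves become Gaussian expectations.
  set t : (PerpModes N → ℝ) → ℝ := fun ψ => c₀ * gaussNorm μ * gaussDensity μ ψ with ht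
  have ht0 : ∀ ψ, 0 < t ψ := fun ψ => mul_pos (mul_pos hc₀pos hgn) (gaussDensity_pos hμ ψ)
  have hhi : Integrable fun ψ => t ψ * G ψ := by
    have := ((integrable_gaussPi_iff hμ).mp hGi).const_mul (c₀ * gaussNorm μ)
    refine this.congr (Filter.Eventually.of_forall fun ψ => ?_)
    simp only [ht]; ring
  have hhint : ∫ ψ, t ψ * G ψ = c₀ * gaussNorm μ * ∫ ψ, G ψ ∂(gaussPi μ) := by
    rw [integral_gaussPi hμ, ← integral_const_mul]
    refine integral_congr_ae (Filter.Eventually.of_forall fun ψ => ?_)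
    simp only [ht]; ring
  have hend : ∀ y, y ^ 2 = b ^ 2 → ∀ (ψ : PerpModes N → ℝ) k,
      curveScale ε R b m y k * ψ k = √ε * (squeeze m (1 - 1 / R) k * ψ k) := by
    intro y hy ψ k
    rw [curveScale, hy, div_self (by positivity), mul_one, mul_assoc]
  have hball : ∀ ψ : PerpModes N → ℝ, 0 < G ψ → ∀ ψ' : PerpSpace N,
      (∀ k, ψ' k ^ 2 = (squeeze m (1 - 1 / R) k * ψ k) ^ 2) → ψ' ∈ D := by
    intro ψ hψ ψ' hψ'
    refine hD ?_
    rw [Set.mem_ofPred_eq]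
    refine (sobolevNorm_mono (le_max_left s 0) _).trans_lt ?_
    have hM0 := hL.le.trans (curveEnergy_ge hL m ψ)
    have h1 : 0 ≤ 2 * C * ε * curveEnergy L m ψ := by positivity
    have h2 : ε * Real.exp (∑ k, β k * ψ k ^ 2) < 1 := by simp only [hG] at hψ; linarith
    have h3 : Real.exp (∑ k, β k * ψ k ^ 2) < ε⁻¹ := by
      rwa [lt_inv_comm₀ (Real.exp_pos _) hε, lt_inv_comm₀ hε (Real.exp_pos _), ← one_div,
        lt_div_iff₀' hε]
    have h4 := (Real.lt_log_iff_exp_lt (by positivity)).mpr h3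
    have h5 : ∑ k : PerpModes N, (1 + ((k : ℤ) : ℝ) ^ 2) ^ σ * ψ' k ^ 2 = ∑ k, β k * ψ k ^ 2 := by
      refine Finset.sum_congr rfl fun k _ => ?_
      rw [hψ', mul_pow, hβ, endWeight]; ring
    rw [sobolevNorm, h5]
    refine Real.sqrt_lt_sqrt ?_ h4
    exact Finset.sum_nonneg fun k _ => mul_nonneg (hβ0 k) (sq_nonneg _)
  have henergy := energy_ge_of_curves (continuous_potential hL N) (ε := ε) hfK
    (by linarith : -b ≤ b) (d := curveScale ε R b m) (d' := curveScaleDeriv ε R b m)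
    (fun y k => hasDerivAt_curveScale ε R b m y k) (continuous_curveScaleDeriv ε R b m)
    (fun y hy k => curveScale_pos hε hR1 hb0 hm01 hy k) hhi (by
      intro ψ hψ
      have hGψ : 0 < G ψ := (pos_iff_pos_of_mul_pos hψ).mp (ht0 ψ)
      refine ⟨?_, ?_, t ψ, (ht0 ψ).le, ?_⟩
      · simp_rw [hend (-b) (by ring) ψ]
        exact hfA _ (assemble_mem_wellSet hε hδ.le (hball ψ hGψ _ fun k => rfl))
      · simp_rw [hend b rfl ψ]
        refine hfB _ (Set.mem_neg.mpr ?_)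
        rw [neg_assemble]
        have h1 : (-fun k => √ε * (squeeze m (1 - 1 / R) k * ψ k)) =
            fun k => √ε * (-(squeeze m (1 - 1 / R) k * ψ k)) := by
          funext k; simp
        rw [h1]
        exact assemble_mem_wellSet hε hδ.le (hball ψ hGψ _ fun k => neg_sq _)
      · have hE0 := (Real.exp_pos (∑ k, β k * ψ k ^ 2)).le
        have hM0 := hL.le.trans (curveEnergy_ge hL m ψ)
        have hx : 0 ≤ C * (ε * curveEnergy L m ψ) := by positivity
        have hEε : 0 ≤ ε * Real.exp (∑ k, β k * ψ k ^ 2) := by positivity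
        have hGle : G ψ ≤ 1 - C * (ε * curveEnergy L m ψ) := by simp only [hG]; linarith
        have hres := hC N m hm01 (sum_one_sub_highModes_le K N) ε ψ hε (by
          simp only [hG] at hGψ; linarith)
        set I := ∫ y in -b..b, (1 + ∑ k, (curveScaleDeriv ε R b m y k * ψ k) ^ 2) /
          ((∏ k, curveScale ε R b m y k) *
            Real.exp (-potential L N (assemble y fun k => curveScale ε R b m y k * ψ k) / ε))
        have hone : t ψ * ((√ε ^ (2 * N))⁻¹ * Real.exp (potentialZero L 0 / ε +
            1 / 2 * ∑ k : PerpModes N, mu L k * ψ k ^ 2) * √(2 * Real.pi * ε)) = 1 := by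
          have h1 : t ψ = c₀ * Real.exp (-(1 / 2 * ∑ k : PerpModes N, mu L k * ψ k ^ 2)) := by
            change c₀ * gaussNorm μ * ((gaussNorm μ)⁻¹ * _) = _
            rw [mul_assoc, mul_inv_cancel_left₀ hgn.ne']
          have h2 : Real.exp (-potentialZero L 0 / ε) *
              Real.exp (-(1 / 2 * ∑ k : PerpModes N, mu L k * ψ k ^ 2)) *
              Real.exp (potentialZero L 0 / ε +
                1 / 2 * ∑ k : PerpModes N, mu L k * ψ k ^ 2) = 1 := by
            rw [← Real.exp_add, ← Real.exp_add, Real.exp_eq_one_iff]; ring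
          have h3 : ∀ q κ E₀ E₁ E₂ : ℝ, q ≠ 0 → κ ≠ 0 →
              q * E₀ / κ * E₁ * (q⁻¹ * E₂ * κ) = E₀ * E₁ * E₂ := by
            intro q κ E₀ E₁ E₂ hq hκ
            field_simp
          rw [h1, hc₀, h3 _ _ _ _ _ (by positivity) hκ.ne', h2]
        -- With t I ≤ 1 + CεM one gets 2t - t² I ≥ t (1 - CεM) ≥ t G.
        have hle := mul_le_mul_of_nonneg_left hres (ht0 ψ).le
        rw [← mul_assoc (t ψ), hone, one_mul] at hle
        have h3 := mul_le_mul_of_nonneg_left hle (ht0 ψ).le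
        have h4 := mul_le_mul_of_nonneg_left hGle (ht0 ψ).le
        nlinarith)
  rw [hhint] at henergy
  have h1 : saddleCapacity L N ε = ε * (c₀ * gaussNorm μ) := by
    rw [saddleCapacity, ← gaussNorm_mu_mul hε, hc₀]; ring
  rw [h1, mul_assoc]
  refine mul_le_mul_of_nonneg_left (le_trans ?_ henergy) hε.le
  exact mul_le_mul_of_nonneg_left hGint (by positivity)

/-- Trial function and curves bound the capacity relative to the same `saddleCapacity`, and r is the
relative deviation from it. The condition ε < b²/16 serves only the upper bound. -/
theorem exists_capacity_estimate (hL : 0 < L) (hL' : L < 2 * Real.pi) {δ s : ℝ}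
    (hδ : 0 < δ) (hδL : δ < √L) (hs' : s < 1 / 2) :
    ∃ C ε₀ : ℝ, 0 < ε₀ ∧ ∀ (N : ℕ) (ε : ℝ), 0 < ε → ε < ε₀ →
      ∀ D : Set (PerpSpace N), IsClosed D →
        {ψ : PerpSpace N | sobolevNorm s ψ < √(Real.log (ε⁻¹))} ⊆ D →
        (∃! c : ℝ, IsCapacity (potential L N) ε (wellSet L ε δ D) (-wellSet L ε δ D) c) ∧
        ∀ c : ℝ, IsCapacity (potential L N) ε (wellSet L ε δ D) (-wellSet L ε δ D) c →
          ∃ r : ℝ, |r| ≤ C * ε ∧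
            c = (2 * Real.pi * ε) ^ ((N : ℝ) + 1 / 2) * √|mu L 0| *
                Real.exp (-potentialZero L 0 / ε) /
              (2 * Real.pi * √((-laplacianPerp L N - (1 : Matrix _ _ ℝ)).det)) * (1 + r) := by
  obtain ⟨C, hC⟩ := exists_saddleCapacity_le_energy hL hL' hδ hδL hs'
  set b := √L - δ with hb
  have hb0 : 0 < b := by linarith
  refine ⟨max C (16 / b ^ 2), min 1 (b ^ 2 / 16), by positivity, ?_⟩
  intro N ε hε hε₀ D hDc hD
  have hε1 : ε < 1 := hε₀.trans_le (min_le_left _ _)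
  have hεb : 16 * ε ≤ b ^ 2 := by
    have := hε₀.trans_le (min_le_right _ _)
    linarith
  have hfin := isFiniteMeasure_gibbsMeasure (integrable_exp_neg_potential hL hL' N hε)
  have hA : IsClosed (wellSet L ε δ D) := isClosed_wellSet ε δ hDc
  have hB : IsClosed (-wellSet L ε δ D) := hA.neg
  have hAb : ∀ φ ∈ wellSet L ε δ D, zeroMode φ ≤ -b := fun φ h => zeroMode_le_of_mem_wellSet h
  have hBb : ∀ φ ∈ -wellSet L ε δ D, b ≤ zeroMode φ := fun φ h => le_zeroMode_of_mem_neg_wellSet h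
  obtain ⟨χ, hχ⟩ := exists_isSeparator_of_zeroMode hb0 hAb hBb
  refine ⟨?_, fun c hc => ?_⟩
  · obtain ⟨c, hc⟩ := exists_isCapacity (continuous_potential hL N) hA hχ hε
    exact ⟨c, hc, fun c' hc' => hc'.unique hε hA hB hχ hc⟩
  · rw [← saddleCapacity_eq hL hL' hε]
    have hP := saddleCapacity_pos (N := N) hL hL' hε
    have hup := (hc.le_energy hε hA hB hχ (isAdmissible_trialPotential hε hb0 hAb hBb)).trans
      (energy_trialPotential_le_saddleCapacity hL hL' hε hb0 hεb)
    have hlow := hc.ge_of_forall_energy_ge hε hA hB hχ (hC N ε hε hε1 D hD)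
    rw [← le_div_iff₀' hP] at hlow
    rw [← div_le_iff₀' hP] at hup
    refine ⟨c / saddleCapacity L N ε - 1, ?_, ?_⟩
    · rw [abs_le]
      have h1 := mul_le_mul_of_nonneg_right (le_max_left C (16 / b ^ 2)) hε.le
      have h2 := mul_le_mul_of_nonneg_right (le_max_right C (16 / b ^ 2)) hε.le
      constructor <;> linarith
    · rw [add_sub_cancel, mul_div_cancel₀ _ hP.ne']

end LowerBound

end AllenCahn

end

open AllenCahn
theorem mainTheorem2 (L : ℝ) (hL_pos : 0 < L) (hL_lt : L < 2 * Real.pi) :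
    (∃ C ε₀ : ℝ, 0 < ε₀ ∧ ∀ (N : ℕ) (ε : ℝ), 0 < ε → ε < ε₀ →
      MeasureTheory.Integrable (fun φ => Real.exp (-potential L N φ / ε)) ∧
      ∃ r : ℝ, |r| ≤ C * ε ∧
        partitionFunction (potential L N) ε =
          2 * (2 * Real.pi * ε) ^ ((N : ℝ) + 1 / 2) /
            √(nu L 0 * (-laplacianPerp L N + (2 : ℝ) • (1 : Matrix _ _ ℝ)).det) * (1 + r)) ∧
    (∀ δ s : ℝ, 0 < δ → δ < √L → s < 1 / 2 →
      ∃ C ε₀ : ℝ, 0 < ε₀ ∧ ∀ (N : ℕ) (ε : ℝ), 0 < ε → ε < ε₀ →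
        ∀ D : Set (PerpSpace N), IsClosed D →
          {ψ : PerpSpace N | sobolevNorm s ψ < √(Real.log (ε⁻¹))} ⊆ D →
          (∃! c : ℝ, IsCapacity (potential L N) ε (wellSet L ε δ D) (-wellSet L ε δ D) c) ∧
          ∀ c : ℝ, IsCapacity (potential L N) ε (wellSet L ε δ D) (-wellSet L ε δ D) c →
            ∃ r : ℝ, |r| ≤ C * ε ∧
              c = (2 * Real.pi * ε) ^ ((N : ℝ) + 1 / 2) * √|mu L 0| *
                  Real.exp (-potentialZero L 0 / ε) /
                (2 * Real.pi * √((-laplacianPerp L N - (1 : Matrix _ _ ℝ)).det)) * (1 + r)) := by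
  exact ⟨exists_partitionFunction_estimate hL_pos hL_lt,
    fun _ _ hδ hδL hs => exists_capacity_estimate hL_pos hL_lt hδ hδL hs⟩
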